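/- Let $m\ge 1$, $n=2m+1$, $b<0$, and let $\mathcal T=y\Delta_x+\partial_y^2$ on $\mathbb R^{n+1}=\mathbb R^n_x\times\mathbb R_y$. Put $a=\tfrac23(-b)^{3/2}$ and, for $y\le b$, $$u=9(|x|^2-a^2)+12a(-y)^{3/2}+4y^3,\qquad v=9(|x|^2-a^2)-12a(-y)^{3/2}+4y^3,$$ $$D=D^n_{b,-}=\{(x,y):u<0,\ y<b\},\qquad A_m=\frac1{2^{1/3}3^{1/3}\pi^m},\qquad c_j=\frac{\Gamma(j+\frac56)\Gamma(j+\frac16)}{\Gamma(\frac56)\Gamma(\frac16)\Gamma(j+1)}.$$ Let $k=-u/9$ on $D$ and $k=0$ elsewhere. For $0\le l\le m-1$ let $\delta^{(l)}(k)=\chi_{-l-1}(k)$, where $\chi_q(s)=s^q/\Gamma(q+1)$ for $s>0$, $\chi_q(s)=0$ for $s\le0$. For $\operatorname{Re}q>-1$, $\chi_q(k)$ is a locally integrable function on $\mathbb R^{n+1}$; for other $q$ with $\operatorname{Re}q>-m-1$ it is defined as a distribution by analytic continuation in $q$, and the same applies to its products with functions of $(x,y)$ that are smooth near $\overline D$.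 Let $F$ be the Gauss hypergeometric function and $\chi_D$ the characteristic function of $D$. Then $$E_-(x,y;0,b)=A_m\sum_{j=0}^{m-1}(-1)^jc_j\Big(\frac{u-v}9\Big)^{-j-1/6}\delta^{(m-j-1)}(k)+(-1)^mA_mc_m\Big(-\frac v9\Big)^{-m-1/6}F\Big(\tfrac16,m+\tfrac16,m+1;\tfrac uv\Big)\chi_D$$ is a well-defined distribution on $\mathbb R^{n+1}$ (the last term being a locally integrable function), it is a fundamental solution of $\mathcal T$ relative to $(0,b)$, that is, $\mathcal TE_-=\delta(x,y-b)$, and its support is $\overline D$. Moreover each term of the sum over $j$ is supported by the boundary of $D$, and the support of the last term is $\overline D$. -/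

import Mathlib

open MeasureTheory
open scoped Distributions LineDeriv

namespace Tricomi

/-- The space `ℝⁿ⁺¹ = ℝⁿ × ℝ` of points `(x, y)`. -/
abbrev Space (n : ℕ) : Type := EuclideanSpace ℝ (Fin n) × ℝ

/-- Smooth compactly supported real test functions on `ℝⁿ⁺¹`. -/
abbrev Test (n : ℕ) : Type := 𝓓((⊤ : TopologicalSpace.Opens (Space n)), ℝ)

/-- Real-valued distributions on `ℝⁿ⁺¹`. -/
abbrev Distr (n : ℕ) : Type := 𝓓'((⊤ : TopologicalSpace.Opens (Space n)), ℝ)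

/-- The test function `(x, y) ↦ y φ(x, y)`. -/
noncomputable def mulY {n : ℕ} (φ : Test n) : Test n where
  toFun p := p.2 * φ p
  contDiff' := contDiff_snd.mul φ.contDiff
  hasCompactSupport' := φ.hasCompactSupport.mul_left
  tsupport_subset' := Set.subset_univ _

/-- The unit vector of `ℝⁿ⁺¹` in the direction `x_i`. -/
noncomputable def dirX {n : ℕ} (i : Fin n) : Space n := (EuclideanSpace.single i 1, 0)

/-- The unit vector of `ℝⁿ⁺¹` in the direction `y`. -/
def dirY (n : ℕ) : Space n := (0, 1)

/-- The action on test functions of the distribution `𝒯E = y Δₓ E + ∂²E/∂y²`; the product of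
a distribution `S` with the function `y` is `φ ↦ S (y φ)`. -/
noncomputable def tricomi {n : ℕ} (E : Distr n) (φ : Test n) : ℝ :=
  (∑ i : Fin n, ∂_{dirX i} (∂_{dirX i} E)) (mulY φ) + (∂_{dirY n} (∂_{dirY n} E)) φ

/-- `E` is a fundamental solution of `𝒯` relative to the point `p`: `𝒯E` is the Dirac measure
at `p`. -/
def IsFundamentalSolution {n : ℕ} (E : Distr n) (p : Space n) : Prop :=
  ∀ φ : Test n, tricomi E φ = (Distribution.delta p : Distr n) φ

/-- `a = 2(-b)^{3/2}/3`. -/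
noncomputable def aOf (b : ℝ) : ℝ := 2 * (-b) ^ (3 / 2 : ℝ) / 3

/-- `u = 9(|x|² - a²) + 12 a (-y)^{3/2} + 4 y³`. -/
noncomputable def u {n : ℕ} (b : ℝ) (p : Space n) : ℝ :=
  9 * (‖p.1‖ ^ 2 - aOf b ^ 2) + 12 * aOf b * (-p.2) ^ (3 / 2 : ℝ) + 4 * p.2 ^ 3

/-- `v = 9(|x|² - a²) - 12 a (-y)^{3/2} + 4 y³`. -/
noncomputable def v {n : ℕ} (b : ℝ) (p : Space n) : ℝ :=
  9 * (‖p.1‖ ^ 2 - aOf b ^ 2) - 12 * aOf b * (-p.2) ^ (3 / 2 : ℝ) + 4 * p.2 ^ 3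

/-- The region `{u < 0, y < b}` (the open conoid with vertex `(0, b)`). -/
def conoid (n : ℕ) (b : ℝ) : Set (Space n) := {p | u b p < 0 ∧ p.2 < b}

/-- `k = -u/9`. In the variables `x` and `t = 2(-y)^{3/2}/3`, with `t₀ = a`, this is
`(t - t₀)² - |x|²`; it is positive on the conoid. -/
noncomputable def k {n : ℕ} (b : ℝ) (p : Space n) : ℝ := -u b p / 9

/-- `B` is the distribution `w · δ^{(l)}(k)`, where `k = -u/9` on the conoid and `k` is replaced
by `0` outside of it, and `w` is a real function, smooth near the closure of the conoid.

Here `δ^{(l)}(k) = χ_{-l-1}(k)`, where `χ_q(s) = s^q / Γ(q+1)` for `s > 0` and `χ_q(s) = 0` for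
`s ≤ 0`. For `Re q > -1` the distribution `w χ_q(k)` is a function, and for other `q` it is defined
by analytic continuation in `q`: for every test function `φ`, `B φ` is the value at `q = -l-1`
of an analytic function on the half-plane `Re q > -l-2` which is equal to `∫ w χ_q(k) φ` when
`Re q > -1`. There is at most one such analytic function. -/
def IsWeightedDelta {n : ℕ} (b : ℝ) (l : ℕ) (w : Space n → ℝ) (B : Distr n) : Prop :=
  ∀ φ : Test n, ∃ g : ℂ → ℂ,
    DifferentiableOn ℂ g {q : ℂ | -(l : ℝ) - 2 < q.re} ∧
    (∀ q : ℂ, -1 < q.re →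
      IntegrableOn (fun p : Space n ↦
        ((k b p : ℝ) : ℂ) ^ q / Complex.Gamma (q + 1) * ((w p * φ p : ℝ) : ℂ)) (conoid n b) ∧
      g q = ∫ p in conoid n b,
        ((k b p : ℝ) : ℂ) ^ q / Complex.Gamma (q + 1) * ((w p * φ p : ℝ) : ℂ)) ∧
    g (-(l : ℂ) - 1) = ((B φ : ℝ) : ℂ)

/-- `A_m = 1 / (2^{1/3} 3^{1/3} π^m)`. -/
noncomputable def A (m : ℕ) : ℝ :=
  1 / ((2 : ℝ) ^ (1 / 3 : ℝ) * (3 : ℝ) ^ (1 / 3 : ℝ) * Real.pi ^ m)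

/-- `c_j = Γ(j + 5/6) Γ(j + 1/6) / (Γ(5/6) Γ(1/6) Γ(j + 1))`. -/
noncomputable def c (j : ℕ) : ℝ :=
  Real.Gamma (j + 5 / 6) * Real.Gamma (j + 1 / 6) /
    (Real.Gamma (5 / 6) * Real.Gamma (1 / 6) * Real.Gamma (j + 1))

/-- The function `(-1)^m A_m c_m (-v/9)^{-m-1/6} F(1/6, m+1/6, m+1; u/v)` on the conoid,
extended by zero. -/
noncomputable def regularPart (m : ℕ) (b : ℝ) : Space (2 * m + 1) → ℝ :=
  (conoid (2 * m + 1) b).indicator fun p ↦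
    (-1) ^ m * A m * c m * (-v b p / 9) ^ (-(m : ℝ) - 1 / 6) *
      ordinaryHypergeometric (1 / 6 : ℝ) ((m : ℝ) + 1 / 6) ((m : ℝ) + 1) (u b p / v b p)

end Tricomi

/-!
In the variables `x` and `t = 2(-y)^{3/2}/3`, with `a` the value of `t` at the vertex, one has
`k = (t - a)² - |x|²` and `(u - v)/9 = 4at`, `-v/9 = k + 4at`. All terms of `E` are therefore of the
form `g χ_q(k)` with `g` smooth near the closed conoid, and everything rests on the formula for
`𝒯(g χ_q(k))`, where `𝒯` is formally self-adjoint: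
`𝒯(g χ_q(k)) = 4(q-1)(-y) g χ_{q-1}(k) + (transport g) χ_{q-1}(k) + (𝒯g) χ_q(k)`
(`riesz_mul_tri`, extended to smaller exponents in `rieszC_mul_tri`).

The continuation in `q` comes from the same formula. A second-order operator raises the exponent,
`riesz_ascend`, in the way in which the wave operator acts on the classical Riesz family, with the
factor `4q + 2n - 2`. Dividing by this factor defines `rieszC` for `Re q > -(n+1)/2`, which for
`n = 2m + 1` contains all the exponents in `E`. At the next exponent there is a pole, and its residue
is a Dirac measure at the vertex (`tendsto_rieszC_vertex`): on functions of `y` this is an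
integration by parts, and terms with a factor `x_i` do not contribute.

For the weight `(4at)^{-j-1/6}` and `q = j - m`, the formula leaves one term with `χ_{q-1}(k)` and
one with `χ_q(k)`, both having weights of the same kind (`rieszC_wt_mul_tri`); for `j = 0` there is
the Dirac measure in addition. The recursion for `c_j` makes the sum over `j` telescope
(`sum_rieszC_wt_mul_tri`). What is left is a multiple of `δ(k)`, and the last term of `E` cancels it:
it is `(4at)^{-m-1/6} f(k/(4at))` with `f` the Pfaff transform of the hypergeometric function, the
hypergeometric equation for `f` (`pfaff_ode`) gives `𝒯` of it inside the conoid as zero (`tri_tail`),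
and `f(0) = 1` determines the multiple of `δ(k)` (`rieszC_regularFactor_mul_tri`).

The supports follow from `k χ_q(k) = (q+1) χ_{q+1}(k)`, which annihilates `χ_{-l-1}(k)` inside the
conoid (`rieszC_neg_eq_zero`), and from the positivity of the hypergeometric function on `[0, 1)`.
-/

open Set Filter Topology
open scoped ContDiff

namespace Tricomi

/-! ### Integrals depending on a parameter -/

/-- An integral of functions depending holomorphically on `q` is differentiable in `q` if the
integrand has an integrable bound near `q₀`; the derivatives are then bounded by Cauchy's estimate,
so no separate bound on them is needed. -/
lemma differentiableAt_integral_of_norm_le {α : Type*} [MeasurableSpace α] {μ : Measure α}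
    {F : ℂ → α → ℂ} {q₀ : ℂ} {δ : ℝ} {bound : α → ℝ} (hδ : 0 < δ)
    (hmeas : ∀ q, AEStronglyMeasurable (F q) μ)
    (hdiff : ∀ᵐ a ∂μ, Differentiable ℂ fun q => F q a)
    (hle : ∀ᵐ a ∂μ, ∀ q ∈ Metric.closedBall q₀ (2 * δ), ‖F q a‖ ≤ bound a)
    (hbound : Integrable bound μ) :
    DifferentiableAt ℂ (fun q => ∫ a, F q a ∂μ) q₀ := by
  have hq₀ : q₀ ∈ Metric.closedBall q₀ (2 * δ) := Metric.mem_closedBall_self (by positivity)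
  have hF' : AEStronglyMeasurable (fun a => deriv (fun q => F q a) q₀) μ := by
    refine aestronglyMeasurable_of_tendsto_ae (𝓝[≠] (0 : ℂ))
      (f := fun t a => t⁻¹ * (F (q₀ + t) a - F q₀ a))
      (fun t => ((hmeas (q₀ + t)).sub (hmeas q₀)).const_mul t⁻¹) ?_
    filter_upwards [hdiff] with a ha
    have h1 := hasDerivAt_iff_tendsto_slope_zero.1 (ha q₀).hasDerivAt
    simpa only [smul_eq_mul] using h1
  refine (hasDerivAt_integral_of_dominated_loc_of_deriv_le (Metric.ball_mem_nhds q₀ hδ)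
    (bound := fun a => bound a / δ) (F' := fun q a => deriv (fun q => F q a) q)
    (.of_forall hmeas) ?_ hF' ?_ (hbound.div_const δ) ?_).2.differentiableAt
  · exact hbound.mono' (hmeas q₀) (hle.mono fun a ha => ha q₀ hq₀)
  · filter_upwards [hdiff, hle] with a ha hla q hq
    refine Complex.norm_deriv_le_of_forall_mem_sphere_norm_le hδ ha.diffContOnCl fun z hz => ?_
    refine hla z ?_
    rw [mem_sphere_iff_norm] at hz
    rw [mem_ball_iff_norm] at hq
    rw [mem_closedBall_iff_norm]
    calc ‖z - q₀‖ = ‖(z - q) + (q - q₀)‖ := by ring_nf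
      _ ≤ 2 * δ := (norm_add_le _ _).trans (by linarith)
  · filter_upwards [hdiff] with a ha q _ using (ha q).hasDerivAt

lemma contDiff_intervalIntegral {E F : Type} [NormedAddCommGroup E] [NormedSpace ℝ E]
    [ProperSpace E] [NormedAddCommGroup F] [NormedSpace ℝ F] [CompleteSpace F]
    {f : ℝ → E → F} (hf : ContDiff ℝ ∞ fun z : ℝ × E => f z.1 z.2) :
    ContDiff ℝ ∞ fun x => ∫ τ in (0 : ℝ)..1, f τ x := by
  rw [contDiff_infty]
  intro N
  induction N generalizing F with
  | zero =>
    refine contDiff_zero.2 ?_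
    exact intervalIntegral.continuous_parametric_intervalIntegral_of_continuous'
      (f := fun x τ => f τ x) (hf.continuous.comp continuous_swap) 0 1
  | succ N ih =>
    set f' : ℝ → E → E →L[ℝ] F := fun τ x =>
      (fderiv ℝ (fun z : ℝ × E => f z.1 z.2) (τ, x)).comp (ContinuousLinearMap.inr ℝ ℝ E) with hf'
    have hf's : ContDiff ℝ ∞ fun z : ℝ × E => f' z.1 z.2 :=
      (hf.fderiv_right (m := ∞) (by simp)).clm_comp contDiff_const
    have hd : ∀ τ x, HasFDerivAt (fun x => f τ x) (f' τ x) x := fun τ x => by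
      have h1 : HasFDerivAt (fun x : E => ((τ, x) : ℝ × E)) (ContinuousLinearMap.inr ℝ ℝ E) x :=
        hasFDerivAt_prodMk_right τ x
      exact ((hf.differentiable (by simp) (τ, x)).hasFDerivAt).comp x h1
    refine contDiff_succ_iff_hasFDerivAt.2 ⟨fun x => ∫ τ in (0 : ℝ)..1, f' τ x, ih hf's,
      fun x₀ => ?_⟩
    have hK : IsCompact (Icc (0 : ℝ) 1 ×ˢ Metric.closedBall x₀ 1) :=
      isCompact_Icc.prod (isCompact_closedBall _ _)
    obtain ⟨C, hC⟩ := hK.exists_bound_of_continuousOn hf's.continuous.continuousOn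
    have hslice : ∀ x, Continuous fun τ => f τ x := fun x =>
      hf.continuous.comp (continuous_id.prodMk continuous_const)
    have hslice' : ∀ x, Continuous fun τ => f' τ x := fun x =>
      hf's.continuous.comp (continuous_id.prodMk continuous_const)
    refine intervalIntegral.hasFDerivAt_integral_of_dominated_of_fderiv_le (bound := fun _ => C)
      (s := Metric.ball x₀ 1) (F := fun x τ => f τ x) (F' := fun x τ => f' τ x)
      (Metric.ball_mem_nhds x₀ one_pos)
      (.of_forall fun x => (hslice x).aestronglyMeasurable) ((hslice x₀).intervalIntegrable _ _)
      (hslice' x₀).aestronglyMeasurable ?_ intervalIntegrable_const ?_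
    · refine ae_of_all _ fun τ hτ x hx => hC (τ, x) ⟨?_, Metric.ball_subset_closedBall hx⟩
      rw [uIoc_of_le zero_le_one] at hτ
      exact Ioc_subset_Icc_self hτ
    · exact ae_of_all _ fun τ _ x _ => hd τ x

section

variable {n : ℕ} {b : ℝ}

/-- The function `ρ = √(-y)`, smooth for `y < 0`. -/
noncomputable def rho (y : ℝ) : ℝ := √(-y)

/-- The variable `t = 2(-y)^{3/2}/3`, written as `2ρ³/3`; `dt/dy = -ρ`. -/
noncomputable def tOf (y : ℝ) : ℝ := 2 / 3 * rho y ^ 3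

/-- An open neighbourhood of the closed conoid on which all weights are smooth. The second
condition says that `k > -2at`, so that `k / (4at) > -1/2` there. -/
def nbhd (n : ℕ) (b : ℝ) : Set (Space n) :=
  {p | p.2 < 0 ∧ ‖p.1‖ ^ 2 < tOf p.2 ^ 2 + aOf b ^ 2}

lemma rho_pos {y : ℝ} (hy : y < 0) : 0 < rho y := Real.sqrt_pos.2 (by linarith)

lemma rho_sq {y : ℝ} (hy : y ≤ 0) : rho y ^ 2 = -y := Real.sq_sqrt (by linarith)

lemma tOf_pos {y : ℝ} (hy : y < 0) : 0 < tOf y := by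
  have := rho_pos hy
  unfold tOf; positivity

lemma neg_rpow_eq {y : ℝ} (hy : y ≤ 0) : (-y) ^ (3 / 2 : ℝ) = rho y ^ 3 := by
  rw [rho, Real.sqrt_eq_rpow, ← Real.rpow_natCast, ← Real.rpow_mul (by linarith)]
  norm_num

lemma aOf_eq_tOf (hb : b ≤ 0) : aOf b = tOf b := by
  rw [aOf, tOf, neg_rpow_eq hb]; ring

lemma k_eq {p : Space n} (hp : p.2 ≤ 0) : k b p = (tOf p.2 - aOf b) ^ 2 - ‖p.1‖ ^ 2 := by
  have h2 := rho_sq hp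
  have h3 : p.2 ^ 3 = - (rho p.2 ^ 3) ^ 2 := by
    have : p.2 = - rho p.2 ^ 2 := by linarith
    calc p.2 ^ 3 = (- rho p.2 ^ 2) ^ 3 := by rw [← this]
      _ = _ := by ring
  rw [k, u, neg_rpow_eq hp, tOf, h3]
  ring

lemma neg_v_eq {p : Space n} (hp : p.2 ≤ 0) :
    -v b p / 9 = k b p + 4 * aOf b * tOf p.2 := by
  rw [k, u, v, neg_rpow_eq hp, tOf]; ring

lemma u_sub_v_eq {p : Space n} (hp : p.2 ≤ 0) :
    (u b p - v b p) / 9 = 4 * aOf b * tOf p.2 := by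
  rw [u, v, neg_rpow_eq hp, tOf]; ring

lemma rho_strictAnti {y z : ℝ} (h : y < z) (hz : z ≤ 0) : rho z < rho y :=
  Real.sqrt_lt_sqrt (by linarith) (by linarith)

lemma rho_anti {y z : ℝ} (h : y ≤ z) : rho z ≤ rho y :=
  Real.sqrt_le_sqrt (by linarith)

lemma rho_nonneg (y : ℝ) : 0 ≤ rho y := Real.sqrt_nonneg _

lemma tOf_anti {y z : ℝ} (h : y ≤ z) : tOf z ≤ tOf y := by
  have := rho_anti h
  have := rho_nonneg z
  unfold tOf; gcongr

lemma tOf_strictAnti {y z : ℝ} (h : y < z) (hz : z ≤ 0) : tOf z < tOf y := by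
  have := rho_strictAnti h hz
  have := rho_nonneg z
  unfold tOf; gcongr

lemma continuous_rho : Continuous rho := by unfold rho; fun_prop

lemma continuous_tOf : Continuous tOf := by
  have := continuous_rho
  unfold tOf; fun_prop

lemma hasDerivAt_rho {y : ℝ} (hy : y < 0) : HasDerivAt rho (-1 / (2 * rho y)) y := by
  exact (hasDerivAt_neg y).sqrt (by linarith : -y ≠ 0)

lemma hasDerivAt_tOf {y : ℝ} (hy : y < 0) : HasDerivAt tOf (-rho y) y := by
  have h := ((hasDerivAt_rho hy).pow 3).const_mul (2 / 3 : ℝ)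
  have h0 := (rho_pos hy).ne'
  convert! h using 1
  field_simp
  norm_num
  ring

lemma contDiffOn_rho : ContDiffOn ℝ ∞ rho (Iio 0) := by
  unfold rho
  refine ContDiffOn.sqrt contDiff_neg.contDiffOn fun y hy => ?_
  have : y < 0 := hy
  linarith

lemma contDiffOn_tOf : ContDiffOn ℝ ∞ tOf (Iio 0) := by
  have := contDiffOn_rho
  unfold tOf; fun_prop

lemma isOpen_nbhd : IsOpen (nbhd n b) := by
  have := continuous_tOf
  have h1 : IsOpen {p : Space n | ‖p.1‖ ^ 2 < tOf p.2 ^ 2 + aOf b ^ 2} :=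
    isOpen_lt (by fun_prop) (by fun_prop)
  exact (isOpen_lt continuous_snd continuous_const).inter h1

lemma continuous_u : Continuous (u (n := n) b) := by
  unfold u
  have : Continuous fun p : Space n => (-p.2) ^ (3 / 2 : ℝ) :=
    (continuous_snd.neg).rpow_const fun _ => Or.inr (by norm_num)
  fun_prop

lemma continuous_k : Continuous (k (n := n) b) := by
  have := continuous_u (n := n) (b := b)
  unfold k; fun_prop

lemma isOpen_conoid : IsOpen (conoid n b) :=
  (isOpen_lt continuous_u continuous_const).inter (isOpen_lt continuous_snd continuous_const)

lemma mem_conoid_iff {p : Space n} : p ∈ conoid n b ↔ 0 < k b p ∧ p.2 < b := by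
  have : u b p < 0 ↔ 0 < k b p := by
    unfold k
    constructor <;> intro h <;> linarith
  simp [conoid, this]

/-- The part `y ≥ Y` of the closed conoid. -/
def trunc (n : ℕ) (b Y : ℝ) : Set (Space n) :=
  {p | Y ≤ p.2 ∧ p.2 ≤ b ∧ ‖p.1‖ ≤ tOf p.2 - aOf b}

lemma norm_lt_of_mem_conoid (hb : b < 0) {p : Space n} (hp : p ∈ conoid n b) :
    ‖p.1‖ < tOf p.2 - aOf b := by
  obtain ⟨h1, h2⟩ := mem_conoid_iff.1 hp
  rw [k_eq (by linarith)] at h1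
  have h3 : aOf b ≤ tOf p.2 := by rw [aOf_eq_tOf hb.le]; exact tOf_anti h2.le
  exact lt_of_pow_lt_pow_left₀ 2 (by linarith) (by linarith)

lemma mem_conoid_iff_norm (hb : b < 0) {p : Space n} :
    p ∈ conoid n b ↔ p.2 < b ∧ ‖p.1‖ < tOf p.2 - aOf b := by
  refine ⟨fun h => ⟨h.2, norm_lt_of_mem_conoid hb h⟩, fun ⟨h1, h2⟩ => ?_⟩
  rw [mem_conoid_iff, k_eq (by linarith)]
  refine ⟨?_, h1⟩
  have := norm_nonneg p.1
  nlinarith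

lemma mem_trunc_of_mem_conoid (hb : b < 0) {Y : ℝ} {p : Space n} (hp : p ∈ conoid n b)
    (hY : Y ≤ p.2) : p ∈ trunc n b Y :=
  ⟨hY, hp.2.le, (norm_lt_of_mem_conoid hb hp).le⟩

lemma isCompact_trunc (Y : ℝ) : IsCompact (trunc n b Y) := by
  have hc := continuous_tOf
  refine Metric.isCompact_of_isClosed_isBounded ?_ ?_
  · have h1 : IsClosed {p : Space n | ‖p.1‖ ≤ tOf p.2 - aOf b} :=
      isClosed_le (by fun_prop) (by fun_prop)
    exact (isClosed_le continuous_const continuous_snd).inter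
      ((isClosed_le continuous_snd continuous_const).inter h1)
  · refine ((Metric.isBounded_closedBall (x := (0 : EuclideanSpace ℝ (Fin n)))
      (r := tOf Y - aOf b)).prod (Metric.isBounded_Icc Y b)).subset ?_
    rintro p ⟨h1, h2, h3⟩
    refine ⟨?_, h1, h2⟩
    have := tOf_anti h1
    simp only [Metric.mem_closedBall, dist_zero_right]
    linarith

lemma aOf_pos (hb : b < 0) : 0 < aOf b := by rw [aOf_eq_tOf hb.le]; exact tOf_pos hb

lemma mem_nbhd_of_norm_le (hb : b < 0) {p : Space n} (h : p.2 ≤ b)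
    (h' : ‖p.1‖ ≤ tOf p.2 - aOf b) : p ∈ nbhd n b := by
  have h1 : p.2 < 0 := by linarith
  refine ⟨h1, ?_⟩
  have := norm_nonneg p.1
  have := aOf_pos hb
  have := tOf_pos h1
  nlinarith

lemma trunc_subset_nbhd (hb : b < 0) (Y : ℝ) : trunc n b Y ⊆ nbhd n b :=
  fun _ hp => mem_nbhd_of_norm_le hb hp.2.1 hp.2.2

lemma conoid_subset_nbhd (hb : b < 0) : conoid n b ⊆ nbhd n b :=
  fun _ hp => mem_nbhd_of_norm_le hb hp.2.le (norm_lt_of_mem_conoid hb hp).le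

/-! ### Directional derivatives and admissible functions -/

/-- The derivative of `ψ` in the direction `w`. -/
noncomputable def pd (w : Space n) (ψ : Space n → ℝ) (p : Space n) : ℝ := fderiv ℝ ψ p w

/-- Smoothness near the closure of the conoid, encoded as smoothness on `nbhd n b`. -/
def SmoothNear (b : ℝ) (ψ : Space n → ℝ) : Prop := ContDiffOn ℝ ∞ ψ (nbhd n b)

/-- Admissible functions: smooth near the conoid and zero there for `y < Y`. The part of the closed
conoid with `Y ≤ y` is compact, so these play the role of products of a test function with a
weight, and the class is closed under differentiation and multiplication by weights. -/
structure IsAdm (b Y : ℝ) (ψ : Space n → ℝ) : Prop where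
  smooth : SmoothNear b ψ
  zero : ∀ p ∈ nbhd n b, p.2 < Y → ψ p = 0

section
variable {f g : Space n → ℝ} {Y : ℝ} {w : Space n}

lemma SmoothNear.add (hf : SmoothNear b f) (hg : SmoothNear b g) :
    SmoothNear b (fun p => f p + g p) := ContDiffOn.add hf hg
lemma SmoothNear.sub (hf : SmoothNear b f) (hg : SmoothNear b g) :
    SmoothNear b (fun p => f p - g p) := ContDiffOn.sub hf hg
lemma SmoothNear.neg (hf : SmoothNear b f) : SmoothNear b (fun p => - f p) := ContDiffOn.neg hf
lemma SmoothNear.mul (hf : SmoothNear b f) (hg : SmoothNear b g) :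
    SmoothNear b (fun p => f p * g p) := ContDiffOn.mul hf hg
lemma SmoothNear.div (hf : SmoothNear b f) (hg : SmoothNear b g) (h : ∀ p ∈ nbhd n b, g p ≠ 0) :
    SmoothNear b (fun p => f p / g p) := ContDiffOn.div hf hg h
lemma SmoothNear.const (a : ℝ) : SmoothNear b (fun _ : Space n => a) := contDiffOn_const
lemma SmoothNear.sum {ι : Type*} {s : Finset ι} {f : ι → Space n → ℝ}
    (hf : ∀ i ∈ s, SmoothNear b (f i)) : SmoothNear b (fun p => ∑ i ∈ s, f i p) :=
  ContDiffOn.sum hf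
lemma SmoothNear.comp_snd {g : ℝ → ℝ} (hg : ContDiffOn ℝ ∞ g (Iio 0)) :
    SmoothNear b (fun p : Space n => g p.2) :=
  ContDiffOn.comp hg contDiff_snd.contDiffOn fun _ hp => hp.1
lemma SmoothNear.congr (hf : SmoothNear b f) (h : ∀ p ∈ nbhd n b, g p = f p) :
    SmoothNear b g := ContDiffOn.congr hf h

lemma SmoothNear.differentiableAt (hf : SmoothNear b f) {p : Space n} (hp : p ∈ nbhd n b) :
    DifferentiableAt ℝ f p :=
  (ContDiffOn.contDiffAt hf (isOpen_nbhd.mem_nhds hp)).differentiableAt (by simp)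

lemma SmoothNear.pd (hf : SmoothNear b f) (w : Space n) : SmoothNear b (pd w f) := by
  have h := (contDiffOn_infty_iff_fderiv_of_isOpen isOpen_nbhd).1 hf
  exact h.2.clm_apply contDiffOn_const

lemma pd_congr (h : ∀ p ∈ nbhd n b, f p = g p) {p : Space n} (hp : p ∈ nbhd n b) :
    pd w f p = pd w g p := by
  have : f =ᶠ[𝓝 p] g := by
    filter_upwards [isOpen_nbhd.mem_nhds hp] with q hq using h q hq
  simp [pd, this.fderiv_eq]

lemma pd_add (hf : SmoothNear b f) (hg : SmoothNear b g) {p : Space n} (hp : p ∈ nbhd n b) :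
    pd w (fun p => f p + g p) p = pd w f p + pd w g p := by
  simp [pd, fderiv_fun_add (hf.differentiableAt hp) (hg.differentiableAt hp)]

lemma pd_mul (hf : SmoothNear b f) (hg : SmoothNear b g) {p : Space n} (hp : p ∈ nbhd n b) :
    pd w (fun p => f p * g p) p = f p * pd w g p + pd w f p * g p := by
  simp [pd, fderiv_fun_mul (hf.differentiableAt hp) (hg.differentiableAt hp)]
  ring

lemma pd_comp_snd {g : ℝ → ℝ} {g' : ℝ} {p : Space n} (hg : HasDerivAt g g' p.2) :
    pd w (fun p : Space n => g p.2) p = g' * w.2 := by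
  have := (hg.hasFDerivAt.comp p (hasFDerivAt_snd (𝕜 := ℝ) (p := p))).fderiv
  simp only [pd]
  change fderiv ℝ (g ∘ Prod.snd) p w = _
  rw [this]
  simp [mul_comm]

lemma pd_comp {g : ℝ → ℝ} {g' : ℝ} {p : Space n} (hg : HasDerivAt g g' (f p))
    (hf : SmoothNear b f) (hp : p ∈ nbhd n b) :
    pd w (fun p : Space n => g (f p)) p = g' * pd w f p := by
  have := (hg.comp_hasFDerivAt p (hf.differentiableAt hp).hasFDerivAt).fderiv
  simp only [pd]
  change fderiv ℝ (g ∘ f) p w = _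
  rw [this]
  simp

lemma IsAdm.add (hf : IsAdm b Y f) (hg : IsAdm b Y g) : IsAdm b Y (fun p => f p + g p) :=
  ⟨hf.smooth.add hg.smooth, fun p hp h => by simp [hf.zero p hp h, hg.zero p hp h]⟩
lemma IsAdm.sum {ι : Type*} {s : Finset ι} {f : ι → Space n → ℝ}
    (hf : ∀ i ∈ s, IsAdm b Y (f i)) : IsAdm b Y (fun p => ∑ i ∈ s, f i p) :=
  ⟨.sum fun i hi => (hf i hi).smooth, fun p hp h =>
    Finset.sum_eq_zero fun i hi => (hf i hi).zero p hp h⟩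
lemma IsAdm.mul_left (hf : SmoothNear b f) (hg : IsAdm b Y g) : IsAdm b Y (fun p => f p * g p) :=
  ⟨hf.mul hg.smooth, fun p hp h => by simp [hg.zero p hp h]⟩
lemma IsAdm.pd (hf : IsAdm b Y f) (w : Space n) : IsAdm b Y (pd w f) := by
  refine ⟨hf.smooth.pd w, fun p hp h => ?_⟩
  have : f =ᶠ[𝓝 p] fun _ => 0 := by
    filter_upwards [isOpen_nbhd.mem_nhds hp,
      (isOpen_lt continuous_snd continuous_const).mem_nhds h] with q hq hq' using hf.zero q hq hq'
  simp [Tricomi.pd, this.fderiv_eq]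
lemma IsAdm.mono {Y' : ℝ} (hf : IsAdm b Y f) (h : Y' ≤ Y) : IsAdm b Y' f :=
  ⟨hf.smooth, fun p hp h' => hf.zero p hp (by linarith)⟩

end

/-! ### Derivatives of `k` -/

lemma smoothNear_rho : SmoothNear b (fun p : Space n => rho p.2) := .comp_snd contDiffOn_rho
lemma smoothNear_tOf : SmoothNear b (fun p : Space n => tOf p.2) := .comp_snd contDiffOn_tOf
lemma smoothNear_snd : SmoothNear b (fun p : Space n => p.2) := contDiff_snd.contDiffOn
lemma smoothNear_coord (i : Fin n) : SmoothNear b (fun p : Space n => p.1 i) := by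
  have : ContDiff ℝ ∞ (fun p : Space n => p.1 i) := by fun_prop
  exact this.contDiffOn

lemma pd_coord (i : Fin n) (w p : Space n) : pd w (fun p : Space n => p.1 i) p = w.1 i := by
  have h : HasFDerivAt (fun p : Space n => p.1 i)
    ((EuclideanSpace.proj (𝕜 := ℝ) i).comp (ContinuousLinearMap.fst ℝ _ ℝ)) p :=
    ((EuclideanSpace.proj (𝕜 := ℝ) i).comp (ContinuousLinearMap.fst ℝ _ ℝ)).hasFDerivAt
  simp [pd, h.fderiv]

lemma pd_norm_sq (w p : Space n) :
    pd w (fun p : Space n => ‖p.1‖ ^ 2) p = 2 * inner ℝ p.1 w.1 := by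
  have h := (hasFDerivAt_fst (𝕜 := ℝ) (p := p)).norm_sq
  simp [pd, h.fderiv]

lemma smoothNear_k : SmoothNear b (k (n := n) b) := by
  have h : SmoothNear b fun p : Space n => (tOf p.2 - aOf b) ^ 2 - ‖p.1‖ ^ 2 := by
    refine ContDiffOn.sub ((smoothNear_tOf.sub (.const _)).pow 2) ?_
    exact (contDiff_fst.norm_sq ℝ).contDiffOn
  exact h.congr fun p hp => k_eq hp.1.le

lemma pd_k {w p : Space n} (hp : p ∈ nbhd n b) :
    pd w (k b) p = -2 * (tOf p.2 - aOf b) * rho p.2 * w.2 - 2 * inner ℝ p.1 w.1 := by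
  rw [pd_congr (g := fun p => (tOf p.2 - aOf b) ^ 2 + (-1) * ‖p.1‖ ^ 2)
    (fun p hp => by rw [k_eq hp.1.le]; ring) hp]
  have h1 : SmoothNear b fun p : Space n => (tOf p.2 - aOf b) ^ 2 :=
    (smoothNear_tOf.sub (.const _)).pow 2
  have h3 : SmoothNear b fun p : Space n => ‖p.1‖ ^ 2 := (contDiff_fst.norm_sq ℝ).contDiffOn
  have h2 : SmoothNear b fun p : Space n => (-1) * ‖p.1‖ ^ 2 := (SmoothNear.const (-1)).mul h3
  rw [pd_add h1 h2 hp, pd_mul (.const _) h3 hp, pd_norm_sq,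
    pd_comp_snd (((hasDerivAt_tOf hp.1).sub_const (aOf b)).fun_pow 2)]
  have : pd w (fun _ : Space n => (-1 : ℝ)) p = 0 := by simp [pd]
  rw [this]
  simp
  ring

end

section

/-! ### Radial integrals and integrability of powers of `k` -/

lemma integral_rpow_mul_sub_rpow {α β c : ℝ} (hα : 0 < α) (hβ : 0 < β) (hc : 0 < c) :
    ∫ w in (0 : ℝ)..c, w ^ (α - 1) * (c - w) ^ (β - 1)
      = c ^ (α + β - 1) * ProbabilityTheory.beta α β := by
  have h := Complex.betaIntegral_scaled (α : ℂ) (β : ℂ) hc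
  have h2 : Complex.betaIntegral α β = (ProbabilityTheory.beta α β : ℝ) := by
    rw [Complex.betaIntegral_eq_Gamma_mul_div, ProbabilityTheory.beta]
    · rw [← Complex.ofReal_add, Complex.Gamma_ofReal, Complex.Gamma_ofReal, Complex.Gamma_ofReal]
      push_cast; rfl
    all_goals simpa
  rw [h2] at h
  have h3 : ((∫ w in (0 : ℝ)..c, w ^ (α - 1) * (c - w) ^ (β - 1) : ℝ) : ℂ) =
      ((c ^ (α + β - 1) * ProbabilityTheory.beta α β : ℝ) : ℂ) := by
    rw [← intervalIntegral.integral_ofReal, Complex.ofReal_mul, Complex.ofReal_cpow hc.le]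
    push_cast
    rw [← h]
    refine intervalIntegral.integral_congr fun w hw => ?_
    rw [uIcc_of_le hc.le] at hw
    rw [Complex.ofReal_cpow hw.1, Complex.ofReal_cpow (by linarith [hw.2])]
    push_cast
    rfl
  exact_mod_cast h3

lemma integral_radial {n : ℕ} (hn : 0 < n) {s σ : ℝ} (hs : 0 < s) (hσ : -1 < σ) :
    ∫ x : EuclideanSpace ℝ (Fin n), (if ‖x‖ < s then (s ^ 2 - ‖x‖ ^ 2) ^ σ else 0) =
      Real.pi ^ (n / 2 : ℝ) * Real.Gamma (σ + 1) / Real.Gamma (σ + 1 + n / 2) *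
        s ^ (2 * σ + n) := by
  have : Nonempty (Fin n) := ⟨⟨0, hn⟩⟩
  have hn' : (0 : ℝ) < n := by exact_mod_cast hn
  rw [integral_fun_norm_addHaar volume (fun r : ℝ => if r < s then (s ^ 2 - r ^ 2) ^ σ else 0)]
  have h1 : ∫ r in Ioi (0 : ℝ), r ^ (n - 1) • (if r < s then (s ^ 2 - r ^ 2) ^ σ else 0) =
      1 / 2 * (s ^ (2 * σ + n) * ProbabilityTheory.beta (n / 2) (σ + 1)) := by
    have h2 := integral_comp_rpow_Ioi_of_pos (p := 2) two_pos (g := fun w : ℝ =>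
      (Iic (s ^ 2)).indicator (fun w => 1 / 2 * (w ^ ((n / 2 : ℝ) - 1) *
        (s ^ 2 - w) ^ (σ + 1 - 1))) w)
    rw [setIntegral_indicator measurableSet_Iic, Ioi_inter_Iic, integral_const_mul,
      ← intervalIntegral.integral_of_le (by positivity),
      integral_rpow_mul_sub_rpow (by positivity) (by linarith) (by positivity)] at h2
    have h4 : (s ^ 2) ^ ((n : ℝ) / 2 + (σ + 1) - 1) = s ^ (2 * σ + n) := by
      rw [← Real.rpow_natCast, ← Real.rpow_mul hs.le]
      congr 1; push_cast; ring
    rw [h4] at h2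
    rw [← h2]
    have hne : ∀ᵐ r : ℝ ∂(volume.restrict (Ioi 0)), r ≠ s :=
      ae_restrict_of_ae (by simp [ae_iff])
    refine integral_congr_ae ?_
    filter_upwards [hne, ae_restrict_mem measurableSet_Ioi] with r hrs hr
    have hr : 0 < r := hr
    have h5 : r ^ (2 : ℝ) = r ^ 2 := Real.rpow_natCast r 2
    rw [h5]
    by_cases h : r < s
    · have : r ^ 2 ∈ Iic (s ^ 2) := by simp only [mem_Iic]; gcongr
      simp only [this, indicator_of_mem, h, if_true, smul_eq_mul]
      have h6 : r ^ (n - 1) = r * (r ^ 2) ^ ((n : ℝ) / 2 - 1) := by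
        rw [← Real.rpow_natCast (r) 2, ← Real.rpow_mul hr.le, ← Real.rpow_natCast,
          mul_comm, ← Real.rpow_add_one hr.ne']
        congr 1
        rw [Nat.cast_sub hn]; push_cast; ring
      rw [h6]
      norm_num
      ring
    · have h' : s < r := lt_of_le_of_ne (not_lt.1 h) (Ne.symm hrs)
      have : r ^ 2 ∉ Iic (s ^ 2) := by simp only [mem_Iic, not_le]; gcongr
      simp [this, h]
  have h7 : (volume.real (Metric.ball (0 : EuclideanSpace ℝ (Fin n)) 1)) =
      Real.pi ^ (n / 2 : ℝ) / Real.Gamma (n / 2 + 1) := by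
    rw [Measure.real, EuclideanSpace.volume_ball]
    have : 0 < Real.Gamma ((n : ℝ) / 2 + 1) := Real.Gamma_pos_of_pos (by positivity)
    simp only [ENNReal.ofReal_one, one_pow, one_mul, Fintype.card_fin]
    rw [ENNReal.toReal_ofReal (by positivity), Real.sqrt_eq_rpow, ← Real.rpow_natCast,
      ← Real.rpow_mul Real.pi_pos.le]
    congr 2; ring
  rw [finrank_euclideanSpace_fin, h1, h7, Real.Gamma_add_one (by positivity),
    ProbabilityTheory.beta]
  have h8 := (Real.Gamma_pos_of_pos (show (0 : ℝ) < n / 2 by positivity)).ne'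
  have h9 : (n : ℝ) / 2 + (σ + 1) = σ + 1 + n / 2 := by ring
  rw [h9]
  have h10 := (Real.Gamma_pos_of_pos (show (0 : ℝ) < σ + 1 + n / 2 by linarith [half_pos hn'])).ne'
  simp only [nsmul_eq_mul, smul_eq_mul]
  field_simp

/-- If the function were not integrable, its integral would be the junk value `0`, while
`integral_radial` shows it to be positive. -/
lemma integrable_radial {n : ℕ} (hn : 0 < n) {s σ : ℝ} (hs : 0 < s) (hσ : -1 < σ) :
    Integrable fun x : EuclideanSpace ℝ (Fin n) =>
      if ‖x‖ < s then (s ^ 2 - ‖x‖ ^ 2) ^ σ else 0 := by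
  refine not_imp_comm.1 integral_undef ?_
  rw [integral_radial hn hs hσ]
  have h1 := Real.Gamma_pos_of_pos (show 0 < σ + 1 by linarith)
  have h2 := Real.Gamma_pos_of_pos (show 0 < σ + 1 + n / 2 by
    have : (0 : ℝ) ≤ n / 2 := by positivity
    linarith)
  have := Real.pi_pos
  positivity

variable {n : ℕ} {b : ℝ}

/-- On a slice `y = const` the conoid is a ball of radius `t - a`, and `k = (t - a)² - |x|²`. -/
lemma indicator_conoid_slice (hb : b < 0) {Y σ y : ℝ} (x : EuclideanSpace ℝ (Fin n)) :
    (conoid n b ∩ {p | Y ≤ p.2}).indicator (fun p => k b p ^ σ) (x, y) =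
      if Y ≤ y ∧ y < b then
        (if ‖x‖ < tOf y - aOf b then ((tOf y - aOf b) ^ 2 - ‖x‖ ^ 2) ^ σ else 0) else 0 := by
  by_cases h : (x, y) ∈ conoid n b ∩ {p | Y ≤ p.2}
  · rw [indicator_of_mem h]
    obtain ⟨h1, h2⟩ := (mem_conoid_iff_norm hb).1 h.1
    rw [if_pos ⟨h.2, h1⟩, if_pos h2, k_eq (by linarith)]
  · rw [indicator_of_notMem h]
    simp only [mem_inter_iff, mem_conoid_iff_norm hb, mem_ofPred_eq] at h
    split_ifs with h1 h2 <;> first | rfl | exact absurd ⟨⟨h1.2, h2⟩, h1.1⟩ h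

lemma integrableOn_k_rpow (hb : b < 0) (hn : 2 ≤ n) (Y : ℝ) {σ : ℝ} (hσ : -1 < σ) :
    IntegrableOn (fun p : Space n => k b p ^ σ) (conoid n b ∩ {p | Y ≤ p.2}) := by
  have hm : MeasurableSet (conoid n b ∩ {p : Space n | Y ≤ p.2}) :=
    isOpen_conoid.measurableSet.inter (measurableSet_le measurable_const measurable_snd)
  rw [← integrable_indicator_iff hm]
  have hmeas : AEStronglyMeasurable
      ((conoid n b ∩ {p : Space n | Y ≤ p.2}).indicator (fun p => k b p ^ σ))
      (volume.prod volume) := by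
    refine (Measurable.indicator ?_ hm).aestronglyMeasurable
    exact continuous_k.measurable.pow_const σ
  have hs : ∀ y, y < b → 0 < tOf y - aOf b := fun y hy => by
    rw [aOf_eq_tOf hb.le]; linarith [tOf_strictAnti hy hb.le]
  refine (integrable_prod_iff' hmeas).2 ⟨ae_of_all _ fun y => ?_, ?_⟩
  · simp_rw [indicator_conoid_slice hb]
    by_cases h : Y ≤ y ∧ y < b
    · simp only [h, and_self, if_true]
      exact integrable_radial (by omega) (hs y h.2) hσ
    · simp only [h, if_false]
      exact integrable_zero _ _ _
  · have hnn : ∀ p : Space n, ‖(conoid n b ∩ {p : Space n | Y ≤ p.2}).indicator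
        (fun p => k b p ^ σ) p‖ = (conoid n b ∩ {p : Space n | Y ≤ p.2}).indicator
        (fun p => k b p ^ σ) p := fun p => by
      refine Real.norm_of_nonneg (indicator_nonneg (fun p hp => ?_) p)
      exact Real.rpow_nonneg (mem_conoid_iff.1 hp.1).1.le _
    simp_rw [hnn, indicator_conoid_slice hb]
    have : (fun y : ℝ => ∫ x : EuclideanSpace ℝ (Fin n), if Y ≤ y ∧ y < b then
        (if ‖x‖ < tOf y - aOf b then ((tOf y - aOf b) ^ 2 - ‖x‖ ^ 2) ^ σ else 0) else 0) =
        (Ico Y b).indicator fun y => Real.pi ^ (n / 2 : ℝ) * Real.Gamma (σ + 1) /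
          Real.Gamma (σ + 1 + n / 2) * (tOf y - aOf b) ^ (2 * σ + n) := by
      ext y
      by_cases h : Y ≤ y ∧ y < b
      · simp only [h, and_self, if_true]
        rw [indicator_of_mem (show y ∈ Ico Y b from h),
          integral_radial (by omega) (hs y h.2) hσ]
      · simp only [h, if_false]
        rw [indicator_of_notMem (show y ∉ Ico Y b from h), integral_zero]
    rw [this, integrable_indicator_iff measurableSet_Ico]
    have hc : Continuous fun y => Real.pi ^ (n / 2 : ℝ) * Real.Gamma (σ + 1) /
          Real.Gamma (σ + 1 + n / 2) * (tOf y - aOf b) ^ (2 * σ + n) := by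
      refine continuous_const.mul ((continuous_tOf.sub continuous_const).rpow_const fun _ => ?_)
      right
      have : (2 : ℝ) ≤ n := by exact_mod_cast hn
      linarith
    exact (hc.integrableOn_Icc (a := Y) (b := b)).mono_set Ico_subset_Icc_self

end

section

variable {n : ℕ} {b Y : ℝ} {ψ : Space n → ℝ}

/-! ### The Riesz family -/

/-- The pairing of `χ_q(k)` with `ψ` for `Re q > -1`, where it is an integral. -/
noncomputable def riesz (b : ℝ) (q : ℂ) (ψ : Space n → ℝ) : ℂ :=
  ∫ p in conoid n b, ((k b p : ℝ) : ℂ) ^ q / Complex.Gamma (q + 1) * ((ψ p : ℝ) : ℂ)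

lemma IsAdm.bounded (hb : b < 0) (h : IsAdm b Y ψ) :
    ∃ C, 0 ≤ C ∧ ∀ p ∈ conoid n b, |ψ p| ≤ {p : Space n | Y ≤ p.2}.indicator (fun _ => C) p := by
  obtain ⟨C, hC⟩ := (isCompact_trunc (n := n) (b := b) Y).exists_bound_of_continuousOn
    (h.smooth.continuousOn.mono (trunc_subset_nbhd hb Y))
  refine ⟨max C 0, le_max_right _ _, fun p hp => ?_⟩
  by_cases hY : Y ≤ p.2
  · rw [indicator_of_mem (show p ∈ {p : Space n | Y ≤ p.2} from hY)]
    exact (hC p (mem_trunc_of_mem_conoid hb hp hY)).trans (le_max_left _ _)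
  · rw [indicator_of_notMem (show p ∉ {p : Space n | Y ≤ p.2} from hY),
      h.zero p (conoid_subset_nbhd hb hp) (not_le.1 hY), abs_zero]

lemma k_pos_of_mem {p : Space n} (hp : p ∈ conoid n b) : 0 < k b p := (mem_conoid_iff.1 hp).1

lemma measurableSet_conoid : MeasurableSet (conoid n b) := isOpen_conoid.measurableSet

lemma IsAdm.aestronglyMeasurable (hb : b < 0) (h : IsAdm b Y ψ) :
    AEStronglyMeasurable ψ (volume.restrict (conoid n b)) :=
  (h.smooth.continuousOn.mono (conoid_subset_nbhd hb)).aestronglyMeasurable measurableSet_conoid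

lemma integrableOn_indicator_k_rpow (hb : b < 0) (hn : 2 ≤ n) (Y C : ℝ) {σ : ℝ} (hσ : -1 < σ) :
    IntegrableOn (fun p : Space n => k b p ^ σ * {p : Space n | Y ≤ p.2}.indicator (fun _ => C) p)
      (conoid n b) := by
  have hS : MeasurableSet {p : Space n | Y ≤ p.2} :=
    measurableSet_le measurable_const measurable_snd
  have h1 := (integrableOn_k_rpow hb hn Y hσ).mul_const C
  have : (fun p : Space n => k b p ^ σ * {p : Space n | Y ≤ p.2}.indicator (fun _ => C) p) =
      {p : Space n | Y ≤ p.2}.indicator (fun p => k b p ^ σ * C) := by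
    ext p
    by_cases hp : Y ≤ p.2 <;> simp [indicator, hp]
  rw [this, IntegrableOn, integrable_indicator_iff hS, IntegrableOn, Measure.restrict_restrict hS,
    inter_comm]
  exact h1

lemma IsAdm.integrableOn_rpow (hb : b < 0) (hn : 2 ≤ n) (h : IsAdm b Y ψ) {σ : ℝ} (hσ : -1 < σ) :
    IntegrableOn (fun p : Space n => k b p ^ σ * ψ p) (conoid n b) := by
  obtain ⟨C, hC0, hC⟩ := h.bounded hb
  refine (integrableOn_indicator_k_rpow hb hn Y C hσ).mono'
    ((continuous_k.measurable.pow_const σ).aestronglyMeasurable.mul (h.aestronglyMeasurable hb)) ?_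
  filter_upwards [ae_restrict_mem measurableSet_conoid] with p hp
  rw [norm_mul, Real.norm_of_nonneg (Real.rpow_nonneg (k_pos_of_mem hp).le _)]
  exact mul_le_mul_of_nonneg_left (hC p hp) (Real.rpow_nonneg (k_pos_of_mem hp).le _)

lemma aestronglyMeasurable_cpow (q : ℂ) :
    AEStronglyMeasurable (fun p : Space n => ((k b p : ℝ) : ℂ) ^ q)
      (volume.restrict (conoid n b)) := by
  have : Continuous (k (n := n) b) := continuous_k
  exact ((Complex.measurable_ofReal.comp this.measurable).pow_const q).aestronglyMeasurable

lemma IsAdm.integrableOn_cpow (hb : b < 0) (hn : 2 ≤ n) (h : IsAdm b Y ψ) {q : ℂ}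
    (hq : -1 < q.re) :
    IntegrableOn (fun p : Space n => ((k b p : ℝ) : ℂ) ^ q * ((ψ p : ℝ) : ℂ)) (conoid n b) := by
  refine Integrable.mono (h.integrableOn_rpow hb hn hq) ((aestronglyMeasurable_cpow q).mul
    (Complex.continuous_ofReal.comp_aestronglyMeasurable (h.aestronglyMeasurable hb))) ?_
  filter_upwards [ae_restrict_mem measurableSet_conoid] with p hp
  rw [norm_mul, norm_mul, Complex.norm_cpow_eq_rpow_re_of_pos (k_pos_of_mem hp),
    Real.norm_of_nonneg (Real.rpow_nonneg (k_pos_of_mem hp).le _)]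
  simp

lemma IsAdm.integrableOn_riesz (hb : b < 0) (hn : 2 ≤ n) (h : IsAdm b Y ψ) {q : ℂ}
    (hq : -1 < q.re) :
    IntegrableOn (fun p : Space n =>
      ((k b p : ℝ) : ℂ) ^ q / Complex.Gamma (q + 1) * ((ψ p : ℝ) : ℂ)) (conoid n b) := by
  refine ((h.integrableOn_cpow hb hn hq).div_const (Complex.Gamma (q + 1))).congr ?_
  exact ae_of_all _ fun p => by simp only; ring

lemma riesz_eq (q : ℂ) (ψ : Space n → ℝ) : riesz b q ψ =
    (∫ p in conoid n b, ((k b p : ℝ) : ℂ) ^ q * ((ψ p : ℝ) : ℂ)) * (Complex.Gamma (q + 1))⁻¹ := by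
  rw [riesz, ← integral_mul_const]
  congr 1; ext p; ring

lemma differentiableOn_riesz (hb : b < 0) (hn : 2 ≤ n) (h : IsAdm b Y ψ) :
    DifferentiableOn ℂ (fun q => riesz b q ψ) {q : ℂ | -1 < q.re} := by
  intro q₀ (hq₀ : -1 < q₀.re)
  refine DifferentiableAt.differentiableWithinAt ?_
  simp_rw [riesz_eq]
  refine DifferentiableAt.mul ?_ ((Complex.differentiable_one_div_Gamma _).comp q₀ (by fun_prop))
  obtain ⟨C, hC0, hC⟩ := h.bounded hb
  set δ : ℝ := (q₀.re + 1) / 3 with hδ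
  have hδ0 : 0 < δ := by rw [hδ]; linarith
  have hlo : -1 < q₀.re - 2 * δ := by rw [hδ]; linarith
  have hhi : -1 < q₀.re + 2 * δ := by linarith
  refine differentiableAt_integral_of_norm_le (μ := volume.restrict (conoid n b))
    (F := fun q p => ((k b p : ℝ) : ℂ) ^ q * ((ψ p : ℝ) : ℂ)) hδ0
    (bound := fun p => k b p ^ (q₀.re - 2 * δ) *
        {p : Space n | Y ≤ p.2}.indicator (fun _ => C) p +
        k b p ^ (q₀.re + 2 * δ) * {p : Space n | Y ≤ p.2}.indicator (fun _ => C) p)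
    (fun q => (aestronglyMeasurable_cpow q).mul
      (Complex.continuous_ofReal.comp_aestronglyMeasurable (h.aestronglyMeasurable hb))) ?_ ?_
    ((integrableOn_indicator_k_rpow hb hn Y C hlo).add
      (integrableOn_indicator_k_rpow hb hn Y C hhi))
  · filter_upwards [ae_restrict_mem measurableSet_conoid] with p hp q
    have hk' : ((k b p : ℝ) : ℂ) ≠ 0 := by exact_mod_cast (k_pos_of_mem hp).ne'
    exact (differentiableAt_id.const_cpow (Or.inl hk')).mul_const _
  · filter_upwards [ae_restrict_mem measurableSet_conoid] with p hp z hz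
    have hk := k_pos_of_mem hp
    have h2 := abs_le.1 ((Complex.abs_re_le_norm _).trans (mem_closedBall_iff_norm.1 hz))
    rw [Complex.sub_re] at h2
    rw [norm_mul, Complex.norm_cpow_eq_rpow_re_of_pos hk, Complex.norm_real, ← add_mul]
    have h3 := Real.rpow_nonneg hk.le (q₀.re - 2 * δ)
    have h4 := Real.rpow_nonneg hk.le (q₀.re + 2 * δ)
    refine mul_le_mul ?_ (hC p hp) (abs_nonneg _) (by positivity)
    rcases le_total 1 (k b p) with h1k | h1k
    · have := Real.rpow_le_rpow_of_exponent_le h1k (show z.re ≤ q₀.re + 2 * δ by linarith)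
      linarith
    · have := Real.rpow_le_rpow_of_exponent_ge hk h1k
        (show q₀.re - 2 * δ ≤ z.re by linarith)
      linarith

/-! ### Elementary rules -/

lemma riesz_congr {ψ' : Space n → ℝ} (h : ∀ p ∈ conoid n b, ψ p = ψ' p) (q : ℂ) :
    riesz b q ψ = riesz b q ψ' :=
  setIntegral_congr_fun measurableSet_conoid fun p hp => by simp only [h p hp]

lemma riesz_add (hb : b < 0) (hn : 2 ≤ n) {ψ' : Space n → ℝ} (h : IsAdm b Y ψ)
    (h' : IsAdm b Y ψ') {q : ℂ} (hq : -1 < q.re) :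
    riesz b q (fun p => ψ p + ψ' p) = riesz b q ψ + riesz b q ψ' := by
  rw [riesz, riesz, riesz, ← integral_add (h.integrableOn_riesz hb hn hq)
    (h'.integrableOn_riesz hb hn hq)]
  congr 1; ext p; push_cast; ring

lemma riesz_const_mul (a : ℝ) (q : ℂ) :
    riesz b q (fun p => a * ψ p) = a * riesz b q ψ := by
  rw [riesz, riesz, ← integral_const_mul]
  congr 1; ext p; push_cast; ring

/-- The identity `k χ_q(k) = (q + 1) χ_{q+1}(k)`. -/
lemma riesz_k_mul {q : ℂ} (hq : -1 < q.re) :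
    riesz b q (fun p => k b p * ψ p) = (q + 1) * riesz b (q + 1) ψ := by
  have h1 : q + 1 ≠ 0 := fun h => by
    have := congrArg Complex.re h
    simp at this; linarith
  rw [riesz, riesz, ← integral_const_mul]
  refine setIntegral_congr_fun measurableSet_conoid fun p hp => ?_
  have hk' : ((k b p : ℝ) : ℂ) ≠ 0 := by exact_mod_cast (k_pos_of_mem hp).ne'
  rw [Complex.Gamma_add_one _ h1, Complex.cpow_add _ _ hk', Complex.cpow_one]
  have : Complex.Gamma (q + 1) ≠ 0 := Complex.Gamma_ne_zero_of_re_pos (by simp; linarith)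
  push_cast
  field_simp

lemma riesz_ofReal (q : ℝ) : riesz b (q : ℂ) ψ =
    ((∫ p in conoid n b, k b p ^ q * ψ p) / Real.Gamma (q + 1) : ℝ) := by
  rw [riesz_eq, Complex.ofReal_div, ← integral_complex_ofReal, div_eq_mul_inv]
  congr 1
  · refine setIntegral_congr_fun measurableSet_conoid fun p hp => ?_
    rw [Complex.ofReal_mul, Complex.ofReal_cpow (k_pos_of_mem hp).le]
  · rw [← Complex.Gamma_ofReal]; push_cast; rfl

/-! ### Integration by parts -/

/-- For `q > 1` the function `k^q ψ`, extended by zero, is differentiable on the whole space: at a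
boundary point `k = O(|r - p|)`, so `k^q = o(|r - p|)`. -/
lemma hasFDerivAt_indicator (hb : b < 0) (hψ : SmoothNear b ψ) {q : ℝ} (hq : 1 < q) (p : Space n) :
    HasFDerivAt ((conoid n b).indicator fun p => k b p ^ q * ψ p)
      ((conoid n b).indicator (fun p => k b p ^ q • fderiv ℝ ψ p +
        ψ p • ((q * k b p ^ (q - 1)) • fderiv ℝ (k b) p)) p) p := by
  by_cases hp : p ∈ conoid n b
  · rw [indicator_of_mem hp]
    have hU := conoid_subset_nbhd hb hp
    have h1 := ((smoothNear_k.differentiableAt hU).hasFDerivAt.rpow_const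
      (Or.inl (k_pos_of_mem hp).ne') (p := q)).mul (hψ.differentiableAt hU).hasFDerivAt
    refine h1.congr_of_eventuallyEq ?_
    filter_upwards [isOpen_conoid.mem_nhds hp] with r hr
    rw [indicator_of_mem hr]; rfl
  · rw [indicator_of_notMem hp]
    rcases lt_or_ge (k b p) 0 with hk | hk
    · refine (hasFDerivAt_const (0 : ℝ) p).congr_of_eventuallyEq ?_
      filter_upwards [continuous_k.continuousAt.eventually (gt_mem_nhds hk)] with r hr
      exact indicator_of_notMem (fun h => (k_pos_of_mem h).not_gt hr) _
    rcases lt_or_ge b p.2 with hy | hy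
    · refine (hasFDerivAt_const (0 : ℝ) p).congr_of_eventuallyEq ?_
      filter_upwards [continuous_snd.continuousAt.eventually (lt_mem_nhds hy)] with r hr
      exact indicator_of_notMem (fun h => h.2.not_gt hr) _
    -- What remains is the boundary, where `k` vanishes.
    have hkp := k_eq (b := b) (show p.2 ≤ 0 by linarith)
    have hta : 0 ≤ tOf p.2 - aOf b := by rw [aOf_eq_tOf hb.le]; linarith [tOf_anti hy]
    have hxt : ‖p.1‖ ≤ tOf p.2 - aOf b := abs_le_of_sq_le_sq' (by linarith) hta |>.2
    have hk0 : k b p = 0 := by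
      rcases hy.eq_or_lt with h | h
      · have : tOf p.2 - aOf b = 0 := by rw [aOf_eq_tOf hb.le, h, sub_self]
        rw [this] at hkp hxt
        have := norm_nonneg p.1
        rw [hkp, le_antisymm hxt this]; norm_num
      · exact le_antisymm (not_lt.1 fun h' => hp (mem_conoid_iff.2 ⟨h', h⟩)) hk
    have hU : p ∈ nbhd n b := mem_nbhd_of_norm_le hb hy hxt
    have hkO : (fun r => k b r) =O[𝓝 p] fun r => r - p := by
      simpa [hk0] using (smoothNear_k.differentiableAt hU).hasFDerivAt.isBigO_sub
    have h0 : (fun r => |k b r| ^ (q - 1) * |ψ r|) =o[𝓝 p] fun _ => (1 : ℝ) := by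
      rw [Asymptotics.isLittleO_one_iff]
      have h1 : ContinuousAt (fun r => |k b r| ^ (q - 1) * |ψ r|) p := by
        refine ContinuousAt.mul ?_ (hψ.differentiableAt hU).continuousAt.abs
        exact continuous_k.continuousAt.abs.rpow_const (Or.inr (by linarith))
      have h2 := h1.tendsto
      simpa [hk0, Real.zero_rpow (show q - 1 ≠ 0 by linarith)] using h2
    have h3 := h0.mul_isBigO hkO.norm_norm
    rw [hasFDerivAt_iff_isLittleO]
    refine Asymptotics.IsBigO.trans_isLittleO (Asymptotics.IsBigO.of_bound 1 (.of_forall fun r => ?_))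
      (h3.congr_right (g₂ := fun r => ‖r - p‖) (by simp)).of_norm_right
    rw [indicator_of_notMem hp]
    by_cases hr : r ∈ conoid n b
    · have hkr := k_pos_of_mem hr
      rw [indicator_of_mem hr]
      have : k b r ^ q = k b r ^ (q - 1) * k b r := by
        rw [← Real.rpow_add_one hkr.ne']; ring_nf
      simp only [sub_zero, _root_.zero_apply, norm_mul, Real.norm_eq_abs, abs_abs,
        one_mul, this, abs_of_pos hkr, abs_of_pos (Real.rpow_pos_of_pos hkr (q - 1))]
      exact le_of_eq (by ring)
    · rw [indicator_of_notMem hr]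
      simp only [sub_zero, _root_.zero_apply, norm_zero]
      positivity

/-- Integration by parts: `∂_w χ_q(k) = χ_{q-1}(k) ∂_w k` for large real `q`. -/
lemma riesz_pd (hb : b < 0) (hn : 2 ≤ n) (h : IsAdm b Y ψ) {q : ℝ} (hq : 1 < q) (w : Space n) :
    riesz b (q : ℂ) (pd w ψ) = - riesz b ((q - 1 : ℝ) : ℂ) (fun p => pd w (k b) p * ψ p) := by
  have hkψ : IsAdm b Y fun p => pd w (k b) p * ψ p := .mul_left (smoothNear_k.pd w) h
  have i1 := (h.pd w).integrableOn_rpow hb hn (σ := q) (by linarith)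
  have i2 := hkψ.integrableOn_rpow hb hn (σ := q - 1) (by linarith)
  set F' : Space n → (Space n →L[ℝ] ℝ) := (conoid n b).indicator (fun p =>
    k b p ^ q • fderiv ℝ ψ p + ψ p • ((q * k b p ^ (q - 1)) • fderiv ℝ (k b) p)) with hF'
  have hF'w : ∀ p, F' p w = (conoid n b).indicator (fun p => k b p ^ q * pd w ψ p +
      q * (k b p ^ (q - 1) * (pd w (k b) p * ψ p))) p := fun p => by
    by_cases hp : p ∈ conoid n b
    · simp [hF', indicator_of_mem hp, pd]; ring
    · simp [hF', indicator_of_notMem hp]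
  have : (volume : Measure (Space n)).IsAddHaarMeasure := Measure.prod.instIsAddHaarMeasure _ _
  have key := integral_bilinear_hasFDerivAt_right_eq_neg_left_of_integrable (μ := volume)
    (f := fun _ : Space n => (1 : ℝ)) (f' := fun _ => 0)
    (g := (conoid n b).indicator fun p => k b p ^ q * ψ p) (g' := F') (v := w)
    (B := ContinuousLinearMap.mul ℝ ℝ) (by simp) (by
      simp only [ContinuousLinearMap.mul_apply', one_mul, hF'w]
      rw [integrable_indicator_iff measurableSet_conoid]
      exact i1.add (i2.const_mul q)) (by
      simp only [ContinuousLinearMap.mul_apply', one_mul]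
      rw [integrable_indicator_iff measurableSet_conoid]
      exact h.integrableOn_rpow hb hn (by linarith))
      (fun p _ => hasFDerivAt_const _ _) (fun p _ => hasFDerivAt_indicator hb h.smooth hq p)
  simp only [ContinuousLinearMap.mul_apply', one_mul, hF'w, _root_.zero_apply,
    zero_mul, integral_zero, neg_zero] at key
  rw [integral_indicator measurableSet_conoid, integral_add i1 (i2.const_mul q),
    integral_const_mul] at key
  rw [riesz_ofReal, riesz_ofReal, ← Complex.ofReal_neg]
  generalize (∫ a : Space n in conoid n b, k b a ^ q * pd w ψ a) = I₁ at key ⊢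
  generalize (∫ a : Space n in conoid n b, k b a ^ (q - 1) * (pd w (k b) a * ψ a)) = I₂ at key ⊢
  rw [sub_add_cancel,
    Real.Gamma_add_one (by linarith)]
  congr 1
  have := (Real.Gamma_pos_of_pos (show 0 < q by linarith)).ne'
  have : q ≠ 0 := by linarith
  field_simp
  linarith

end

section

variable {n : ℕ} {b Y : ℝ} {φ g : Space n → ℝ}

lemma riesz_sum (hb : b < 0) (hn : 2 ≤ n) {ι : Type*} (s : Finset ι) {ψ : ι → Space n → ℝ}
    (h : ∀ i ∈ s, IsAdm b Y (ψ i)) {q : ℂ} (hq : -1 < q.re) :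
    riesz b q (fun p => ∑ i ∈ s, ψ i p) = ∑ i ∈ s, riesz b q (ψ i) := by
  simp only [riesz]
  rw [← integral_finsetSum s fun i hi => (h i hi).integrableOn_riesz hb hn hq]
  congr 1; ext p; push_cast; rw [Finset.mul_sum]

/-! ### Second-order identities -/

lemma riesz_mul_pd_pd (hb : b < 0) (hn : 2 ≤ n) (hφ : IsAdm b Y φ) (hg : SmoothNear b g)
    {q : ℝ} (hq : 2 < q) (w : Space n) :
    riesz b q (fun p => g p * pd w (pd w φ) p) =
      riesz b ((q - 2 : ℝ) : ℂ) (fun p => pd w (k b) p ^ 2 * (g p * φ p)) +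
      riesz b ((q - 1 : ℝ) : ℂ) (fun p => (pd w (pd w (k b)) p * g p +
        2 * (pd w (k b) p * pd w g p)) * φ p) +
      riesz b q (fun p => pd w (pd w g) p * φ p) := by
  have hq0 : -1 < ((q : ℝ) : ℂ).re := by simp; linarith
  have hq1 : -1 < ((q - 1 : ℝ) : ℂ).re := by simp; linarith
  have hk : SmoothNear b (k (n := n) b) := smoothNear_k
  have hgφ : IsAdm b Y (fun p => g p * φ p) := hφ.mul_left hg
  have hg'φ : IsAdm b Y (fun p => pd w g p * φ p) := hφ.mul_left (hg.pd w)
  have hg''φ : IsAdm b Y (fun p => pd w (pd w g) p * φ p) := hφ.mul_left ((hg.pd w).pd w)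
  have hkgφ : IsAdm b Y (fun p => pd w (k b) p * (g p * φ p)) := hgφ.mul_left (hk.pd w)
  have a1 : IsAdm b Y (fun p => g p * pd w (pd w φ) p) := ((hφ.pd w).pd w).mul_left hg
  -- moving both derivatives off `φ`
  have e1 : riesz b q (fun p => g p * pd w (pd w φ) p) +
      2 * riesz b q (pd w fun p => pd w g p * φ p) =
      riesz b q (pd w (pd w fun p => g p * φ p)) +
        riesz b q (fun p => pd w (pd w g) p * φ p) := by
    have h2 := riesz_const_mul (b := b) (ψ := pd w fun p => pd w g p * φ p) 2 (q : ℂ)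
    push_cast at h2
    rw [← h2, ← riesz_add hb hn a1 ((hg'φ.pd w).mul_left (.const 2)) hq0,
      ← riesz_add hb hn ((hgφ.pd w).pd w) hg''φ hq0]
    refine riesz_congr (fun p hp => ?_) _
    have hU := conoid_subset_nbhd hb hp
    rw [pd_mul (hg.pd w) hφ.smooth hU, pd_congr (fun p hp => pd_mul hg hφ.smooth hp) hU,
      pd_add (hg.mul (hφ.smooth.pd w)) ((hg.pd w).mul hφ.smooth) hU,
      pd_mul hg (hφ.smooth.pd w) hU, pd_mul (hg.pd w) hφ.smooth hU]
    ring
  have e2 := riesz_pd hb hn (hgφ.pd w) (show 1 < q by linarith) w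
  have e3 := riesz_pd hb hn hg'φ (show 1 < q by linarith) w
  have e4 := riesz_pd hb hn hkgφ (show 1 < q - 1 by linarith) w
  have e5 : riesz b ((q - 1 : ℝ) : ℂ) (pd w fun p => pd w (k b) p * (g p * φ p)) =
      riesz b ((q - 1 : ℝ) : ℂ) (fun p => pd w (k b) p * pd w (fun p => g p * φ p) p) +
      riesz b ((q - 1 : ℝ) : ℂ) (fun p => pd w (pd w (k b)) p * (g p * φ p)) := by
    rw [← riesz_add hb hn ((hgφ.pd w).mul_left (hk.pd w)) (hgφ.mul_left ((hk.pd w).pd w)) hq1]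
    refine riesz_congr (fun p hp => ?_) _
    rw [pd_mul (hk.pd w) hgφ.smooth (conoid_subset_nbhd hb hp)]
  have e6 : riesz b ((q - 1 : ℝ) : ℂ) (fun p => (pd w (pd w (k b)) p * g p +
        2 * (pd w (k b) p * pd w g p)) * φ p) =
      riesz b ((q - 1 : ℝ) : ℂ) (fun p => pd w (pd w (k b)) p * (g p * φ p)) +
      2 * riesz b ((q - 1 : ℝ) : ℂ) (fun p => pd w (k b) p * (pd w g p * φ p)) := by
    have h2 := riesz_const_mul (b := b) (ψ := fun p => pd w (k b) p * (pd w g p * φ p)) 2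
      ((q - 1 : ℝ) : ℂ)
    push_cast at h2 ⊢
    push_cast at hq1
    rw [← h2, ← riesz_add hb hn (hgφ.mul_left ((hk.pd w).pd w))
      ((hg'φ.mul_left (hk.pd w)).mul_left (.const 2)) (by simpa using hq1)]
    exact riesz_congr (fun p hp => by ring) _
  have e7 : riesz b ((q - 1 - 1 : ℝ) : ℂ) (fun p => pd w (k b) p * (pd w (k b) p * (g p * φ p))) =
      riesz b ((q - 2 : ℝ) : ℂ) (fun p => pd w (k b) p ^ 2 * (g p * φ p)) := by
    rw [show q - 1 - 1 = q - 2 by ring]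
    exact riesz_congr (fun p hp => by ring) _
  rw [e6]
  linear_combination e1 + e2 - 2 * e3 - e4 + e5 + e7

lemma pd_snd (w p : Space n) : pd w (fun p : Space n => p.2) p = w.2 := by
  simp [pd, (hasFDerivAt_snd (𝕜 := ℝ) (p := p)).fderiv]

/-! ### Derivatives of `k` along the coordinate axes -/

lemma pd_dirX_k {p : Space n} (hp : p ∈ nbhd n b) (i : Fin n) :
    pd (dirX i) (k b) p = -2 * p.1 i := by
  rw [pd_k hp]; simp [dirX, EuclideanSpace.inner_single_right]

lemma pd_dirY_k {p : Space n} (hp : p ∈ nbhd n b) :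
    pd (dirY n) (k b) p = -2 * (tOf p.2 - aOf b) * rho p.2 := by
  rw [pd_k hp]; simp [dirY]

lemma pd_dirX_dirX_k {p : Space n} (hp : p ∈ nbhd n b) (i : Fin n) :
    pd (dirX i) (pd (dirX i) (k b)) p = -2 := by
  rw [pd_congr (fun p hp => pd_dirX_k hp i) hp, pd_mul (.const _) (smoothNear_coord i) hp,
    pd_coord]
  simp [pd, dirX]

lemma pd_dirY_dirY_k {p : Space n} (hp : p ∈ nbhd n b) :
    pd (dirY n) (pd (dirY n) (k b)) p = 2 * rho p.2 ^ 2 + (tOf p.2 - aOf b) / rho p.2 := by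
  have h0 := (rho_pos hp.1).ne'
  rw [pd_congr (fun p hp => pd_dirY_k hp) hp,
    pd_comp_snd ((((hasDerivAt_tOf hp.1).sub_const (aOf b)).const_mul (-2)).fun_mul
      (hasDerivAt_rho hp.1))]
  simp only [dirY]
  field_simp

/-! ### The Tricomi operator -/

/-- The operator `yΔₓ + ∂_y²` on functions. -/
noncomputable def tri (φ : Space n → ℝ) (p : Space n) : ℝ :=
  p.2 * ∑ i, pd (dirX i) (pd (dirX i) φ) p + pd (dirY n) (pd (dirY n) φ) p

/-- The first-order operator `g ↦ (𝒯k) g + 2 (y ⟨∇ₓk, ∇ₓg⟩ + ∂_y k ∂_y g)`, which collects the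
terms of `𝒯(g χ_q(k))` with `χ_{q-1}(k)` that do not come from the square of the gradient of `k`. -/
noncomputable def transport (b : ℝ) (g : Space n → ℝ) (p : Space n) : ℝ :=
  (2 * (n + 1) * rho p.2 ^ 2 + (tOf p.2 - aOf b) / rho p.2) * g p
    - 4 * (tOf p.2 - aOf b) * rho p.2 * pd (dirY n) g p
    - 4 * p.2 * ∑ i, p.1 i * pd (dirX i) g p

lemma SmoothNear.tri (hg : SmoothNear b g) : SmoothNear b (tri g) :=
  (smoothNear_snd.mul (.sum fun _ _ => (hg.pd _).pd _)).add ((hg.pd _).pd _)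

lemma IsAdm.tri (hφ : IsAdm b Y φ) : IsAdm b Y (tri φ) :=
  ((IsAdm.sum fun _ _ => (hφ.pd _).pd _).mul_left smoothNear_snd).add ((hφ.pd _).pd _)

lemma SmoothNear.transport (hg : SmoothNear b g) : SmoothNear b (transport b g) := by
  have ht : SmoothNear b fun p : Space n => tOf p.2 - aOf b := smoothNear_tOf.sub (.const _)
  have hr : SmoothNear b fun p : Space n => rho p.2 := smoothNear_rho
  have hr2 : SmoothNear b fun p : Space n => rho p.2 ^ 2 := hr.pow 2
  exact ((((SmoothNear.mul (.const _) hr2).add (ht.div hr fun p hp => (rho_pos hp.1).ne')).mul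
    hg).sub (((SmoothNear.mul (.const 4) ht).mul hr).mul (hg.pd _))).sub
      ((SmoothNear.mul (.const 4) smoothNear_snd).mul
        (.sum fun i _ => (smoothNear_coord i).mul (hg.pd _)))

lemma sum_sq_eq (x : EuclideanSpace ℝ (Fin n)) : ∑ i, x i ^ 2 = ‖x‖ ^ 2 := by
  rw [EuclideanSpace.norm_sq_eq]; simp

/-- The formula for `𝒯(g χ_q(k))`, paired with `φ`. It uses the eikonal identity
`y |∇ₓk|² + (∂_y k)² = -4 y k`, by which the term with `χ_{q-2}(k)` becomes one with `χ_{q-1}(k)`. -/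
lemma riesz_mul_tri (hb : b < 0) (hn : 2 ≤ n) (hφ : IsAdm b Y φ) (hg : SmoothNear b g)
    {q : ℝ} (hq : 2 < q) :
    riesz b q (fun p => g p * tri φ p) =
      4 * (q - 1) * riesz b ((q - 1 : ℝ) : ℂ) (fun p => -p.2 * (g p * φ p)) +
      riesz b ((q - 1 : ℝ) : ℂ) (fun p => transport b g p * φ p) +
      riesz b q (fun p => tri g p * φ p) := by
  have hq0 : -1 < ((q : ℝ) : ℂ).re := by simp; linarith
  have hq1 : -1 < ((q - 1 : ℝ) : ℂ).re := by simp only [Complex.ofReal_re]; linarith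
  have hq2 : -1 < ((q - 2 : ℝ) : ℂ).re := by simp only [Complex.ofReal_re]; linarith
  have hk : SmoothNear b (k (n := n) b) := smoothNear_k
  have hyg : SmoothNear b fun p : Space n => p.2 * g p := smoothNear_snd.mul hg
  have hgφ : IsAdm b Y (fun p => g p * φ p) := hφ.mul_left hg
  have hX : ∀ i : Fin n, _ := fun i => riesz_mul_pd_pd hb hn hφ hyg hq (dirX i)
  have hY := riesz_mul_pd_pd hb hn hφ hg hq (dirY n)
  have e0 : riesz b q (fun p => g p * tri φ p) =
      (∑ i, riesz b q (fun p => p.2 * g p * pd (dirX i) (pd (dirX i) φ) p)) +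
      riesz b q (fun p => g p * pd (dirY n) (pd (dirY n) φ) p) := by
    rw [← riesz_sum hb hn (Y := Y) _ (fun i _ => ((hφ.pd _).pd _).mul_left hyg) hq0,
      ← riesz_add hb hn (Y := Y) (.sum fun i _ => ((hφ.pd _).pd _).mul_left hyg)
        (((hφ.pd _).pd _).mul_left hg) hq0]
    refine riesz_congr (fun p hp => ?_) _
    rw [tri, mul_add, ← mul_assoc, mul_comm (g p) p.2, Finset.mul_sum]
  have a1 : ∀ (w : Space n) (g : Space n → ℝ), SmoothNear b g →
      IsAdm b Y (fun p => pd w (k b) p ^ 2 * (g p * φ p)) := fun w g hg =>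
    (hφ.mul_left hg).mul_left (ContDiffOn.pow (hk.pd w) 2)
  have a2 : ∀ (w : Space n) (g : Space n → ℝ), SmoothNear b g →
      IsAdm b Y (fun p => (pd w (pd w (k b)) p * g p + 2 * (pd w (k b) p * pd w g p)) * φ p) :=
    fun w g hg => hφ.mul_left ((((hk.pd w).pd w).mul hg).add
      (.mul (.const 2) ((hk.pd w).mul (hg.pd w))))
  have a3 : ∀ (w : Space n) (g : Space n → ℝ), SmoothNear b g →
      IsAdm b Y (fun p => pd w (pd w g) p * φ p) :=
    fun w g hg => hφ.mul_left ((hg.pd w).pd w)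
  have f1 : (∑ i, riesz b ((q - 2 : ℝ) : ℂ) (fun p =>
        pd (dirX i) (k b) p ^ 2 * (p.2 * g p * φ p))) +
      riesz b ((q - 2 : ℝ) : ℂ) (fun p => pd (dirY n) (k b) p ^ 2 * (g p * φ p)) =
      4 * (q - 1) * riesz b ((q - 1 : ℝ) : ℂ) (fun p => -p.2 * (g p * φ p)) := by
    have hkk := riesz_k_mul (b := b) (ψ := fun p => -p.2 * (g p * φ p)) hq2
    have h4 := riesz_const_mul (b := b) (ψ := fun p => k b p * (-p.2 * (g p * φ p))) 4
      ((q - 2 : ℝ) : ℂ)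
    have : (((q - 2 : ℝ) : ℂ) + 1) = ((q - 1 : ℝ) : ℂ) := by push_cast; ring
    rw [this] at hkk
    rw [hkk] at h4
    have : (4 : ℂ) * (q - 1) * riesz b ((q - 1 : ℝ) : ℂ) (fun p => -p.2 * (g p * φ p)) =
      ((4 : ℝ) : ℂ) * (((q - 1 : ℝ) : ℂ) *
        riesz b ((q - 1 : ℝ) : ℂ) (fun p => -p.2 * (g p * φ p))) := by push_cast; ring
    rw [this, ← h4, ← riesz_sum hb hn (Y := Y) _ (fun i _ => a1 _ _ hyg) hq2,
      ← riesz_add hb hn (Y := Y) (.sum fun i _ => a1 _ _ hyg) (a1 _ _ hg) hq2]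
    refine riesz_congr (fun p hp => ?_) _
    have hU := conoid_subset_nbhd hb hp
    simp only [pd_dirX_k hU, pd_dirY_k hU]
    rw [← Finset.sum_mul, k_eq hU.1.le]
    have : ∑ i, (-2 * p.1 i) ^ 2 = 4 * ‖p.1‖ ^ 2 := by
      rw [← sum_sq_eq, Finset.mul_sum]; exact Finset.sum_congr rfl fun i _ => by ring
    have h2 := rho_sq hU.1.le
    rw [this]
    linear_combination 4 * (tOf p.2 - aOf b) ^ 2 * g p * φ p * h2
  have f2 : (∑ i, riesz b ((q - 1 : ℝ) : ℂ) (fun p => (pd (dirX i) (pd (dirX i) (k b)) p *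
        (p.2 * g p) + 2 * (pd (dirX i) (k b) p * pd (dirX i) (fun p => p.2 * g p) p)) * φ p)) +
      riesz b ((q - 1 : ℝ) : ℂ) (fun p => (pd (dirY n) (pd (dirY n) (k b)) p * g p +
        2 * (pd (dirY n) (k b) p * pd (dirY n) g p)) * φ p) =
      riesz b ((q - 1 : ℝ) : ℂ) (fun p => transport b g p * φ p) := by
    rw [← riesz_sum hb hn (Y := Y) _ (fun i _ => a2 _ _ hyg) hq1,
      ← riesz_add hb hn (Y := Y) (.sum fun i _ => a2 _ _ hyg) (a2 _ _ hg) hq1]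
    refine riesz_congr (fun p hp => ?_) _
    have hU := conoid_subset_nbhd hb hp
    have : ∀ i : Fin n, pd (dirX i) (fun p => p.2 * g p) p = p.2 * pd (dirX i) g p := fun i => by
      rw [pd_mul smoothNear_snd hg hU, pd_snd]; simp [dirX]
    simp only [pd_dirX_dirX_k hU, pd_dirY_dirY_k hU, pd_dirX_k hU, pd_dirY_k hU, this, transport]
    have h2 := rho_sq hU.1.le
    rw [← Finset.sum_mul, Finset.sum_add_distrib]
    have : ∑ i, 2 * (-2 * p.1 i * (p.2 * pd (dirX i) g p)) =
      -4 * p.2 * ∑ i, p.1 i * pd (dirX i) g p := by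
      rw [Finset.mul_sum]; exact Finset.sum_congr rfl fun i _ => by ring
    rw [this]
    simp only [Finset.sum_const, Finset.card_univ, Fintype.card_fin, nsmul_eq_mul]
    linear_combination (-2 * n * g p * φ p) * h2
  have f3 : (∑ i, riesz b q (fun p => pd (dirX i) (pd (dirX i) (fun p => p.2 * g p)) p * φ p)) +
      riesz b q (fun p => pd (dirY n) (pd (dirY n) g) p * φ p) =
      riesz b q (fun p => tri g p * φ p) := by
    rw [← riesz_sum hb hn (Y := Y) _ (fun i _ => a3 _ _ hyg) hq0,
      ← riesz_add hb hn (Y := Y) (.sum fun i _ => a3 _ _ hyg) (a3 _ _ hg) hq0]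
    refine riesz_congr (fun p hp => ?_) _
    have hU := conoid_subset_nbhd hb hp
    have h1 : ∀ (i : Fin n) (g : Space n → ℝ), SmoothNear b g → ∀ p ∈ nbhd n b,
        pd (dirX i) (fun p => p.2 * g p) p = p.2 * pd (dirX i) g p := fun i g hg p hU => by
      rw [pd_mul smoothNear_snd hg hU, pd_snd]; simp [dirX]
    have h2 : ∀ i : Fin n, pd (dirX i) (pd (dirX i) (fun p => p.2 * g p)) p =
        p.2 * pd (dirX i) (pd (dirX i) g) p := fun i => by
      rw [pd_congr (h1 i g hg) hU, h1 i _ (hg.pd _) p hU]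
    simp only [h2, tri]
    rw [← Finset.sum_mul, Finset.mul_sum, add_mul]
  rw [e0, Finset.sum_congr rfl fun i _ => hX i, hY, Finset.sum_add_distrib,
    Finset.sum_add_distrib, ← f1, ← f2, ← f3]
  ring

end

section

variable {n : ℕ} {b Y : ℝ} {φ ψ g : Space n → ℝ}

/-! ### Analytic continuation in the exponent -/

/-- Two holomorphic functions on a half-plane that agree at all large real numbers are equal. -/
lemma eqOn_of_eq_large {c R : ℝ} {f g : ℂ → ℂ} (hf : DifferentiableOn ℂ f {q : ℂ | c < q.re})
    (hg : DifferentiableOn ℂ g {q : ℂ | c < q.re}) (h : ∀ x : ℝ, R < x → f x = g x) :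
    EqOn f g {q : ℂ | c < q.re} := by
  have ho : IsOpen {q : ℂ | c < q.re} := isOpen_lt continuous_const Complex.continuous_re
  have hconv : Convex ℝ {q : ℂ | c < q.re} := convex_halfSpace_re_gt c
  set x₀ : ℝ := max c R + 1 with hx₀
  have h1 : c < x₀ := by have := le_max_left c R; linarith
  have h2 : R < x₀ := by have := le_max_right c R; linarith
  refine (hf.analyticOnNhd ho).eqOn_of_preconnected_of_frequently_eq (hg.analyticOnNhd ho)
    hconv.isPreconnected (show ((x₀ : ℝ) : ℂ) ∈ {q : ℂ | c < q.re} by simpa using h1) ?_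
  have ht : Tendsto (fun x : ℝ => (x : ℂ)) (𝓝[>] x₀) (𝓝[≠] ((x₀ : ℝ) : ℂ)) := by
    refine tendsto_nhdsWithin_iff.2 ⟨?_, ?_⟩
    · exact (Complex.continuous_ofReal.tendsto x₀).mono_left nhdsWithin_le_nhds
    · filter_upwards [self_mem_nhdsWithin] with x (hx : x₀ < x)
      simpa using hx.ne'
  refine ht.frequently (Eventually.frequently ?_)
  filter_upwards [self_mem_nhdsWithin] with x (hx : x₀ < x) using h x (h2.trans hx)

/-- The operator `ψ ↦ 𝒯(-ψ/y) - ∂_y(ψ/(2y²))`. On the family `χ_q(k)` its transpose lowers the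
exponent by one, up to the factor `4q + 2n - 2`, see `riesz_ascend`; the second summand cancels the
zeroth-order term `(t - a)/ρ` of the transport operator. -/
noncomputable def ascend (ψ : Space n → ℝ) (p : Space n) : ℝ :=
  tri (fun p => -(p.2)⁻¹ * ψ p) p + pd (dirY n) (fun p => -(2 * p.2 ^ 2)⁻¹ * ψ p) p

lemma smoothNear_inv_snd : SmoothNear b (fun p : Space n => -(p.2)⁻¹) :=
  .neg (ContDiffOn.inv smoothNear_snd fun _ hp => hp.1.ne)

lemma smoothNear_inv_snd_sq : SmoothNear b (fun p : Space n => -(2 * p.2 ^ 2)⁻¹) :=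
  .neg (ContDiffOn.inv (contDiffOn_const.mul (ContDiffOn.pow smoothNear_snd 2)) fun p hp => by
    have : p.2 ≠ 0 := hp.1.ne
    positivity)

lemma IsAdm.ascend (h : IsAdm b Y ψ) : IsAdm b Y (ascend ψ) :=
  (h.mul_left smoothNear_inv_snd).tri.add ((h.mul_left smoothNear_inv_snd_sq).pd _)

lemma riesz_ascend_of_large (hb : b < 0) (hn : 2 ≤ n) (h : IsAdm b Y ψ) {q : ℝ} (hq : 2 < q) :
    riesz b q (ascend ψ) = (4 * q + 2 * n - 2) * riesz b ((q - 1 : ℝ) : ℂ) ψ := by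
  have hq0 : -1 < ((q : ℝ) : ℂ).re := by simp; linarith
  have hq1 : -1 < ((q - 1 : ℝ) : ℂ).re := by simp only [Complex.ofReal_re]; linarith
  have hθ : IsAdm b Y (fun p => -(p.2)⁻¹ * ψ p) := h.mul_left smoothNear_inv_snd
  have hη : IsAdm b Y (fun p => -(2 * p.2 ^ 2)⁻¹ * ψ p) := h.mul_left smoothNear_inv_snd_sq
  have hone : SmoothNear b (fun _ : Space n => (1 : ℝ)) := .const 1
  have hpd1 : ∀ w p, pd w (fun _ : Space n => (1 : ℝ)) p = 0 := fun w p => by simp [pd]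
  have e1 := riesz_mul_tri hb hn hθ hone hq
  have e2 := riesz_pd hb hn hη (show 1 < q by linarith) (dirY n)
  have e3 : riesz b q (ascend ψ) = riesz b q (fun p => 1 * tri (fun p => -(p.2)⁻¹ * ψ p) p) +
      riesz b q (pd (dirY n) fun p => -(2 * p.2 ^ 2)⁻¹ * ψ p) := by
    rw [← riesz_add hb hn (hθ.tri.mul_left hone) (hη.pd _) hq0]
    exact riesz_congr (fun p _ => by rw [ascend, one_mul]) _
  have e4 : riesz b q (fun p => tri (fun _ => (1 : ℝ)) p * (-(p.2)⁻¹ * ψ p)) = 0 := by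
    have : ∀ p : Space n, tri (fun _ : Space n => (1 : ℝ)) p = 0 := fun p => by
      have : ∀ w, pd w (fun _ : Space n => (1 : ℝ)) = fun _ => 0 := fun w => funext (hpd1 w)
      simp only [tri, this]
      simp [pd]
    simp [riesz, this]
  have e5 : riesz b ((q - 1 : ℝ) : ℂ) (fun p => -p.2 * (1 * (-(p.2)⁻¹ * ψ p))) =
      riesz b ((q - 1 : ℝ) : ℂ) ψ := by
    refine riesz_congr (fun p hp => ?_) _
    have : p.2 ≠ 0 := (conoid_subset_nbhd hb hp).1.ne
    field_simp
  have e6 : riesz b ((q - 1 : ℝ) : ℂ) (fun p => transport b (fun _ => 1) p * (-(p.2)⁻¹ * ψ p)) =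
      riesz b ((q - 1 : ℝ) : ℂ) (fun p => pd (dirY n) (k b) p * (-(2 * p.2 ^ 2)⁻¹ * ψ p)) +
      ((2 * (n + 1) : ℝ) : ℂ) * riesz b ((q - 1 : ℝ) : ℂ) ψ := by
    rw [← riesz_const_mul, ← riesz_add hb hn (hη.mul_left (smoothNear_k.pd _))
      (h.mul_left (.const _)) hq1]
    refine riesz_congr (fun p hp => ?_) _
    have hU := conoid_subset_nbhd hb hp
    have h0 := rho_pos hU.1
    have h2 : p.2 = -rho p.2 ^ 2 := by rw [rho_sq hU.1.le, neg_neg]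
    simp only [transport, hpd1, pd_dirY_k hU]
    generalize rho p.2 = r at h0 h2
    generalize tOf p.2 = t
    rw [h2]
    simp only [mul_zero, Finset.sum_const_zero]
    field_simp
    ring
  rw [e3, e1, e2, e4, e5, e6]
  push_cast
  ring

/-- The continuation of `riesz b q ψ` to `Re q > -1 - N` by `N`-fold use of `riesz_ascend`. -/
noncomputable def rieszExt (b : ℝ) : ℕ → ℂ → (Space n → ℝ) → ℂ
  | 0, q, ψ => riesz b q ψ
  | N + 1, q, ψ => rieszExt b N (q + 1) (ascend ψ) / (4 * (q + 1) + 2 * n - 2)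

lemma den_ne_zero {q : ℂ} (hq : -((n : ℝ) + 1) / 2 < q.re) : 4 * (q + 1) + 2 * (n : ℂ) - 2 ≠ 0 :=
  fun h => by
    have := congrArg Complex.re h
    simp at this
    linarith

lemma riesz_ascend (hb : b < 0) (hn : 2 ≤ n) (h : IsAdm b Y ψ) {q : ℂ} (hq : -1 < q.re) :
    riesz b (q + 1) (ascend ψ) = (4 * (q + 1) + 2 * n - 2) * riesz b q ψ := by
  have hd := (differentiableOn_riesz hb hn h.ascend).comp (f := fun q : ℂ => q + 1)
    (s := {q : ℂ | -1 < q.re}) (by fun_prop) (fun q (hq : -1 < q.re) => by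
      simp only [mem_ofPred_eq, Complex.add_re, Complex.one_re]; linarith)
  have hd' : DifferentiableOn ℂ (fun q : ℂ => (4 * (q + 1) + 2 * n - 2) * riesz b q ψ)
      {q : ℂ | -1 < q.re} := .mul (by fun_prop) (differentiableOn_riesz hb hn h)
  refine eqOn_of_eq_large (R := 1) hd hd' (fun x hx => ?_) hq
  have := riesz_ascend_of_large hb hn h (show 2 < x + 1 by linarith)
  simp only [Function.comp]
  push_cast at this
  rw [this]
  simp

lemma rieszExt_eq_riesz (hb : b < 0) (hn : 2 ≤ n) (N : ℕ) (h : IsAdm b Y ψ) {q : ℂ}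
    (hq : -1 < q.re) : rieszExt b N q ψ = riesz b q ψ := by
  induction N generalizing q ψ with
  | zero => rfl
  | succ N ih =>
    have hq' : -((n : ℝ) + 1) / 2 < q.re := by
      have : (2 : ℝ) ≤ n := by exact_mod_cast hn
      linarith
    rw [rieszExt, ih h.ascend (by simp; linarith), riesz_ascend hb hn h hq,
      mul_div_cancel_left₀ _ (den_ne_zero hq')]

lemma differentiableOn_rieszExt (hb : b < 0) (hn : 2 ≤ n) (N : ℕ) (h : IsAdm b Y ψ) :
    DifferentiableOn ℂ (fun q => rieszExt b N q ψ)
      {q : ℂ | -1 - (N : ℝ) < q.re ∧ -((n : ℝ) + 1) / 2 < q.re} := by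
  induction N generalizing ψ with
  | zero =>
    refine (differentiableOn_riesz hb hn h).mono fun q hq => ?_
    simpa using hq.1
  | succ N ih =>
    simp only [rieszExt]
    refine DifferentiableOn.div ?_ (by fun_prop) fun q hq => den_ne_zero hq.2
    refine (ih h.ascend).comp (f := fun q : ℂ => q + 1) (by fun_prop) fun q hq => ?_
    obtain ⟨h1, h2⟩ := hq
    push_cast at h1
    simp only [mem_ofPred_eq, Complex.add_re, Complex.one_re]
    constructor <;> linarith

lemma rieszExt_im (N : ℕ) (x : ℝ) : (rieszExt b N x ψ).im = 0 := by
  induction N generalizing x ψ with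
  | zero => rw [rieszExt, riesz_ofReal, Complex.ofReal_im]
  | succ N ih =>
    have h := ih (ψ := ascend ψ) (x + 1)
    have h1 : rieszExt b N ((x + 1 : ℝ) : ℂ) (ascend ψ) =
        ((rieszExt b N ((x + 1 : ℝ) : ℂ) (ascend ψ)).re : ℂ) :=
      Complex.ext (by simp) (by simpa using h)
    have h2 : 4 * ((x : ℂ) + 1) + 2 * n - 2 = ((4 * (x + 1) + 2 * n - 2 : ℝ) : ℂ) := by
      push_cast; ring
    push_cast at h1
    rw [rieszExt, h1, h2, ← Complex.ofReal_div, Complex.ofReal_im]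

/-! ### Continuity with respect to the test function -/

/-- The derivatives of order at most `N` of the family converge to zero uniformly on `trunc n b Y`.
This records the part of convergence in the space of test functions that the continuity of the
distributions needs. -/
def IsNull {ι : Type*} (b Y : ℝ) (l : Filter ι) : ℕ → (ι → Space n → ℝ) → Prop
  | 0, ψ => ∀ ε > 0, ∀ᶠ i in l, ∀ p ∈ trunc n b Y, |ψ i p| ≤ ε
  | N + 1, ψ => IsNull b Y l N ψ ∧ ∀ w, IsNull b Y l N (fun i => pd w (ψ i))

section null
variable {ι : Type*} {l : Filter ι} {Ψ Φ : ι → Space n → ℝ}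

lemma IsNull.congr (hb : b < 0) {N : ℕ} (h : IsNull b Y l N Ψ)
    (he : ∀ i, ∀ p ∈ nbhd n b, Φ i p = Ψ i p) : IsNull b Y l N Φ := by
  induction N generalizing Ψ Φ with
  | zero =>
    intro ε hε
    filter_upwards [h ε hε] with i hi p hp
    rw [he i p (trunc_subset_nbhd hb Y hp)]
    exact hi p hp
  | succ N ih => exact ⟨ih h.1 he, fun w => ih (h.2 w) fun i p hp => pd_congr (he i) hp⟩

lemma IsNull.add (hb : b < 0) {N : ℕ} (h : IsNull b Y l N Ψ) (h' : IsNull b Y l N Φ)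
    (hΨ : ∀ i, SmoothNear b (Ψ i)) (hΦ : ∀ i, SmoothNear b (Φ i)) :
    IsNull b Y l N (fun i p => Ψ i p + Φ i p) := by
  induction N generalizing Ψ Φ with
  | zero =>
    intro ε hε
    filter_upwards [h (ε / 2) (by positivity), h' (ε / 2) (by positivity)] with i hi hi' p hp
    exact (abs_add_le _ _).trans (by linarith [hi p hp, hi' p hp])
  | succ N ih =>
    exact ⟨ih h.1 h'.1 hΨ hΦ, fun w => (ih (h.2 w) (h'.2 w) (fun i => (hΨ i).pd w)
      (fun i => (hΦ i).pd w)).congr hb fun i p hp => pd_add (hΨ i) (hΦ i) hp⟩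

lemma IsNull.of_succ {N : ℕ} (h : IsNull b Y l (N + 1) Ψ) : IsNull b Y l N Ψ := h.1

lemma IsNull.mul_left (hb : b < 0) {N : ℕ} (hg : SmoothNear b g) (h : IsNull b Y l N Ψ)
    (hΨ : ∀ i, SmoothNear b (Ψ i)) : IsNull b Y l N (fun i p => g p * Ψ i p) := by
  induction N generalizing Ψ g with
  | zero =>
    intro ε hε
    obtain ⟨C, hC⟩ := (isCompact_trunc (n := n) (b := b) Y).exists_bound_of_continuousOn
      (hg.continuousOn.mono (trunc_subset_nbhd hb Y))
    filter_upwards [h (ε / (|C| + 1)) (by positivity)] with i hi p hp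
    rw [abs_mul]
    calc |g p| * |Ψ i p| ≤ (|C| + 1) * (ε / (|C| + 1)) := by
          refine mul_le_mul ?_ (hi p hp) (abs_nonneg _) (by positivity)
          exact ((hC p hp).trans (le_abs_self C)).trans (by linarith)
      _ = ε := by field_simp
  | succ N ih =>
    refine ⟨ih hg h.1 hΨ, fun w => ?_⟩
    refine ((ih hg (h.2 w) fun i => (hΨ i).pd w).add hb (ih (hg.pd w) h.1 hΨ)
      (fun i => hg.mul ((hΨ i).pd w)) (fun i => (hg.pd w).mul (hΨ i))).congr hb
      fun i p hp => pd_mul hg (hΨ i) hp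

lemma IsNull.sum (hb : b < 0) {N : ℕ} {κ : Type*} (s : Finset κ) {Ψ : κ → ι → Space n → ℝ}
    (h : ∀ j ∈ s, IsNull b Y l N (Ψ j)) (hΨ : ∀ j ∈ s, ∀ i, SmoothNear b (Ψ j i)) :
    IsNull b Y l N (fun i p => ∑ j ∈ s, Ψ j i p) := by
  classical
  induction s using Finset.induction_on with
  | empty =>
    simp only [Finset.sum_empty]
    clear h hΨ
    have : ∀ N, IsNull b Y l N (fun (_ : ι) (_ : Space n) => (0 : ℝ)) := fun N => by
      induction N with
      | zero => exact fun ε hε => .of_forall fun i p _ => by simpa using hε.le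
      | succ N ih =>
        exact ⟨ih, fun w => ih.congr hb (by simp [pd])⟩
    exact this N
  | insert j s hj ih =>
    simp only [Finset.sum_insert hj]
    have hs : ∀ j ∈ s, ∀ i, SmoothNear b (Ψ j i) := fun j hj =>
      hΨ j (Finset.mem_insert_of_mem hj)
    exact (h j (Finset.mem_insert_self _ _)).add hb
      (ih (fun j hj => h j (Finset.mem_insert_of_mem hj)) hs)
      (hΨ j (Finset.mem_insert_self _ _)) fun i => .sum fun j hj => hs j hj i

lemma IsNull.tri (hb : b < 0) {N : ℕ} (h : IsNull b Y l (N + 2) Ψ)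
    (hΨ : ∀ i, SmoothNear b (Ψ i)) : IsNull b Y l N (fun i => tri (Ψ i)) := by
  have h2 : ∀ w, IsNull b Y l N (fun i => pd w (pd w (Ψ i))) := fun w => (h.2 w).2 w
  exact ((IsNull.sum hb _ (fun i _ => h2 _) fun j _ i => ((hΨ i).pd _).pd _).mul_left hb
    smoothNear_snd fun i => .sum fun j _ => ((hΨ i).pd _).pd _).add hb (h2 _)
    (fun i => smoothNear_snd.mul (.sum fun j _ => ((hΨ i).pd _).pd _))
    fun i => ((hΨ i).pd _).pd _

lemma IsNull.ascend (hb : b < 0) {N : ℕ} (h : IsNull b Y l (N + 2) Ψ)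
    (hΨ : ∀ i, SmoothNear b (Ψ i)) : IsNull b Y l N (fun i => ascend (Ψ i)) := by
  have h1 : ∀ i, SmoothNear b fun p => -(p.2)⁻¹ * Ψ i p := fun i => smoothNear_inv_snd.mul (hΨ i)
  have h2 : ∀ i, SmoothNear b fun p => -(2 * p.2 ^ 2)⁻¹ * Ψ i p :=
    fun i => smoothNear_inv_snd_sq.mul (hΨ i)
  exact ((h.mul_left hb smoothNear_inv_snd hΨ).tri hb h1).add hb
    ((h.of_succ.mul_left hb smoothNear_inv_snd_sq hΨ).2 _) (fun i => (h1 i).tri)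
    fun i => (h2 i).pd _

lemma tendsto_riesz (hb : b < 0) (hn : 2 ≤ n) (h : IsNull b Y l 0 Ψ) (hΨ : ∀ i, IsAdm b Y (Ψ i))
    {q : ℂ} (hq : -1 < q.re) : Tendsto (fun i => riesz b q (Ψ i)) l (𝓝 0) := by
  simp_rw [riesz_eq]
  rw [← zero_mul (Complex.Gamma (q + 1))⁻¹]
  refine Tendsto.mul_const _ ?_
  have hint := integrableOn_indicator_k_rpow hb hn Y 1 hq
  set M := ∫ p in conoid n b, k b p ^ q.re * {p : Space n | Y ≤ p.2}.indicator (fun _ => (1 : ℝ)) p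
    with hM
  have hM0 : 0 ≤ M := by
    refine setIntegral_nonneg measurableSet_conoid fun p hp => ?_
    exact mul_nonneg (Real.rpow_nonneg (k_pos_of_mem hp).le _)
      (indicator_nonneg (fun _ _ => zero_le_one) _)
  rw [Metric.tendsto_nhds]
  intro ε hε
  filter_upwards [h (ε / (M + 1) / 2) (by positivity)] with i hi
  rw [dist_zero_right]
  have hle : ‖∫ p in conoid n b, ((k b p : ℝ) : ℂ) ^ q * ((Ψ i p : ℝ) : ℂ)‖ ≤
      ∫ p in conoid n b, ε / (M + 1) / 2 * (k b p ^ q.re *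
        {p : Space n | Y ≤ p.2}.indicator (fun _ => (1 : ℝ)) p) := by
    refine norm_integral_le_of_norm_le (hint.const_mul _) ?_
    filter_upwards [ae_restrict_mem measurableSet_conoid] with p hp
    rw [norm_mul, Complex.norm_cpow_eq_rpow_re_of_pos (k_pos_of_mem hp), Complex.norm_real,
      mul_left_comm]
    refine mul_le_mul_of_nonneg_left ?_ (Real.rpow_nonneg (k_pos_of_mem hp).le _)
    by_cases hY : Y ≤ p.2
    · simpa [indicator, hY] using hi p (mem_trunc_of_mem_conoid hb hp hY)
    · simp [indicator, hY, (hΨ i).zero p (conoid_subset_nbhd hb hp) (not_le.1 hY)]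
  refine hle.trans_lt ?_
  rw [integral_const_mul, ← hM]
  calc ε / (M + 1) / 2 * M ≤ ε / (M + 1) / 2 * (M + 1) := by gcongr; linarith
    _ = ε / 2 := by field_simp
    _ < ε := by linarith

lemma tendsto_rieszExt (hb : b < 0) (hn : 2 ≤ n) (N : ℕ) (h : IsNull b Y l (2 * N) Ψ)
    (hΨ : ∀ i, IsAdm b Y (Ψ i)) {q : ℂ} (hq : -1 - (N : ℝ) < q.re) :
    Tendsto (fun i => rieszExt b N q (Ψ i)) l (𝓝 0) := by
  induction N generalizing q Ψ with
  | zero => exact tendsto_riesz hb hn h hΨ (by simpa using hq)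
  | succ N ih =>
    have := ih (h.ascend hb fun i => (hΨ i).smooth) (fun i => (hΨ i).ascend) (q := q + 1) (by
      push_cast at hq; simp only [Complex.add_re, Complex.one_re]; linarith)
    simpa [rieszExt] using this.div_const (4 * (q + 1) + 2 * (n : ℂ) - 2)

end null

end

section

variable {n : ℕ} {b Y : ℝ} {φ ψ ψ' g : Space n → ℝ}

/-! ### The continued family -/

/-- The analytic continuation of `riesz b q ψ` to `Re q > -(n+1)/2`. Taking `N = n` steps of
`rieszExt` covers this half-plane as `n ≥ 1`, and its points avoid the zero of `4(q+1) + 2n - 2`. -/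
noncomputable def rieszC (b : ℝ) (q : ℂ) (ψ : Space n → ℝ) : ℂ := rieszExt b n q ψ

lemma rieszC_eq_riesz (hb : b < 0) (hn : 2 ≤ n) (h : IsAdm b Y ψ) {q : ℂ}
    (hq : -1 < q.re) : rieszC b q ψ = riesz b q ψ := rieszExt_eq_riesz hb hn n h hq

lemma rieszC_eq_riesz_ofReal (hb : b < 0) (hn : 2 ≤ n) (h : IsAdm b Y ψ) {x : ℝ}
    (hx : -1 < x) : rieszC b x ψ = riesz b x ψ := rieszC_eq_riesz hb hn h (by simpa using hx)

lemma differentiableOn_rieszC (hb : b < 0) (hn : 2 ≤ n) (h : IsAdm b Y ψ) :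
    DifferentiableOn ℂ (fun q => rieszC b q ψ) {q : ℂ | -((n : ℝ) + 1) / 2 < q.re} := by
  refine (differentiableOn_rieszExt hb hn n h).mono fun q (hq : _ < q.re) => ⟨?_, hq⟩
  have : (2 : ℝ) ≤ n := by exact_mod_cast hn
  linarith

lemma differentiableOn_rieszC_sub_one (hb : b < 0) (hn : 2 ≤ n) (h : IsAdm b Y ψ) :
    DifferentiableOn ℂ (fun q => rieszC b (q - 1) ψ) {q : ℂ | -((n : ℝ) - 1) / 2 < q.re} := by
  refine (differentiableOn_rieszC hb hn h).comp (f := fun q : ℂ => q - 1) (by fun_prop)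
    fun q (hq : _ < q.re) => ?_
  simp only [mem_ofPred_eq, Complex.sub_re, Complex.one_re]
  linarith

lemma differentiableOn_rieszC_add_one (hb : b < 0) (hn : 2 ≤ n) (h : IsAdm b Y ψ) :
    DifferentiableOn ℂ (fun q => rieszC b (q + 1) ψ) {q : ℂ | -((n : ℝ) + 1) / 2 < q.re} := by
  refine (differentiableOn_rieszC hb hn h).comp (f := fun q : ℂ => q + 1) (by fun_prop)
    fun q (hq : _ < q.re) => ?_
  simp only [mem_ofPred_eq, Complex.add_re, Complex.one_re]
  linarith

lemma rieszC_congr (hb : b < 0) (hn : 2 ≤ n) (h : IsAdm b Y ψ) (h' : IsAdm b Y ψ')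
    (he : ∀ p ∈ conoid n b, ψ p = ψ' p) {q : ℂ} (hq : -((n : ℝ) + 1) / 2 < q.re) :
    rieszC b q ψ = rieszC b q ψ' :=
  eqOn_of_eq_large (R := 0) (differentiableOn_rieszC hb hn h) (differentiableOn_rieszC hb hn h')
    (fun x hx => by
      rw [rieszC_eq_riesz_ofReal hb hn h (by linarith), rieszC_eq_riesz_ofReal hb hn h'
        (by linarith), riesz_congr he]) hq

lemma rieszC_add (hb : b < 0) (hn : 2 ≤ n) (h : IsAdm b Y ψ) (h' : IsAdm b Y ψ')
    {q : ℂ} (hq : -((n : ℝ) + 1) / 2 < q.re) :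
    rieszC b q (fun p => ψ p + ψ' p) = rieszC b q ψ + rieszC b q ψ' :=
  eqOn_of_eq_large (R := 0) (g := fun q => rieszC b q ψ + rieszC b q ψ')
    (differentiableOn_rieszC hb hn (h.add h'))
    ((differentiableOn_rieszC hb hn h).add (differentiableOn_rieszC hb hn h'))
    (fun x hx => by
      rw [rieszC_eq_riesz_ofReal hb hn h (by linarith), rieszC_eq_riesz_ofReal hb hn h'
        (by linarith), rieszC_eq_riesz_ofReal hb hn (h.add h') (by linarith),
        riesz_add hb hn h h' (by simp; linarith)]) hq

lemma rieszC_const_mul (hb : b < 0) (hn : 2 ≤ n) (h : IsAdm b Y ψ) (a : ℝ)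
    {q : ℂ} (hq : -((n : ℝ) + 1) / 2 < q.re) :
    rieszC b q (fun p => a * ψ p) = a * rieszC b q ψ :=
  eqOn_of_eq_large (R := 0) (g := fun q => a * rieszC b q ψ)
    (differentiableOn_rieszC hb hn (h.mul_left (.const a)))
    ((differentiableOn_rieszC hb hn h).const_mul (a : ℂ))
    (fun x hx => by
      rw [rieszC_eq_riesz_ofReal hb hn h (by linarith),
        rieszC_eq_riesz_ofReal hb hn (h.mul_left (.const a)) (by linarith),
        riesz_const_mul]) hq

lemma rieszC_sum (hb : b < 0) (hn : 2 ≤ n) {ι : Type*} (s : Finset ι) {ψ : ι → Space n → ℝ}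
    (h : ∀ i ∈ s, IsAdm b Y (ψ i)) {q : ℂ} (hq : -((n : ℝ) + 1) / 2 < q.re) :
    rieszC b q (fun p => ∑ i ∈ s, ψ i p) = ∑ i ∈ s, rieszC b q (ψ i) :=
  eqOn_of_eq_large (R := 0) (g := fun q => ∑ i ∈ s, rieszC b q (ψ i))
    (differentiableOn_rieszC hb hn (.sum h))
    (.fun_sum fun i hi => differentiableOn_rieszC hb hn (h i hi))
    (fun x hx => by
      rw [rieszC_eq_riesz_ofReal hb hn (.sum h) (by linarith), riesz_sum hb hn s h
        (by simp; linarith)]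
      exact Finset.sum_congr rfl fun i hi =>
        (rieszC_eq_riesz_ofReal hb hn (h i hi) (by linarith)).symm) hq

lemma rieszC_k_mul (hb : b < 0) (hn : 2 ≤ n) (h : IsAdm b Y ψ)
    {q : ℂ} (hq : -((n : ℝ) + 1) / 2 < q.re) :
    rieszC b q (fun p => k b p * ψ p) = (q + 1) * rieszC b (q + 1) ψ :=
  eqOn_of_eq_large (R := 0) (g := fun q => (q + 1) * rieszC b (q + 1) ψ)
    (differentiableOn_rieszC hb hn (h.mul_left smoothNear_k))
    (.mul (by fun_prop) (differentiableOn_rieszC_add_one hb hn h))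
    (fun x hx => by
      rw [rieszC_eq_riesz hb hn h (by simp; linarith),
        rieszC_eq_riesz_ofReal hb hn (h.mul_left smoothNear_k) (by linarith),
        riesz_k_mul (by simp; linarith)]) hq

lemma rieszC_pd_dirX (hb : b < 0) (hn : 2 ≤ n) (h : IsAdm b Y ψ) (i : Fin n)
    {q : ℂ} (hq : -((n : ℝ) - 1) / 2 < q.re) :
    rieszC b q (pd (dirX i) ψ) = 2 * rieszC b (q - 1) (fun p => p.1 i * ψ p) := by
  have hx := h.mul_left (smoothNear_coord i)
  refine eqOn_of_eq_large (R := 1) (c := -((n : ℝ) - 1) / 2)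
    (g := fun q => 2 * rieszC b (q - 1) (fun p => p.1 i * ψ p))
    ((differentiableOn_rieszC hb hn (h.pd _)).mono fun q (hq : _ < q.re) => ?_)
    ((differentiableOn_rieszC_sub_one hb hn hx).const_mul 2) (fun x hx' => ?_) hq
  · simp only [mem_ofPred_eq]; linarith
  · rw [rieszC_eq_riesz_ofReal hb hn (h.pd _) (by linarith),
      rieszC_eq_riesz hb hn hx (by simp; linarith), riesz_pd hb hn h hx']
    have h2 := riesz_const_mul (b := b) (ψ := fun p => p.1 i * ψ p) (-2) ((x - 1 : ℝ) : ℂ)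
    have h3 : riesz b ((x - 1 : ℝ) : ℂ) (fun p => pd (dirX i) (k b) p * ψ p) =
        riesz b ((x - 1 : ℝ) : ℂ) (fun p => -2 * (p.1 i * ψ p)) := riesz_congr (fun p hp => by
      rw [pd_dirX_k (conoid_subset_nbhd hb hp), mul_assoc]) _
    rw [h3, h2]
    push_cast
    ring

lemma rieszC_mul_tri (hb : b < 0) (hn : 2 ≤ n) (hφ : IsAdm b Y φ) (hg : SmoothNear b g)
    {q : ℂ} (hq : -((n : ℝ) - 1) / 2 < q.re) :
    rieszC b q (fun p => g p * tri φ p) =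
      4 * (q - 1) * rieszC b (q - 1) (fun p => -p.2 * (g p * φ p)) +
      rieszC b (q - 1) (fun p => transport b g p * φ p) +
      rieszC b q (fun p => tri g p * φ p) := by
  have h1 : IsAdm b Y (fun p => g p * tri φ p) := hφ.tri.mul_left hg
  have h2 : IsAdm b Y (fun p => -p.2 * (g p * φ p)) :=
    (hφ.mul_left hg).mul_left smoothNear_snd.neg
  have h3 : IsAdm b Y (fun p => transport b g p * φ p) := hφ.mul_left hg.transport
  have h4 : IsAdm b Y (fun p => tri g p * φ p) := hφ.mul_left hg.tri
  have hsub : {q : ℂ | -((n : ℝ) - 1) / 2 < q.re} ⊆ {q : ℂ | -((n : ℝ) + 1) / 2 < q.re} :=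
    fun q (hq : _ < q.re) => by simp only [mem_ofPred_eq]; linarith
  refine eqOn_of_eq_large (R := 2) (c := -((n : ℝ) - 1) / 2)
    (g := fun q => 4 * (q - 1) * rieszC b (q - 1) (fun p => -p.2 * (g p * φ p)) +
      rieszC b (q - 1) (fun p => transport b g p * φ p) +
      rieszC b q (fun p => tri g p * φ p))
    ((differentiableOn_rieszC hb hn h1).mono hsub)
    ((DifferentiableOn.add (.mul (by fun_prop) (differentiableOn_rieszC_sub_one hb hn h2))
      (differentiableOn_rieszC_sub_one hb hn h3)).add
      ((differentiableOn_rieszC hb hn h4).mono hsub)) (fun x hx => ?_) hq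
  have := riesz_mul_tri hb hn hφ hg hx
  push_cast at this
  rw [rieszC_eq_riesz_ofReal hb hn h1 (by linarith), this,
    rieszC_eq_riesz hb hn h2 (by simp; linarith), rieszC_eq_riesz hb hn h3 (by simp; linarith),
    rieszC_eq_riesz_ofReal hb hn h4 (by linarith)]

lemma rieszC_ofReal_re (x : ℝ) : ((rieszC b x ψ).re : ℂ) = rieszC b x ψ :=
  Complex.ext (by simp) (by rw [Complex.ofReal_im, rieszC, rieszExt_im])

/-! ### Test functions and distributions -/

lemma smoothNear_test (φ : Test n) : SmoothNear b φ := φ.contDiff.contDiffOn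

lemma pd_test (φ : Test n) (w : Space n) : pd w φ = (∂_{w} φ : Test n) := by
  ext p
  have h : DifferentiableAt ℝ φ p := (φ.contDiff.differentiable (by simp)) p
  rw [TestFunction.lineDerivOp_eq_lineDerivCLM ℝ, TestFunction.lineDerivCLM_apply, pd]
  simp [h.lineDeriv_eq_fderiv]

lemma exists_isAdm_of_subset {K : Set (Space n)} (hK : IsCompact K) :
    ∃ Y : ℝ, ∀ (b : ℝ) (φ : Test n), tsupport φ ⊆ K → IsAdm b Y φ := by
  obtain ⟨Y, hY⟩ := (hK.image continuous_snd).bddBelow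
  refine ⟨Y, fun b φ hφ => ⟨smoothNear_test φ, fun p _ hp => ?_⟩⟩
  exact image_eq_zero_of_notMem_tsupport fun h =>
    (not_le.2 hp) (hY (mem_image_of_mem _ (hφ h)))

lemma exists_isAdm (b : ℝ) (φ : Test n) : ∃ Y, IsAdm b Y φ :=
  let ⟨Y, hY⟩ := exists_isAdm_of_subset φ.hasCompactSupport
  ⟨Y, hY b φ subset_rfl⟩

/-- A family of test functions that tends to zero does so with all derivatives. -/
lemma isNull_test {ι : Type*} {l : Filter ι} {Φ : ι → Test n} (h : Tendsto Φ l (𝓝 0)) (N : ℕ) :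
    IsNull b Y l N (fun i => Φ i) := by
  induction N generalizing Φ with
  | zero =>
    intro ε hε
    have h1 := ((TestFunction.toBoundedContinuousFunctionCLM ℝ (n := ⊤) (F := ℝ)
      (Ω := (⊤ : TopologicalSpace.Opens (Space n)))).continuous.tendsto 0).comp h
    rw [map_zero] at h1
    filter_upwards [Metric.tendsto_nhds.1 h1 ε hε] with i hi p _
    rw [dist_zero_right] at hi
    exact (BoundedContinuousFunction.norm_coe_le_norm
      (TestFunction.toBoundedContinuousFunctionCLM ℝ (Φ i)) p).trans hi.le
  | succ N ih =>
    refine ⟨ih h, fun w => ?_⟩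
    simp_rw [pd_test]
    refine ih ?_
    have := ((TestFunction.lineDerivCLM ℝ w : Test n →L[ℝ] Test n).continuous.tendsto 0).comp h
    rwa [map_zero] at this

/-- The linear form `φ ↦ ⟨w χ_x(k), φ⟩`. -/
noncomputable def rieszForm (hb : b < 0) (hn : 2 ≤ n) {x : ℝ} (hx : -((n : ℝ) + 1) / 2 < x)
    {w : Space n → ℝ} (hw : SmoothNear b w) : Test n →ₗ[ℝ] ℝ where
  toFun φ := (rieszC b x (fun p => w p * φ p)).re
  map_add' φ φ' := by
    obtain ⟨Y, hY⟩ := exists_isAdm b φ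
    obtain ⟨Y', hY'⟩ := exists_isAdm b φ'
    rw [← Complex.add_re, ← rieszC_add hb hn ((hY.mul_left hw).mono (min_le_left Y Y'))
      ((hY'.mul_left hw).mono (min_le_right Y Y')) (by simpa using hx)]
    simp [mul_add]
  map_smul' a φ := by
    obtain ⟨Y, hY⟩ := exists_isAdm b φ
    have := rieszC_const_mul hb hn (hY.mul_left hw) a (q := x) (by simpa using hx)
    rw [RingHom.id_apply, smul_eq_mul, ← Complex.re_ofReal_mul, ← this]
    simp [mul_left_comm]

/-- The distribution `w χ_x(k)`. -/
noncomputable def rieszDistr (hb : b < 0) (hn : 2 ≤ n) {x : ℝ} (hx : -((n : ℝ) + 1) / 2 < x)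
    {w : Space n → ℝ} (hw : SmoothNear b w) : Distr n where
  toLinearMap := rieszForm hb hn hx hw
  cont := by
    refine (TestFunction.continuous_iff_continuous_comp _).2 fun K hK => ?_
    obtain ⟨Y, hY⟩ := exists_isAdm_of_subset K.isCompact
    let ι := TestFunction.ofSupportedInCLM ℝ (n := ⊤) (F := ℝ) hK
    have hadm : ∀ f, IsAdm b Y (ι f) := fun f => hY b _ f.tsupport_subset
    refine continuous_of_continuousAt_zero (rieszForm hb hn hx hw ∘ₗ ι.toLinearMap) ?_
    have h0 : Tendsto (fun f => ι f) (𝓝 0) (𝓝 0) := by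
      simpa using ι.continuous.tendsto 0
    have hn' : (2 : ℝ) ≤ n := by exact_mod_cast hn
    have h1 := tendsto_rieszExt hb hn n ((isNull_test h0 (2 * n)).mul_left hb hw
      fun f => smoothNear_test _) (fun f => (hadm f).mul_left hw) (q := x) (by
        simp only [Complex.ofReal_re]; linarith)
    rw [ContinuousAt, map_zero]
    exact (Complex.continuous_re.tendsto 0).comp h1

lemma rieszDistr_apply (hb : b < 0) (hn : 2 ≤ n) {x : ℝ} (hx : -((n : ℝ) + 1) / 2 < x)
    {w : Space n → ℝ} (hw : SmoothNear b w) (φ : Test n) :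
    ((rieszDistr hb hn hx hw φ : ℝ) : ℂ) = rieszC b x (fun p => w p * φ p) :=
  rieszC_ofReal_re x

end

section

variable {n : ℕ} {b Y : ℝ}

/-! ### The vertex -/

lemma sub_aOf_nonneg (hb : b < 0) {y : ℝ} (hy : y ≤ b) : 0 ≤ tOf y - aOf b := by
  rw [aOf_eq_tOf hb.le]; linarith [tOf_anti hy]

lemma isAdm_comp_snd {f : ℝ → ℝ} (hf : ContDiffOn ℝ ∞ f (Iio 0)) (h0 : ∀ y < Y, f y = 0) :
    IsAdm b Y (fun p : Space n => f p.2) := ⟨.comp_snd hf, fun _ _ h => h0 _ h⟩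

/-- Polar coordinates on each slice reduce the pairing with a function of `y` to one integral. -/
lemma riesz_comp_snd (hb : b < 0) (hn : 2 ≤ n) {f : ℝ → ℝ} (hf : ContDiffOn ℝ ∞ f (Iio 0))
    (hY : Y < b) (h0 : ∀ y < Y, f y = 0) {x : ℝ} (hx : -1 < x) :
    riesz b x (fun p : Space n => f p.2) = ((Real.pi ^ (n / 2 : ℝ) / Real.Gamma (x + 1 + n / 2) *
      ∫ y in Y..b, f y * (tOf y - aOf b) ^ (2 * x + n) : ℝ) : ℂ) := by
  have hadm : IsAdm b Y (fun p : Space n => f p.2) := isAdm_comp_snd hf h0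
  have hint := hadm.integrableOn_rpow hb hn hx
  rw [riesz_ofReal]
  congr 1
  rw [← integrable_indicator_iff measurableSet_conoid] at hint
  rw [← integral_indicator measurableSet_conoid, Measure.volume_eq_prod,
    integral_prod_symm _ hint, intervalIntegral.integral_of_le hY.le,
    ← integral_Icc_eq_integral_Ioc, integral_Icc_eq_integral_Ico,
    ← integral_indicator measurableSet_Ico, ← integral_const_mul, ← integral_div]
  congr 1
  ext y
  have h1 : ∀ z : EuclideanSpace ℝ (Fin n),
      (conoid n b).indicator (fun p => k b p ^ x * f p.2) (z, y) =
      (conoid n b ∩ {p | Y ≤ p.2}).indicator (fun p => k b p ^ x) (z, y) * f y := fun z => by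
    by_cases hz : (z, y) ∈ conoid n b
    · rcases lt_or_ge y Y with hy | hy
      · simp [h0 y hy, indicator]
      · rw [indicator_of_mem hz, indicator_of_mem
          (show (z, y) ∈ conoid n b ∩ {p | Y ≤ p.2} from ⟨hz, hy⟩)]
    · rw [indicator_of_notMem hz, indicator_of_notMem (fun h => hz h.1), zero_mul]
  simp_rw [h1, integral_mul_const, indicator_conoid_slice hb]
  by_cases hy : Y ≤ y ∧ y < b
  · have hs : 0 < tOf y - aOf b := by
      rw [aOf_eq_tOf hb.le]; linarith [tOf_strictAnti hy.2 hb.le]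
    rw [indicator_of_mem (show y ∈ Ico Y b from hy)]
    simp only [hy, and_self, if_true]
    rw [integral_radial (by omega) hs hx]
    have := (Real.Gamma_pos_of_pos (show 0 < x + 1 by linarith)).ne'
    field_simp
  · rw [indicator_of_notMem (show y ∉ Ico Y b from hy)]
    simp [hy]

/-- For a function of `y` alone the integral over the slices is explicit, and an integration by parts
in `y` turns the vanishing factor `4x + 2n - 2` into a finite integral. -/
lemma rieszC_comp_snd_of_pos (hb : b < 0) (hn : 2 ≤ n) {f f' : ℝ → ℝ}
    (hf : ContDiffOn ℝ ∞ f (Iio 0)) (hY : Y < b) (h0 : ∀ y ≤ Y, f y = 0)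
    (hf' : ∀ y < 0, HasDerivAt (fun y => f y / rho y) (f' y) y) (hf'c : ContinuousOn f' (Iio 0))
    {x : ℝ} (hx : 0 < x) :
    (4 * x + 2 * n - 2) * rieszC b ((x : ℂ) - 1) (fun p : Space n => f p.2) =
      ((Real.pi ^ (n / 2 : ℝ) / Real.Gamma (x + n / 2) *
        (2 * ∫ y in Y..b, f' y * (tOf y - aOf b) ^ (2 * x + n - 1)) : ℝ) : ℂ) := by
  have hn' : (2 : ℝ) ≤ n := by exact_mod_cast hn
  have hadm : IsAdm b Y (fun p : Space n => f p.2) := isAdm_comp_snd hf fun y hy => h0 y hy.le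
  have h1 := riesz_comp_snd hb hn hf hY (fun y hy => h0 y hy.le) (show -1 < x - 1 by linarith)
  rw [rieszC_eq_riesz hb hn hadm (by simp; linarith), ← Complex.ofReal_one, ← Complex.ofReal_sub,
    h1]
  have hsub : ∀ y ∈ uIcc Y b, y < 0 := fun y hy => by
    rw [uIcc_of_le hY.le] at hy; linarith [hy.2]
  have h2 := intervalIntegral.integral_mul_deriv_eq_deriv_mul (a := Y) (b := b)
    (u := fun y => f y / rho y) (u' := f') (v := fun y => (tOf y - aOf b) ^ (2 * x + n - 1))
    (v' := fun y => -rho y * (2 * x + n - 1) * (tOf y - aOf b) ^ (2 * x + n - 1 - 1))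
    (fun y hy => hf' y (hsub y hy))
    (fun y hy => ((hasDerivAt_tOf (hsub y hy)).sub_const (aOf b)).rpow_const
      (Or.inr (by linarith)))
    ((hf'c.mono hsub).intervalIntegrable)
    (by
      refine ContinuousOn.intervalIntegrable (Continuous.continuousOn ?_)
      refine (continuous_rho.neg.mul continuous_const).mul
        ((continuous_tOf.sub continuous_const).rpow_const fun _ => Or.inr (by linarith)))
  have hb0 : tOf b - aOf b = 0 := by rw [aOf_eq_tOf hb.le, sub_self]
  simp only [hb0, h0 Y le_rfl, zero_div, zero_mul, sub_zero] at h2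
  rw [Real.zero_rpow (by linarith : 2 * x + n - 1 ≠ 0), mul_zero, zero_sub] at h2
  have h3 : ∫ y in Y..b, f y / rho y * (-rho y * (2 * x + n - 1) *
      (tOf y - aOf b) ^ (2 * x + n - 1 - 1)) =
      -(2 * x + n - 1) * ∫ y in Y..b, f y * (tOf y - aOf b) ^ (2 * (x - 1) + n) := by
    rw [← intervalIntegral.integral_const_mul]
    refine intervalIntegral.integral_congr fun y hy => ?_
    have := (rho_pos (hsub y hy)).ne'
    have e : 2 * x + n - 1 - 1 = 2 * (x - 1) + n := by ring
    rw [e]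
    field_simp
  rw [h3] at h2
  have h4 : x - 1 + 1 + (n : ℝ) / 2 = x + n / 2 := by ring
  rw [h4]
  have h5 : (4 * (x : ℂ) + 2 * n - 2) = ((2 * (2 * x + n - 1) : ℝ) : ℂ) := by push_cast; ring
  rw [h5, ← Complex.ofReal_mul]
  congr 1
  linear_combination (-2 * (Real.pi ^ (n / 2 : ℝ) / Real.Gamma (x + n / 2))) * h2

lemma differentiableOn_integral_cpow (hb : b < 0) {h : ℝ → ℝ}
    (hh : ContinuousOn h (Iio 0)) (n : ℕ) :
    DifferentiableOn ℂ (fun q : ℂ => ∫ y in Ioo Y b, ((h y : ℝ) : ℂ) *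
      ((tOf y - aOf b : ℝ) : ℂ) ^ (2 * q + n - 1)) {q : ℂ | -((n : ℝ) - 1) / 2 < q.re} := by
  intro q₀ (hq₀ : _ < q₀.re)
  refine DifferentiableAt.differentiableWithinAt ?_
  set δ : ℝ := (q₀.re + ((n : ℝ) - 1) / 2) / 2 with hδ
  have hδ0 : 0 < δ := by rw [hδ]; linarith
  have hsub : Ioo Y b ⊆ Iio 0 := fun y hy => hy.2.trans hb
  have hIcc : Icc Y b ⊆ Iio 0 := fun y hy => hy.2.trans_lt hb
  set S := tOf Y - aOf b with hS
  set M : ℝ := 2 * (q₀.re + 2 * δ) + n - 1 with hM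
  refine differentiableAt_integral_of_norm_le (δ := δ) (bound := fun y => |h y| * (1 + (1 + |S|) ^ M))
    hδ0 (fun q => ?_) ?_ ?_ ?_
  · refine AEStronglyMeasurable.mul ?_ ?_
    · exact (Complex.continuous_ofReal.comp_continuousOn (hh.mono hsub)).aestronglyMeasurable
        measurableSet_Ioo
    · exact ((Complex.measurable_ofReal.comp
        (continuous_tOf.sub continuous_const).measurable).pow_const _).aestronglyMeasurable
  · filter_upwards [ae_restrict_mem measurableSet_Ioo] with y hy q
    have hs : ((tOf y - aOf b : ℝ) : ℂ) ≠ 0 := by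
      have := tOf_strictAnti hy.2 hb.le
      rw [Complex.ofReal_ne_zero, aOf_eq_tOf hb.le]; linarith
    exact (DifferentiableAt.const_cpow (by fun_prop) (Or.inl hs)).const_mul _
  · filter_upwards [ae_restrict_mem measurableSet_Ioo] with y hy q hq
    have hs : 0 < tOf y - aOf b := by
      have := tOf_strictAnti hy.2 hb.le
      rw [aOf_eq_tOf hb.le]; linarith
    have h2 := abs_le.1 ((Complex.abs_re_le_norm _).trans (mem_closedBall_iff_norm.1 hq))
    rw [Complex.sub_re] at h2
    rw [norm_mul, Complex.norm_real, Complex.norm_cpow_eq_rpow_re_of_pos hs, Real.norm_eq_abs]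
    refine mul_le_mul_of_nonneg_left ?_ (abs_nonneg _)
    have hre : (2 * q + n - 1 : ℂ).re = 2 * q.re + n - 1 := by simp
    rw [hre]
    have hp : 0 ≤ 2 * q.re + n - 1 := by rw [hδ] at h2; linarith
    have hpM : 2 * q.re + n - 1 ≤ M := by rw [hM]; linarith
    have hsS : tOf y - aOf b ≤ 1 + |S| := by
      have := tOf_anti hy.1.le
      have := le_abs_self S
      linarith
    calc (tOf y - aOf b) ^ (2 * q.re + n - 1) ≤ (1 + |S|) ^ (2 * q.re + n - 1) :=
          Real.rpow_le_rpow hs.le hsS hp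
      _ ≤ (1 + |S|) ^ M := Real.rpow_le_rpow_of_exponent_le (by linarith [abs_nonneg S]) hpM
      _ ≤ _ := by linarith
  · exact (((hh.mono hIcc).abs.integrableOn_Icc (μ := volume)).mono_set
      Ioo_subset_Icc_self).mul_const _

lemma rieszC_comp_snd (hb : b < 0) (hn : 2 ≤ n) {f f' : ℝ → ℝ}
    (hf : ContDiffOn ℝ ∞ f (Iio 0)) (hY : Y < b) (h0 : ∀ y ≤ Y, f y = 0)
    (hf' : ∀ y < 0, HasDerivAt (fun y => f y / rho y) (f' y) y) (hf'c : ContinuousOn f' (Iio 0))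
    {q : ℂ} (hq : -((n : ℝ) - 1) / 2 < q.re) :
    (4 * q + 2 * n - 2) * rieszC b (q - 1) (fun p : Space n => f p.2) =
      ((Real.pi ^ (n / 2 : ℝ) : ℝ) : ℂ) * (Complex.Gamma (q + n / 2))⁻¹ *
        (2 * ∫ y in Ioo Y b, ((f' y : ℝ) : ℂ) * ((tOf y - aOf b : ℝ) : ℂ) ^ (2 * q + n - 1)) := by
  have hadm : IsAdm b Y (fun p : Space n => f p.2) := isAdm_comp_snd hf fun y hy => h0 y hy.le
  refine eqOn_of_eq_large (c := -((n : ℝ) - 1) / 2) (R := 0)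
    (f := fun q => (4 * q + 2 * n - 2) * rieszC b (q - 1) (fun p : Space n => f p.2))
    (g := fun q => ((Real.pi ^ (n / 2 : ℝ) : ℝ) : ℂ) * (Complex.Gamma (q + n / 2))⁻¹ *
        (2 * ∫ y in Ioo Y b, ((f' y : ℝ) : ℂ) * ((tOf y - aOf b : ℝ) : ℂ) ^ (2 * q + n - 1)))
    (.mul (by fun_prop) (differentiableOn_rieszC_sub_one hb hn hadm))
    (((Differentiable.const_mul (Complex.differentiable_one_div_Gamma.comp
      (by fun_prop : Differentiable ℂ fun q : ℂ => q + n / 2)) _).differentiableOn).mul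
      ((differentiableOn_integral_cpow hb hf'c n).const_mul 2)) (fun x hx => ?_) hq
  rw [rieszC_comp_snd_of_pos hb hn hf hY h0 hf' hf'c hx, intervalIntegral.integral_of_le hY.le,
    integral_Ioc_eq_integral_Ioo]
  push_cast
  rw [div_eq_mul_inv, ← integral_complex_ofReal, ← Complex.Gamma_ofReal]
  push_cast
  congr 2
  refine setIntegral_congr_fun measurableSet_Ioo fun y hy => ?_
  rw [Complex.ofReal_cpow (sub_aOf_nonneg hb hy.2.le)]
  push_cast
  rfl

/-- The exponent `-(n-1)/2 - 1` is the first pole that `4q + 2n - 2` removes; for functions of `y`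
alone the limit there is a boundary term at the vertex. -/
lemma tendsto_rieszC_comp_snd (hb : b < 0) (hn : 2 ≤ n) {f : ℝ → ℝ}
    (hf : ContDiffOn ℝ ∞ f (Iio 0)) (h0 : ∀ y < Y, f y = 0) :
    Tendsto (fun x : ℝ => (4 * (x : ℂ) + 2 * n - 2) *
      rieszC b ((x : ℂ) - 1) (fun p : Space n => f p.2)) (𝓝[>] (-((n : ℝ) - 1) / 2))
      (𝓝 ((2 * Real.pi ^ (((n : ℝ) - 1) / 2) * (f b / rho b) : ℝ) : ℂ)) := by
  have hn' : (2 : ℝ) ≤ n := by exact_mod_cast hn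
  set Z := min Y b - 1 with hZ
  have hZb : Z < b := by have := min_le_right Y b; linarith
  have hZ0 : ∀ y ≤ Z, f y = 0 := fun y hy => h0 y (by have := min_le_left Y b; linarith)
  have hG : ContDiffOn ℝ ∞ (fun y => f y / rho y) (Iio 0) :=
    hf.div contDiffOn_rho fun y hy => (rho_pos hy).ne'
  have hG' := (contDiffOn_infty_iff_deriv_of_isOpen isOpen_Iio).1 hG
  have hd : ∀ y < 0, HasDerivAt (fun y => f y / rho y) (deriv (fun y => f y / rho y) y) y :=
    fun y hy => ((hG'.1 y hy).differentiableAt (isOpen_Iio.mem_nhds hy)).hasDerivAt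
  set f' := deriv fun y => f y / rho y with hf'
  have hc : ContinuousOn f' (Iio 0) := hG'.2.continuousOn
  have hIcc : Icc Z b ⊆ Iio 0 := fun y hy => hy.2.trans_lt hb
  set e : ℝ := -((n : ℝ) - 1) / 2 with he
  -- dominated convergence as the exponent decreases to zero
  have hlim : Tendsto (fun x : ℝ => ∫ y in Ioo Z b, ((f' y : ℝ) : ℂ) *
      ((tOf y - aOf b : ℝ) : ℂ) ^ (2 * (x : ℂ) + n - 1)) (𝓝[>] e)
      (𝓝 (∫ y in Ioo Z b, ((f' y : ℝ) : ℂ))) := by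
    refine tendsto_integral_filter_of_dominated_convergence
      (fun y => |f' y| * (1 + |tOf Z - aOf b|)) (.of_forall fun x => ?_) ?_ ?_ ?_
    · refine AEStronglyMeasurable.mul ?_ ?_
      · exact (Complex.continuous_ofReal.comp_continuousOn (hc.mono fun y hy =>
          hIcc (Ioo_subset_Icc_self hy))).aestronglyMeasurable measurableSet_Ioo
      · exact ((Complex.measurable_ofReal.comp
          (continuous_tOf.sub continuous_const).measurable).pow_const _).aestronglyMeasurable
    · filter_upwards [self_mem_nhdsWithin, nhdsWithin_le_nhds
        (gt_mem_nhds (show e < e + 1 / 2 by linarith))] with x (hx : e < x) hx1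
      filter_upwards [ae_restrict_mem measurableSet_Ioo] with y hy
      have hs : 0 < tOf y - aOf b := by
        have := tOf_strictAnti hy.2 hb.le
        rw [aOf_eq_tOf hb.le]; linarith
      rw [norm_mul, Complex.norm_real, Complex.norm_cpow_eq_rpow_re_of_pos hs, Real.norm_eq_abs]
      refine mul_le_mul_of_nonneg_left ?_ (abs_nonneg _)
      have hre : (2 * (x : ℂ) + n - 1 : ℂ).re = 2 * x + n - 1 := by simp
      rw [hre]
      have hsS : tOf y - aOf b ≤ 1 + |tOf Z - aOf b| := by
        have := tOf_anti hy.1.le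
        have := le_abs_self (tOf Z - aOf b)
        linarith
      calc (tOf y - aOf b) ^ (2 * x + n - 1) ≤ (1 + |tOf Z - aOf b|) ^ (2 * x + n - 1) :=
            Real.rpow_le_rpow hs.le hsS (by rw [he] at hx; linarith)
        _ ≤ (1 + |tOf Z - aOf b|) ^ (1 : ℝ) :=
            Real.rpow_le_rpow_of_exponent_le (by linarith [abs_nonneg (tOf Z - aOf b)])
              (by rw [he] at hx1; linarith)
        _ = _ := Real.rpow_one _
    · exact (((hc.mono hIcc).abs.integrableOn_Icc (μ := volume)).mono_set
        Ioo_subset_Icc_self).mul_const _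
    · filter_upwards [ae_restrict_mem measurableSet_Ioo] with y hy
      have hs : ((tOf y - aOf b : ℝ) : ℂ) ≠ 0 := by
        have := tOf_strictAnti hy.2 hb.le
        rw [Complex.ofReal_ne_zero, aOf_eq_tOf hb.le]; linarith
      have hcont : ContinuousAt (fun x : ℝ => ((f' y : ℝ) : ℂ) *
          ((tOf y - aOf b : ℝ) : ℂ) ^ (2 * (x : ℂ) + n - 1)) e :=
        continuousAt_const.mul (ContinuousAt.const_cpow (by fun_prop) (Or.inl hs))
      have := hcont.tendsto.mono_left (nhdsWithin_le_nhds (s := Ioi e))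
      have he0 : 2 * (e : ℂ) + n - 1 = 0 := by rw [he]; push_cast; ring
      rwa [he0, Complex.cpow_zero, mul_one] at this
  have hftc : ∫ y in Ioo Z b, ((f' y : ℝ) : ℂ) = ((f b / rho b : ℝ) : ℂ) := by
    rw [integral_complex_ofReal, ← integral_Ioc_eq_integral_Ioo,
      ← intervalIntegral.integral_of_le hZb.le,
      intervalIntegral.integral_eq_sub_of_hasDerivAt (f := fun y => f y / rho y)]
    · simp [hZ0 Z le_rfl]
    · intro y hy
      rw [uIcc_of_le hZb.le] at hy
      exact hd y (hIcc hy)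
    · rw [← uIcc_of_le hZb.le] at hIcc
      exact (hc.mono hIcc).intervalIntegrable
  have hgam : Tendsto (fun x : ℝ => (Complex.Gamma ((x : ℂ) + n / 2))⁻¹) (𝓝[>] e)
      (𝓝 (Complex.Gamma ((e : ℂ) + n / 2))⁻¹) := by
    have h1 : Continuous fun x : ℝ => (Complex.Gamma ((x : ℂ) + n / 2))⁻¹ :=
      Complex.differentiable_one_div_Gamma.continuous.comp (by fun_prop)
    exact (h1.tendsto e).mono_left nhdsWithin_le_nhds
  have hge : (Complex.Gamma ((e : ℂ) + n / 2))⁻¹ = ((Real.pi ^ (-(1 / 2) : ℝ) : ℝ) : ℂ) := by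
    have h1 : (e : ℂ) + n / 2 = ((1 / 2 : ℝ) : ℂ) := by rw [he]; push_cast; ring
    rw [h1, Complex.Gamma_ofReal, Real.Gamma_one_half_eq, Real.sqrt_eq_rpow,
      Real.rpow_neg Real.pi_pos.le, Complex.ofReal_inv]
  have hfin := (hgam.const_mul (((Real.pi ^ (n / 2 : ℝ) : ℝ) : ℂ))).mul (hlim.const_mul 2)
  rw [hftc, hge] at hfin
  have hval : ((Real.pi ^ (n / 2 : ℝ) : ℝ) : ℂ) * ((Real.pi ^ (-(1 / 2) : ℝ) : ℝ) : ℂ) *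
      (2 * ((f b / rho b : ℝ) : ℂ)) =
      ((2 * Real.pi ^ (((n : ℝ) - 1) / 2) * (f b / rho b) : ℝ) : ℂ) := by
    have : Real.pi ^ (((n : ℝ) - 1) / 2) = Real.pi ^ (n / 2 : ℝ) * Real.pi ^ (-(1 / 2) : ℝ) := by
      rw [← Real.rpow_add Real.pi_pos]; congr 1; ring
    rw [this]; push_cast; ring
  rw [hval] at hfin
  refine hfin.congr' ?_
  filter_upwards [self_mem_nhdsWithin] with x (hx : e < x)
  exact (rieszC_comp_snd hb hn hf hZb hZ0 hd hc (by simpa [he] using hx)).symm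

/-! ### Hadamard's lemma -/

/-- Hadamard's lemma in the variable `x`. -/
lemma hadamard_test (φ : Test n) (hφ : IsAdm b Y φ) : ∃ Φ : Fin n → Space n → ℝ,
    (∀ i, IsAdm b Y (Φ i)) ∧ ∀ p : Space n, φ p = φ (0, p.2) + ∑ i, p.1 i * Φ i p := by
  refine ⟨fun i p => ∫ τ in (0 : ℝ)..1, pd (dirX i) φ (τ • p.1, p.2), fun i => ⟨?_, ?_⟩, ?_⟩
  · refine ContDiff.contDiffOn ?_
    refine contDiff_intervalIntegral (f := fun τ (p : Space n) => pd (dirX i) φ (τ • p.1, p.2)) ?_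
    have h1 : ContDiff ℝ ∞ (pd (dirX i) φ) := by
      rw [pd_test]; exact (∂_{dirX i} φ : Test n).contDiff
    exact h1.comp (by fun_prop : ContDiff ℝ ∞ fun z : ℝ × Space n => ((z.1 • z.2.1, z.2.2) : Space n))
  · intro p hp hpY
    refine intervalIntegral.integral_zero_ae (ae_of_all _ fun τ hτ => ?_)
    rw [uIoc_of_le zero_le_one] at hτ
    refine (hφ.pd (dirX i)).zero _ ⟨hp.1, ?_⟩ hpY
    refine lt_of_le_of_lt ?_ hp.2
    simp only [norm_smul, Real.norm_of_nonneg hτ.1.le]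
    have := norm_nonneg p.1
    have h2 : τ * ‖p.1‖ ≤ ‖p.1‖ := by nlinarith [hτ.2]
    have h3 : 0 ≤ τ * ‖p.1‖ := mul_nonneg hτ.1.le this
    gcongr
  · intro p
    have hdiff : Differentiable ℝ φ := φ.contDiff.differentiable (by simp)
    have hd : ∀ τ : ℝ, HasDerivAt (fun τ : ℝ => φ (τ • p.1, p.2))
        (∑ i, p.1 i * pd (dirX i) φ (τ • p.1, p.2)) τ := fun τ => by
      have h1 : HasDerivAt (fun τ : ℝ => ((τ • p.1, p.2) : Space n)) ((1 : ℝ) • p.1, 0) τ :=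
        ((hasDerivAt_id τ).smul_const p.1).prodMk (hasDerivAt_const τ p.2)
      have h2 := (hdiff (τ • p.1, p.2)).hasFDerivAt.comp_hasDerivAt τ h1
      convert! h2 using 1
      have h3 : (((1 : ℝ) • p.1, 0) : Space n) = ∑ i, p.1 i • dirX i := by
        have : p.1 = ∑ i, p.1 i • EuclideanSpace.single i (1 : ℝ) := by
          ext j; simp [Pi.single_apply]
        refine Prod.ext ?_ ?_
        · rw [one_smul, Prod.fst_sum]
          simpa [dirX] using this
        · rw [Prod.snd_sum]; simp [dirX]
      rw [h3, map_sum]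
      simp [pd]
    have hcont : ∀ i, Continuous fun τ : ℝ => pd (dirX i) φ (τ • p.1, p.2) := fun i => by
      rw [pd_test]
      exact (∂_{dirX i} φ : Test n).continuous.comp (by fun_prop)
    have := intervalIntegral.integral_eq_sub_of_hasDerivAt (a := 0) (b := 1) (fun τ _ => hd τ)
      (Continuous.intervalIntegrable (continuous_finsetSum _ fun i _ =>
        continuous_const.mul (hcont i)) _ _)
    have hint : ∀ i ∈ Finset.univ, IntervalIntegrable
        (fun τ : ℝ => p.1 i * pd (dirX i) φ (τ • p.1, p.2)) volume 0 1 := fun i _ =>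
      (continuous_const.mul (hcont i)).intervalIntegrable _ _
    rw [intervalIntegral.integral_finsetSum hint] at this
    simp only [intervalIntegral.integral_const_mul, one_smul, zero_smul] at this
    linarith

/-- The limit of `(4x + 2n - 2) χ_{x-1}(k) f(y)` as `x` decreases to `-(n-1)/2` is a multiple of the
Dirac measure at the vertex `(0, b)`. By `hadamard_test` a test function is a function of `y` plus
terms with a factor `x_i`, and `x_i χ_{q-1}(k)` is a derivative of `χ_q(k)`, so that these terms
have no pole. -/
lemma tendsto_rieszC_vertex (hb : b < 0) (hn : 2 ≤ n) (φ : Test n) {f : ℝ → ℝ}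
    (hf : ContDiffOn ℝ ∞ f (Iio 0)) :
    Tendsto (fun x : ℝ => (4 * (x : ℂ) + 2 * n - 2) *
      rieszC b ((x : ℂ) - 1) (fun p : Space n => f p.2 * φ p)) (𝓝[>] (-((n : ℝ) - 1) / 2))
      (𝓝 ((2 * Real.pi ^ (((n : ℝ) - 1) / 2) * (f b * φ (0, b) / rho b) : ℝ) : ℂ)) := by
  obtain ⟨Y, hY⟩ := exists_isAdm_of_subset φ.hasCompactSupport
  have hφ : IsAdm b Y φ := hY b φ subset_rfl
  obtain ⟨Φ, hΦ, hdec⟩ := hadamard_test φ hφ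
  set e : ℝ := -((n : ℝ) - 1) / 2 with he
  have hfs : SmoothNear b (fun p : Space n => f p.2) := .comp_snd hf
  have hφ0 : ContDiffOn ℝ ∞ (fun y => f y * φ (0, y)) (Iio 0) :=
    hf.mul (φ.contDiff.comp (by fun_prop : ContDiff ℝ ∞ fun y : ℝ => ((0, y) : Space n))).contDiffOn
  set F : ℝ → ℝ := fun y => if y < 0 then f y * φ (0, y) else 0 with hF
  have h00 : ∀ y < Y, F y = 0 := fun y hy => by
    by_cases hy0 : y < 0
    · simp only [hF, hy0, if_true]
      rw [hφ.zero (0, y) ⟨hy0, ?_⟩ hy, mul_zero]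
      have := pow_pos (aOf_pos hb) 2
      simp only [norm_zero]
      nlinarith [sq_nonneg (tOf y)]
    · simp [hF, hy0]
  have hFs : ContDiffOn ℝ ∞ F (Iio 0) := hφ0.congr fun y hy => by
    have : y < 0 := hy
    simp [hF, this]
  have h1 := tendsto_rieszC_comp_snd (n := n) hb hn hFs h00
  have hFb : F b = f b * φ (0, b) := by simp [hF, hb]
  rw [hFb] at h1
  have hi : ∀ i, IsAdm b Y (fun p => f p.2 * Φ i p) := fun i => (hΦ i).mul_left hfs
  have hxi : ∀ i, IsAdm b Y (fun p => p.1 i * (f p.2 * Φ i p)) := fun i =>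
    (hi i).mul_left (smoothNear_coord i)
  have h2 : ∀ i, Tendsto (fun x : ℝ => (4 * (x : ℂ) + 2 * n - 2) *
      rieszC b ((x : ℂ) - 1) (fun p : Space n => p.1 i * (f p.2 * Φ i p))) (𝓝[>] e) (𝓝 0) := by
    intro i
    have hcont : ContinuousAt (fun x : ℝ => (4 * (x : ℂ) + 2 * n - 2) *
        (rieszC b x (pd (dirX i) fun p => f p.2 * Φ i p) / 2)) e := by
      refine ContinuousAt.mul (by fun_prop) (ContinuousAt.div_const ?_ _)
      have hd := differentiableOn_rieszC hb hn ((hi i).pd (dirX i))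
      have ho : IsOpen {q : ℂ | -((n : ℝ) + 1) / 2 < q.re} :=
        isOpen_lt continuous_const Complex.continuous_re
      have := (hd.continuousOn.continuousAt (x := (e : ℂ)) (ho.mem_nhds (by
        simp only [mem_ofPred_eq, Complex.ofReal_re, he]; linarith)))
      exact ContinuousAt.comp (f := fun x : ℝ => (x : ℂ)) this
        Complex.continuous_ofReal.continuousAt
    have h3 := hcont.tendsto.mono_left (nhdsWithin_le_nhds (s := Ioi e))
    have h4 : (4 * (e : ℂ) + 2 * n - 2) = 0 := by rw [he]; push_cast; ring
    rw [h4, zero_mul] at h3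
    refine h3.congr' ?_
    filter_upwards [self_mem_nhdsWithin] with x (hx : e < x)
    rw [rieszC_pd_dirX hb hn (hi i) i (by simpa [he] using hx)]
    ring
  have h3 := h1.add (tendsto_finsetSum Finset.univ fun i _ => h2 i)
  rw [Finset.sum_const_zero, add_zero] at h3
  refine h3.congr' ?_
  filter_upwards [self_mem_nhdsWithin] with x (hx : e < x)
  have hq : -((n : ℝ) + 1) / 2 < ((x : ℂ) - 1).re := by
    simp only [Complex.sub_re, Complex.ofReal_re, Complex.one_re]
    rw [he] at hx; linarith
  rw [← Finset.mul_sum, ← mul_add, ← rieszC_sum hb hn _ (fun i _ => hxi i) hq,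
    ← rieszC_add hb hn (isAdm_comp_snd hFs h00) (.sum fun i _ => hxi i) hq]
  congr 1
  refine rieszC_congr hb hn ((isAdm_comp_snd hFs h00).add (.sum fun i _ => hxi i))
    (hφ.mul_left hfs) (fun p hp => ?_) hq
  have : p.2 < 0 := hp.2.trans hb
  rw [hdec p]
  simp only [hF, this, if_true, mul_add, Finset.mul_sum]
  congr 1
  exact Finset.sum_congr rfl fun i _ => by ring

end

section

/-! ### The hypergeometric equation -/

section Hypergeometric

variable {F : ℝ → ℝ} {q : ℕ → ℝ}

lemma hasFPowerSeriesOnBall_of_hasSum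
    (h : ∀ x : ℝ, |x| < 1 → HasSum (fun i => q i * x ^ i) (F x)) :
    HasFPowerSeriesOnBall F (FormalMultilinearSeries.ofScalars ℝ q) 0 1 := by
  refine ⟨ENNReal.le_of_forall_nnreal_lt fun r hr => ?_, one_pos, fun {y} hy => ?_⟩
  · refine FormalMultilinearSeries.le_radius_of_tendsto _ (l := 0) ?_
    have hr' : |(r : ℝ)| < 1 := by
      rw [abs_of_nonneg r.coe_nonneg]; exact_mod_cast hr
    have := (h r hr').summable.tendsto_atTop_zero.norm
    simpa [FormalMultilinearSeries.ofScalars_norm] using this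
  · have hy' : |y| < 1 := by
      simpa [Metric.eball_ofReal, ← ENNReal.ofReal_one] using hy
    simpa [FormalMultilinearSeries.ofScalars_apply_eq, mul_comm] using h y hy'

/-- The Euler operator `x d/dx` multiplies the coefficients of a power series by the exponents. -/
lemma hasSum_mul_deriv (h : ∀ x : ℝ, |x| < 1 → HasSum (fun i => q i * x ^ i) (F x))
    {x : ℝ} (hx : |x| < 1) : HasSum (fun i => (i * q i) * x ^ i) (x * deriv F x) := by
  have hF := hasFPowerSeriesOnBall_of_hasSum h
  have hx' : x ∈ Metric.eball (0 : ℝ) 1 := by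
    simpa [Metric.eball_ofReal, ← ENNReal.ofReal_one] using hx
  have h1 := (ContinuousLinearMap.apply ℝ ℝ x).hasSum (hF.fderiv.hasSum hx')
  rw [← hasSum_nat_add_iff' 1]
  convert! h1 using 1
  · ext i
    rw [ContinuousLinearMap.apply_apply, FormalMultilinearSeries.derivSeries_apply_diag,
      FormalMultilinearSeries.ofScalars_apply_eq]
    simp [mul_assoc]
  · simp [fderiv_eq_smul_deriv]

lemma analyticAt_of_hasSum (h : ∀ x : ℝ, |x| < 1 → HasSum (fun i => q i * x ^ i) (F x))
    {x : ℝ} (hx : |x| < 1) : AnalyticAt ℝ F x :=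
  (hasFPowerSeriesOnBall_of_hasSum h).analyticAt_of_mem (by
    simpa [Metric.eball_ofReal, ← ENNReal.ofReal_one] using hx)

variable {α β γ : ℝ}

lemma hasSum_ordinaryHypergeometric (hα : 0 < α) (hβ : 0 < β) (hγ : 0 < γ) {x : ℝ}
    (hx : |x| < 1) : HasSum (fun i => ordinaryHypergeometricCoefficient α β γ i * x ^ i)
      (ordinaryHypergeometric α β γ x) := by
  have hr := ordinaryHypergeometricSeries_radius_eq_one ℝ α β γ fun i =>
    ⟨by have : (0 : ℝ) ≤ i := i.cast_nonneg; linarith,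
     by have : (0 : ℝ) ≤ i := i.cast_nonneg; linarith,
     by have : (0 : ℝ) ≤ i := i.cast_nonneg; linarith⟩
  have := (ordinaryHypergeometricSeries ℝ α β γ).hasSum (x := x) (by
    rw [hr]; simpa [Metric.eball_ofReal, ← ENNReal.ofReal_one] using hx)
  simp only [ordinaryHypergeometricSeries_apply_eq, smul_eq_mul] at this
  exact this

lemma analyticAt_ordinaryHypergeometric (hα : 0 < α) (hβ : 0 < β) (hγ : 0 < γ) {x : ℝ}
    (hx : |x| < 1) : AnalyticAt ℝ (ordinaryHypergeometric α β γ) x :=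
  analyticAt_of_hasSum (fun _ h => hasSum_ordinaryHypergeometric hα hβ hγ h) hx

lemma ordinaryHypergeometric_pos (hα : 0 < α) (hβ : 0 < β) (hγ : 0 < γ) {x : ℝ}
    (hx0 : 0 ≤ x) (hx : x < 1) : 0 < ordinaryHypergeometric α β γ x := by
  have h := hasSum_ordinaryHypergeometric hα hβ hγ (abs_lt.2 ⟨by linarith, hx⟩)
  have hc : ∀ i, 0 < ordinaryHypergeometricCoefficient α β γ i := fun i => by
    have := ascPochhammer_pos i α hα
    have := ascPochhammer_pos i β hβ
    have := ascPochhammer_pos i γ hγ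
    unfold ordinaryHypergeometricCoefficient
    positivity
  have := le_hasSum h 0 fun i _ => mul_nonneg (hc i).le (pow_nonneg hx0 i)
  rw [pow_zero, mul_one] at this
  exact (hc 0).trans_le this

/-- The hypergeometric equation. Only the interval `(0, 1)` is needed: it contains the values of
`u / v` on the conoid. -/
lemma ordinaryHypergeometric_ode (hα : 0 < α) (hβ : 0 < β) (hγ : 0 < γ) {x : ℝ}
    (hx0 : 0 < x) (hx : x < 1) :
    x * (1 - x) * deriv (deriv (ordinaryHypergeometric α β γ)) x +
      (γ - (α + β + 1) * x) * deriv (ordinaryHypergeometric α β γ) x -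
      α * β * ordinaryHypergeometric α β γ x = 0 := by
  set F : ℝ → ℝ := ordinaryHypergeometric α β γ with hF
  set q := ordinaryHypergeometricCoefficient α β γ with hq
  have hx' : |x| < 1 := abs_lt.2 ⟨by linarith, hx⟩
  have h0 : ∀ x : ℝ, |x| < 1 → HasSum (fun i => q i * x ^ i) (F x) := fun _ h =>
    hasSum_ordinaryHypergeometric hα hβ hγ h
  have h1 : ∀ x : ℝ, |x| < 1 → HasSum (fun i => (i * q i) * x ^ i) (x * deriv F x) :=
    fun _ h => hasSum_mul_deriv h0 h
  have h2 := hasSum_mul_deriv h1 hx'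
  have hd : DifferentiableAt ℝ (deriv F) x := (analyticAt_of_hasSum h0 hx').deriv.differentiableAt
  have e1 : deriv (fun x => x * deriv F x) x = deriv F x + x * deriv (deriv F) x := by
    rw [deriv_fun_mul differentiableAt_fun_id hd]; simp
  rw [e1] at h2
  -- both sides of `(θ + γ - 1)θF = x(θ + α)(θ + β)F`, where `θ = x d/dx`, have the same series
  have hl := h2.add ((h1 x hx').mul_left (γ - 1))
  have hr := ((h2.add ((h1 x hx').mul_left (α + β))).add ((h0 x hx').mul_left (α * β))).mul_left x
  rw [← hasSum_nat_add_iff' 1] at hl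
  have hrec : ∀ i : ℕ, (i + 1) * (i + γ) * q (i + 1) = (i + α) * (i + β) * q i := fun i => by
    have h3 := (ascPochhammer_pos i γ hγ).ne'
    have h4 : (0 : ℝ) < i + γ := by positivity
    have h5 : (γ + i) ≠ 0 := by positivity
    simp only [hq, ordinaryHypergeometricCoefficient, ascPochhammer_succ_eval, Nat.factorial_succ]
    push_cast
    field_simp
    ring
  have := hl.unique (by
    convert! hr using 1
    ext i
    have := hrec i
    push_cast
    rw [pow_succ]
    linear_combination (x * x ^ i) * this)
  simp at this
  have h3 : x * (x * (1 - x) * deriv (deriv F) x + (γ - (α + β + 1) * x) * deriv F x -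
      α * β * F x) = 0 := by linear_combination this
  exact (mul_eq_zero.1 h3).resolve_left hx0.ne'

/-- The function `z ↦ (1 + z)^{-β} F(α, β; γ; z/(1 + z))`; by the Pfaff transformation it is
`F(γ - α, β; γ; -z)`. -/
noncomputable def pfaff (α β γ z : ℝ) : ℝ :=
  (1 + z) ^ (-β) * ordinaryHypergeometric α β γ (z / (1 + z))

lemma pfaff_zero : pfaff α β γ 0 = 1 := by simp [pfaff]

lemma abs_div_one_add_lt {z : ℝ} (hz : -1 / 2 < z) : |z / (1 + z)| < 1 := by
  have : 0 < 1 + z := by linarith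
  rw [abs_lt, lt_div_iff₀ this, div_lt_iff₀ this]
  constructor <;> linarith

lemma analyticAt_pfaff (hα : 0 < α) (hβ : 0 < β) (hγ : 0 < γ) {z : ℝ} (hz : -1 / 2 < z) :
    AnalyticAt ℝ (pfaff α β γ) z := by
  have h1 : 0 < 1 + z := by linarith
  have h2 : AnalyticAt ℝ (fun z : ℝ => 1 + z) z := by fun_prop
  have h3 : AnalyticAt ℝ (fun z : ℝ => z / (1 + z)) z := analyticAt_id.div h2 h1.ne'
  have h4 : AnalyticAt ℝ (fun z : ℝ => ordinaryHypergeometric α β γ (z / (1 + z))) z :=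
    AnalyticAt.fun_comp (analyticAt_ordinaryHypergeometric hα hβ hγ (abs_div_one_add_lt hz)) h3
  have h5 : AnalyticAt ℝ (fun z : ℝ => (1 + z) ^ (-β)) z := by
    refine ((h2.log h1).mul (analyticAt_const (v := -β))).rexp'.congr ?_
    filter_upwards [lt_mem_nhds hz] with z hz
    exact (Real.rpow_def_of_pos (by linarith) _).symm
  exact h5.mul h4

lemma contDiffOn_pfaff (hα : 0 < α) (hβ : 0 < β) (hγ : 0 < γ) :
    ContDiffOn ℝ ∞ (pfaff α β γ) (Ioi (-1 / 2)) := fun _ hz =>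
  (analyticAt_pfaff hα hβ hγ hz).contDiffAt.contDiffWithinAt

lemma contDiffOn_dslope_pfaff (hα : 0 < α) (hβ : 0 < β) (hγ : 0 < γ) :
    ContDiffOn ℝ ∞ (dslope (pfaff α β γ) 0) (Ioi (-1 / 2)) := fun z hz => by
  refine ContDiffAt.contDiffWithinAt (AnalyticAt.contDiffAt ?_)
  by_cases h0 : z = 0
  · obtain ⟨p, hp⟩ := analyticAt_pfaff hα hβ hγ (show -1 / 2 < (0 : ℝ) by norm_num)
    rw [h0]
    exact hp.has_fpower_series_dslope_fslope.analyticAt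
  · have h1 : AnalyticAt ℝ (fun z => (z - 0)⁻¹ • (pfaff α β γ z - pfaff α β γ 0)) z :=
      ((analyticAt_id.sub analyticAt_const).inv (by simpa using h0)).smul
        ((analyticAt_pfaff hα hβ hγ hz).sub analyticAt_const)
    exact h1.congr (dslope_eventuallyEq_slope_of_ne _ h0).symm

/-- The hypergeometric equation for the parameters `γ - α, β; γ`, in the variable `-z`. -/
lemma pfaff_ode (hα : 0 < α) (hβ : 0 < β) (hγ : 0 < γ) {z : ℝ} (hz : 0 < z) :
    z * (1 + z) * deriv (deriv (pfaff α β γ)) z +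
      (γ + (γ - α + β + 1) * z) * deriv (pfaff α β γ) z +
      (γ - α) * β * pfaff α β γ z = 0 := by
  set F : ℝ → ℝ := ordinaryHypergeometric α β γ with hF
  have hX : ∀ z : ℝ, -1 / 2 < z → HasDerivAt (fun z : ℝ => z / (1 + z)) (1 / (1 + z) ^ 2) z := by
    intro z hz
    have h1 : 1 + z ≠ 0 := by linarith
    convert! (hasDerivAt_id z).div ((hasDerivAt_id z).const_add 1) h1 using 1
    simp
  have hP : ∀ e z : ℝ, -1 / 2 < z → HasDerivAt (fun z : ℝ => (1 + z) ^ e) (e * (1 + z) ^ (e - 1)) z := by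
    intro e z hz
    have h1 : 1 + z ≠ 0 := by linarith
    convert! ((hasDerivAt_id z).const_add 1).rpow_const (p := e) (Or.inl h1) using 1
    simp
  have hA : ∀ z : ℝ, -1 / 2 < z → AnalyticAt ℝ F (z / (1 + z)) := fun z hz =>
    analyticAt_ordinaryHypergeometric hα hβ hγ (abs_div_one_add_lt hz)
  have hd : ∀ z : ℝ, -1 / 2 < z → HasDerivAt (pfaff α β γ)
      (-β * (1 + z) ^ (-β - 1) * F (z / (1 + z)) +
        (1 + z) ^ (-β) * (deriv F (z / (1 + z)) * (1 / (1 + z) ^ 2))) z := fun z hz =>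
    (hP (-β) z hz).fun_mul ((hA z hz).differentiableAt.hasDerivAt.comp z (hX z hz))
  have hz' : -1 / 2 < z := by linarith
  have h1 : 0 < 1 + z := by linarith
  have hd' : ∀ᶠ z' in 𝓝 z, deriv (pfaff α β γ) z' = -β * (1 + z') ^ (-β - 1) * F (z' / (1 + z')) +
      (1 + z') ^ (-β - 2) * deriv F (z' / (1 + z')) := by
    filter_upwards [lt_mem_nhds hz'] with z' hz'
    have h1 : 0 < 1 + z' := by linarith
    rw [(hd z' hz').deriv, Real.rpow_sub h1 (-β) 2]
    norm_num
    field_simp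
  have hdd : HasDerivAt (deriv (pfaff α β γ)) _ z :=
    ((((hP (-β - 1) z hz').const_mul (-β)).fun_mul
      ((hA z hz').differentiableAt.hasDerivAt.comp z (hX z hz'))).fun_add
    ((hP (-β - 2) z hz').fun_mul
      (HasDerivAt.comp (h₂ := deriv F) z (hA z hz').deriv.differentiableAt.hasDerivAt
        (hX z hz')))).congr_of_eventuallyEq hd'
  rw [hdd.deriv, (hd z hz').deriv]
  have hode := ordinaryHypergeometric_ode hα hβ hγ (x := z / (1 + z)) (by positivity)
    ((div_lt_one h1).2 (by linarith))
  rw [← hF] at hode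
  simp only [pfaff, ← hF]
  set X := z / (1 + z) with hXd
  have hz1 : z = X * (1 + z) := by rw [hXd]; field_simp
  have e1 : (1 + z) ^ (-β - 1) = (1 + z) ^ (-β) / (1 + z) := by
    rw [Real.rpow_sub h1, Real.rpow_one]
  have e2 : (1 + z) ^ (-β - 2) = (1 + z) ^ (-β) / (1 + z) ^ 2 := by
    rw [Real.rpow_sub h1]; norm_num
  have e3 : (1 + z) ^ (-β - 1 - 1) = (1 + z) ^ (-β) / (1 + z) ^ 2 := by
    rw [← e2]; congr 1; ring
  have e4 : (1 + z) ^ (-β - 2 - 1) = (1 + z) ^ (-β) / (1 + z) ^ 3 := by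
    rw [Real.rpow_sub h1, Real.rpow_one, e2]; field_simp
  rw [e1, e2, e3, e4]
  set P := (1 + z) ^ (-β)
  have hode' : z * deriv (deriv F) X + (γ * (1 + z) - (α + β + 1) * z) * (1 + z) * deriv F X
      - α * β * (1 + z) ^ 2 * F X = 0 := by
    have e5 : X * (1 - X) * (1 + z) ^ 2 = z := by rw [hXd]; field_simp; ring
    linear_combination (1 + z) ^ 2 * hode + (-deriv (deriv F) X) * e5 +
      (α + β + 1) * (1 + z) * deriv F X * (- hz1)
  simp only [Function.comp]
  field_simp
  linear_combination P * hode'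

end Hypergeometric

end

section

variable {n : ℕ} {b β : ℝ} {f : ℝ → ℝ} {p w : Space n}

/-! ### Functions of `k / (4 a t)` with weights -/

/-- The power `(4 a t)^{-β}`; recall that `4 a t = (u - v) / 9`. -/
noncomputable def wt (b β y : ℝ) : ℝ := (4 * aOf b * tOf y) ^ (-β)

/-- The quotient `k / (4 a t) = u / (v - u)`. -/
noncomputable def ratio (b : ℝ) (p : Space n) : ℝ := k b p / (4 * aOf b * tOf p.2)

/-- The function `(4 a t)^{-β} f(k / (4 a t))`. -/
noncomputable def tail (b β : ℝ) (f : ℝ → ℝ) (p : Space n) : ℝ := wt b β p.2 * f (ratio b p)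

lemma four_mul_pos (hb : b < 0) {y : ℝ} (hy : y < 0) : 0 < 4 * aOf b * tOf y := by
  have := aOf_pos hb
  have := tOf_pos hy
  positivity

lemma wt_pos (hb : b < 0) (β : ℝ) {y : ℝ} (hy : y < 0) : 0 < wt b β y :=
  Real.rpow_pos_of_pos (four_mul_pos hb hy) _

lemma wt_add_one (hb : b < 0) {y : ℝ} (hy : y < 0) :
    wt b (β + 1) y = wt b β y / (4 * aOf b * tOf y) := by
  rw [wt, wt, neg_add, Real.rpow_add (four_mul_pos hb hy), Real.rpow_neg_one, div_eq_mul_inv]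

lemma contDiffOn_wt (hb : b < 0) (β : ℝ) : ContDiffOn ℝ ∞ (wt b β) (Iio 0) :=
  (contDiffOn_const.mul contDiffOn_tOf).rpow_const_of_ne fun _ hy => (four_mul_pos hb hy).ne'

lemma hasDerivAt_wt (hb : b < 0) (β : ℝ) {y : ℝ} (hy : y < 0) :
    HasDerivAt (wt b β) (3 / (2 * rho y ^ 2) * β * wt b β y) y := by
  have h := ((hasDerivAt_tOf hy).const_mul (4 * aOf b)).rpow_const (p := -β)
    (Or.inl (four_mul_pos hb hy).ne')
  convert! h using 1
  have h1 := (rho_pos hy).ne'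
  have h2 := (aOf_pos hb).ne'
  rw [Real.rpow_sub (four_mul_pos hb hy), Real.rpow_one, wt]
  set W := (4 * aOf b * tOf y) ^ (-β)
  rw [tOf]
  field_simp

lemma smoothNear_wt (hb : b < 0) (β : ℝ) : SmoothNear b (fun p : Space n => wt b β p.2) :=
  .comp_snd (contDiffOn_wt hb β)

lemma smoothNear_ratio (hb : b < 0) : SmoothNear b (ratio (n := n) b) :=
  smoothNear_k.div ((SmoothNear.const _).mul smoothNear_tOf) fun _ hp => (four_mul_pos hb hp.1).ne'

lemma ratio_mul (hb : b < 0) (hp : p ∈ nbhd n b) : ratio b p * (4 * aOf b * tOf p.2) = k b p :=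
  div_mul_cancel₀ _ (four_mul_pos hb hp.1).ne'

lemma lt_ratio (hb : b < 0) (hp : p ∈ nbhd n b) : -1 / 2 < ratio b p := by
  rw [ratio, lt_div_iff₀ (four_mul_pos hb hp.1), k_eq hp.1.le]
  have := hp.2
  nlinarith

lemma ratio_pos (hb : b < 0) (hp : p ∈ conoid n b) : 0 < ratio b p :=
  div_pos (mem_conoid_iff.1 hp).1 (four_mul_pos hb (hp.2.trans hb))

lemma smoothNear_comp_ratio (hb : b < 0) (hf : ContDiffOn ℝ ∞ f (Ioi (-1 / 2))) :
    SmoothNear b (fun p : Space n => f (ratio b p)) :=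
  ContDiffOn.comp hf (smoothNear_ratio hb) fun _ hp => lt_ratio hb hp

lemma smoothNear_tail (hb : b < 0) (β : ℝ) (hf : ContDiffOn ℝ ∞ f (Ioi (-1 / 2))) :
    SmoothNear b (tail (n := n) b β f) := (smoothNear_wt hb β).mul (smoothNear_comp_ratio hb hf)

lemma pd_ratio (hb : b < 0) (hp : p ∈ nbhd n b) :
    pd w (ratio b) p = pd w (k b) p / (4 * aOf b * tOf p.2) +
      3 / (2 * rho p.2 ^ 2) * w.2 * ratio b p := by
  have hw : ∀ q ∈ nbhd n b, ratio b q = k b q * wt b 1 q.2 := fun q hq => by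
    rw [ratio, wt, Real.rpow_neg_one, div_eq_mul_inv]
  rw [pd_congr hw hp, pd_mul smoothNear_k (smoothNear_wt hb 1) hp,
    pd_comp_snd (hasDerivAt_wt hb 1 hp.1), hw p hp]
  simp only [wt, Real.rpow_neg_one]
  ring

lemma pd_tail (hb : b < 0) (hf : ContDiffOn ℝ ∞ f (Ioi (-1 / 2))) (hp : p ∈ nbhd n b) :
    pd w (tail b β f) p = 3 / (2 * rho p.2 ^ 2) * w.2 * tail b β (fun z => β * f z + z * deriv f z) p
      + pd w (k b) p * tail b (β + 1) (deriv f) p := by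
  have hd : HasDerivAt f (deriv f (ratio b p)) (ratio b p) :=
    ((hf.contDiffAt (isOpen_Ioi.mem_nhds (lt_ratio hb hp))).differentiableAt (by simp)).hasDerivAt
  unfold tail
  rw [pd_mul (smoothNear_wt hb β) (smoothNear_comp_ratio hb hf) hp,
    pd_comp hd (smoothNear_ratio hb) hp, pd_comp_snd (hasDerivAt_wt hb β hp.1), pd_ratio hb hp,
    wt_add_one hb hp.1]
  ring

lemma pd_dirX_tail (hb : b < 0) (hf : ContDiffOn ℝ ∞ f (Ioi (-1 / 2))) (hp : p ∈ nbhd n b)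
    (i : Fin n) : pd (dirX i) (tail b β f) p = -2 * (p.1 i * tail b (β + 1) (deriv f) p) := by
  rw [pd_tail hb hf hp, pd_dirX_k hp]
  simp [dirX, mul_assoc]

lemma pd_dirY_tail (hb : b < 0) (hf : ContDiffOn ℝ ∞ f (Ioi (-1 / 2))) (hp : p ∈ nbhd n b) :
    pd (dirY n) (tail b β f) p =
      3 / (2 * rho p.2 ^ 2) * tail b β (fun z => β * f z + z * deriv f z) p +
      -2 * (tOf p.2 - aOf b) * rho p.2 * tail b (β + 1) (deriv f) p := by
  rw [pd_tail hb hf hp, pd_dirY_k hp]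
  simp [dirY]

/-- The bicharacteristic part of the transport operator acts on functions of `k / (4 a t)` by the
Euler operator `z d/dz`. -/
lemma transport_tail (hb : b < 0) (hf : ContDiffOn ℝ ∞ f (Ioi (-1 / 2))) (hp : p ∈ nbhd n b) :
    transport b (tail b β f) p =
      (2 * (n + 1) * rho p.2 ^ 2 + (1 - 6 * β) * ((tOf p.2 - aOf b) / rho p.2)) * tail b β f p +
      (8 * rho p.2 ^ 2 - 6 * ((tOf p.2 - aOf b) / rho p.2)) *
        tail b β (fun z => z * deriv f z) p := by
  have h0 := (rho_pos hp.1).ne'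
  have hX : ∑ i, p.1 i * pd (dirX i) (tail b β f) p =
      -2 * (‖p.1‖ ^ 2 * tail b (β + 1) (deriv f) p) := by
    rw [← sum_sq_eq, Finset.sum_mul, Finset.mul_sum]
    exact Finset.sum_congr rfl fun i _ => by rw [pd_dirX_tail hb hf hp]; ring
  have hy : p.2 = -rho p.2 ^ 2 := by rw [rho_sq hp.1.le]; ring
  have hk := k_eq (b := b) hp.1.le
  have hr := ratio_mul hb hp
  rw [transport, hX, pd_dirY_tail hb hf hp]
  simp only [tail, wt_add_one hb hp.1]
  have h4 := (four_mul_pos hb hp.1).ne'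
  have hn : ‖p.1‖ ^ 2 = (tOf p.2 - aOf b) ^ 2 - ratio b p * (4 * aOf b * tOf p.2) := by
    rw [hr, hk]; ring
  rw [hn]
  generalize ratio b p = z at *
  generalize deriv f z = f1
  set s := tOf p.2 - aOf b
  set T := 4 * aOf b * tOf p.2
  rw [show 4 * p.2 = -4 * rho p.2 ^ 2 by linarith]
  field_simp
  ring

lemma hasDerivAt_three_div_rho_sq {y : ℝ} (hy : y < 0) :
    HasDerivAt (fun y => 3 / (2 * rho y ^ 2)) (3 / (2 * rho y ^ 4)) y := by
  have h0 := (rho_pos hy).ne'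
  convert! (((hasDerivAt_rho hy).pow 2).const_mul 2).inv
    (mul_ne_zero two_ne_zero (pow_ne_zero 2 h0)) |>.const_mul (3 : ℝ) using 1
  simp
  field_simp

lemma contDiffOn_deriv_Ioi {c : ℝ} (hf : ContDiffOn ℝ ∞ f (Ioi c)) :
    ContDiffOn ℝ ∞ (deriv f) (Ioi c) :=
  ((contDiffOn_infty_iff_deriv_of_isOpen isOpen_Ioi).1 hf).2

lemma pd_dirX_dirX_tail (hb : b < 0) (hf : ContDiffOn ℝ ∞ f (Ioi (-1 / 2))) (hp : p ∈ nbhd n b)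
    (i : Fin n) : pd (dirX i) (pd (dirX i) (tail b β f)) p =
      -2 * tail b (β + 1) (deriv f) p +
        4 * p.1 i ^ 2 * tail b (β + 1 + 1) (deriv (deriv f)) p := by
  have hf1 := contDiffOn_deriv_Ioi hf
  have h1 := smoothNear_tail (n := n) hb (β + 1) hf1
  rw [pd_congr (fun p hp => pd_dirX_tail hb hf hp i) hp,
    pd_mul (.const (-2)) ((smoothNear_coord i).mul h1) hp,
    pd_mul (smoothNear_coord i) h1 hp, pd_dirX_tail hb hf1 hp, pd_coord]
  simp [pd, dirX]
  ring

lemma pd_dirY_dirY_tail (hb : b < 0) (hf : ContDiffOn ℝ ∞ f (Ioi (-1 / 2))) (hp : p ∈ nbhd n b) :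
    pd (dirY n) (pd (dirY n) (tail b β f)) p =
      3 / (2 * rho p.2 ^ 4) * tail b β (fun z => β * f z + z * deriv f z) p +
      3 / (2 * rho p.2 ^ 2) *
        pd (dirY n) (tail b β (fun z => β * f z + z * deriv f z)) p +
      ((2 * rho p.2 ^ 2 + (tOf p.2 - aOf b) / rho p.2) * tail b (β + 1) (deriv f) p +
      -2 * (tOf p.2 - aOf b) * rho p.2 * pd (dirY n) (tail b (β + 1) (deriv f)) p) := by
  have hf1 := contDiffOn_deriv_Ioi hf
  have hg : ContDiffOn ℝ ∞ (fun z => β * f z + z * deriv f z) (Ioi (-1 / 2)) := by fun_prop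
  have h1 := smoothNear_tail (n := n) hb (β + 1) hf1
  have h2 := smoothNear_tail (n := n) hb β hg
  have h0 := (rho_pos hp.1).ne'
  have hr : SmoothNear b fun p : Space n => 3 / (2 * rho p.2 ^ 2) :=
    (SmoothNear.const 3).div ((SmoothNear.const 2).mul (smoothNear_rho.pow 2)) fun p hp => by
      have := rho_pos hp.1
      positivity
  have hs : SmoothNear b fun p : Space n => -2 * (tOf p.2 - aOf b) * rho p.2 :=
    ((SmoothNear.const (-2)).mul (smoothNear_tOf.sub (.const _))).mul smoothNear_rho
  have hr' := hasDerivAt_three_div_rho_sq hp.1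
  rw [pd_congr (fun p hp => pd_dirY_tail hb hf hp) hp, pd_add (hr.mul h2) (hs.mul h1) hp,
    pd_mul hr h2 hp, pd_mul hs h1 hp, pd_comp_snd hr',
    pd_comp_snd ((((hasDerivAt_tOf hp.1).sub_const (aOf b)).const_mul (-2)).fun_mul
      (hasDerivAt_rho hp.1))]
  simp only [dirY]
  field_simp
  ring

/-- `𝒯` of `(4 a t)^{-m-1/6} f(k / (4 a t))` is a multiple of the hypergeometric equation for `f`. -/
lemma tri_tail {m : ℕ} {p : Space (2 * m + 1)} (hb : b < 0) (hf : ContDiffOn ℝ ∞ f (Ioi (-1 / 2)))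
    (hp : p ∈ nbhd (2 * m + 1) b)
    (hode : ratio b p * (1 + ratio b p) * deriv (deriv f) (ratio b p) +
      ((m : ℝ) + 1 + (2 * m + 2) * ratio b p) * deriv f (ratio b p) +
      ((m : ℝ) + 5 / 6) * (m + 1 / 6) * f (ratio b p) = 0) :
    tri (tail b (m + 1 / 6) f) p = 0 := by
  set β : ℝ := m + 1 / 6 with hβ
  have hf1 := contDiffOn_deriv_Ioi hf
  have hg : ContDiffOn ℝ ∞ (fun z => β * f z + z * deriv f z) (Ioi (-1 / 2)) := by fun_prop
  have h0 := (rho_pos hp.1).ne'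
  have ha := (aOf_pos hb).ne'
  have hX : ∑ i, pd (dirX i) (pd (dirX i) (tail b β f)) p =
      -2 * (2 * m + 1) * tail b (β + 1) (deriv f) p +
        4 * ‖p.1‖ ^ 2 * tail b (β + 1 + 1) (deriv (deriv f)) p := by
    rw [Finset.sum_congr rfl fun i _ => pd_dirX_dirX_tail hb hf hp i, Finset.sum_add_distrib,
      ← Finset.sum_mul, ← Finset.sum_mul, ← Finset.mul_sum, sum_sq_eq, Finset.sum_const,
      Finset.card_univ, Fintype.card_fin, nsmul_eq_mul]
    push_cast
    ring
  have hz := lt_ratio hb hp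
  have hd : ∀ {g : ℝ → ℝ}, ContDiffOn ℝ ∞ g (Ioi (-1 / 2)) → DifferentiableAt ℝ g (ratio b p) :=
    fun hg => (hg.contDiffAt (isOpen_Ioi.mem_nhds hz)).differentiableAt (by simp)
  have hg' : deriv (fun z => β * f z + z * deriv f z) (ratio b p) =
      (β + 1) * deriv f (ratio b p) + ratio b p * deriv (deriv f) (ratio b p) := by
    rw [deriv_fun_add ((hd hf).const_mul β) (differentiableAt_fun_id.fun_mul (hd hf1)),
      deriv_const_mul β (hd hf), deriv_fun_mul differentiableAt_fun_id (hd hf1)]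
    simp
    ring
  have hn : ‖p.1‖ ^ 2 = (tOf p.2 - aOf b) ^ 2 - ratio b p * (4 * aOf b * tOf p.2) := by
    rw [ratio_mul hb hp, k_eq hp.1.le]; ring
  have hy : p.2 = -rho p.2 ^ 2 := by rw [rho_sq hp.1.le]; ring
  rw [tri, hX, pd_dirY_dirY_tail hb hf hp, pd_dirY_tail hb hg hp, pd_dirY_tail hb hf1 hp]
  simp only [tail, wt_add_one hb hp.1, hn, hg']
  generalize ratio b p = z at *
  generalize deriv (deriv f) z = f2 at *
  generalize deriv f z = f1 at *
  generalize f z = f0 at *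
  generalize wt b β p.2 = W
  rw [show p.2 * (-2 * (2 * m + 1) * (W / (4 * aOf b * tOf p.2) * f1) +
    4 * ((tOf p.2 - aOf b) ^ 2 - z * (4 * aOf b * tOf p.2)) *
      (W / (4 * aOf b * tOf p.2) / (4 * aOf b * tOf p.2) * f2)) =
    -rho p.2 ^ 2 * (-2 * (2 * m + 1) * (W / (4 * aOf b * tOf p.2) * f1) +
    4 * ((tOf p.2 - aOf b) ^ 2 - z * (4 * aOf b * tOf p.2)) *
      (W / (4 * aOf b * tOf p.2) / (4 * aOf b * tOf p.2) * f2)) by rw [← hy]]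
  rw [tOf]
  generalize rho p.2 = r at *
  field_simp
  rw [hβ]
  linear_combination 144 * aOf b ^ 2 * W * hode

end

section

variable {n m : ℕ} {b β Y : ℝ}

/-! ### The telescoping sum -/

lemma tri_wt (hb : b < 0) (β : ℝ) {p : Space n} (hp : p ∈ nbhd n b) :
    tri (fun p : Space n => wt b β p.2) p =
      16 * aOf b ^ 2 * (β * (β + 2 / 3)) * (rho p.2 ^ 2 * wt b (β + 1 + 1) p.2) := by
  have h0 := (rho_pos hp.1).ne'
  have ha := (aOf_pos hb).ne'
  have hX : ∀ i, pd (dirX i) (pd (dirX i) (fun p : Space n => wt b β p.2)) p = 0 := fun i => by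
    rw [pd_congr (g := fun _ => 0) (fun q hq => by
      rw [pd_comp_snd (hasDerivAt_wt hb β hq.1)]; simp [dirX]) hp]
    simp [pd]
  have hr' := hasDerivAt_three_div_rho_sq hp.1
  have hY : pd (dirY n) (pd (dirY n) (fun p : Space n => wt b β p.2)) p =
      3 / (2 * rho p.2 ^ 4) * β * wt b β p.2 +
        3 / (2 * rho p.2 ^ 2) * β * (3 / (2 * rho p.2 ^ 2) * β * wt b β p.2) := by
    rw [pd_congr (g := fun p => 3 / (2 * rho p.2 ^ 2) * β * wt b β p.2) (fun q hq => by
      rw [pd_comp_snd (hasDerivAt_wt hb β hq.1)]; simp [dirY]) hp,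
      pd_comp_snd ((hr'.mul_const β).fun_mul (hasDerivAt_wt hb β hp.1))]
    simp [dirY]
  rw [tri, Finset.sum_eq_zero fun i _ => hX i, hY, wt_add_one hb hp.1, wt_add_one hb hp.1, tOf]
  field_simp
  ring

lemma transport_wt (hb : b < 0) (β : ℝ) {p : Space n} (hp : p ∈ nbhd n b) :
    transport b (fun p : Space n => wt b β p.2) p =
      (2 * (n + 1) * rho p.2 ^ 2 + (1 - 6 * β) * ((tOf p.2 - aOf b) / rho p.2)) * wt b β p.2 := by
  have h := transport_tail (n := n) (β := β) (f := fun _ => 1) hb contDiffOn_const hp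
  have ht : tail (n := n) b β (fun _ => 1) = fun p => wt b β p.2 := by ext p; simp [tail]
  rw [ht] at h
  simpa [tail] using h

lemma rieszC_zero (hb : b < 0) (hn : 2 ≤ n) {ψ : Space n → ℝ} (h : IsAdm b Y ψ)
    (h0 : ∀ p ∈ conoid n b, ψ p = 0) {q : ℂ} (hq : -((n : ℝ) + 1) / 2 < q.re) :
    rieszC b q ψ = 0 := by
  have h1 := rieszC_const_mul hb hn h 0 hq
  rw [← rieszC_congr hb hn h (h.mul_left (.const 0)) (fun p hp => by rw [h0 p hp, mul_zero]) hq] at h1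
  simpa using h1

lemma neg_half_lt (m : ℕ) {x : ℝ} (hx : -(m : ℝ) - 1 < x) :
    -(((2 * m + 1 : ℕ) : ℝ) + 1) / 2 < x := by
  push_cast; linarith

lemma smoothNear_rho_sq : SmoothNear b (fun p : Space n => rho p.2 ^ 2) := smoothNear_rho.pow 2

/-- The pairing of `𝒯((4at)^{-j-1/6} χ_x(k))` with `φ`. The first term vanishes for `x = j - m`,
which is how the weights are matched with the orders of the derivatives of `δ(k)`. -/
lemma rieszC_wt_mul_tri (hm : 1 ≤ m) (hb : b < 0) {φ : Space (2 * m + 1) → ℝ} (hφ : IsAdm b Y φ)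
    (j : ℕ) {x : ℝ} (hx : -(m : ℝ) < x) :
    rieszC b x (fun p => wt b (j + 1 / 6) p.2 * tri φ p) =
      4 * ((x : ℂ) + m - j) *
        rieszC b ((x : ℂ) - 1) (fun p => rho p.2 ^ 2 * wt b (j + 1 / 6) p.2 * φ p) +
      16 * (aOf b : ℂ) ^ 2 * (j * rieszC b ((x : ℂ) - 1)
          (fun p => rho p.2 ^ 2 * (wt b (j + 1 / 6 + 1) p.2 * φ p)) +
        (j + 1 / 6) * (j + 5 / 6) * rieszC b x
          (fun p => rho p.2 ^ 2 * (wt b (j + 1 / 6 + 1 + 1) p.2 * φ p))) := by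
  have hn : 2 ≤ 2 * m + 1 := by omega
  have hw : ∀ β, SmoothNear b (fun p : Space (2 * m + 1) => wt b β p.2) := smoothNear_wt hb
  have hV : ∀ β, IsAdm b Y (fun p : Space (2 * m + 1) => rho p.2 ^ 2 * (wt b β p.2 * φ p)) :=
    fun β => (hφ.mul_left (hw β)).mul_left smoothNear_rho_sq
  have hx1 : -(((2 * m + 1 : ℕ) : ℝ) + 1) / 2 < ((x : ℂ) - 1).re := by
    refine neg_half_lt m ?_
    simp only [Complex.sub_re, Complex.ofReal_re, Complex.one_re]
    linarith
  have hx0 : -(((2 * m + 1 : ℕ) : ℝ) + 1) / 2 < (x : ℂ).re :=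
    neg_half_lt m (by rw [Complex.ofReal_re]; linarith)
  have e1 : rieszC b ((x : ℂ) - 1) (fun p => -p.2 * (wt b (j + 1 / 6) p.2 * φ p)) =
      rieszC b ((x : ℂ) - 1) (fun p => rho p.2 ^ 2 * (wt b (j + 1 / 6) p.2 * φ p)) :=
    rieszC_congr hb hn ((hφ.mul_left (hw _)).mul_left smoothNear_snd.neg) (hV _)
      (fun p hp => by rw [rho_sq (hp.2.trans hb).le]) hx1
  have e2 : rieszC b ((x : ℂ) - 1) (fun p => transport b (fun p => wt b (j + 1 / 6) p.2) p * φ p) =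
      rieszC b ((x : ℂ) - 1) (fun p =>
        (4 * m + 4 - 4 * j) * (rho p.2 ^ 2 * (wt b (j + 1 / 6) p.2 * φ p)) +
        (16 * aOf b ^ 2 * j) * (rho p.2 ^ 2 * (wt b (j + 1 / 6 + 1) p.2 * φ p))) := by
    refine rieszC_congr hb hn (hφ.mul_left (hw _).transport)
      (((hV _).mul_left (.const _)).add ((hV _).mul_left (.const _))) (fun p hp => ?_) hx1
    have hy : p.2 < 0 := hp.2.trans hb
    have h0 := (rho_pos hy).ne'
    have ha := (aOf_pos hb).ne'
    rw [transport_wt hb _ (conoid_subset_nbhd hb hp), wt_add_one hb hy, tOf]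
    push_cast
    field_simp
    ring
  have e3 : rieszC b x (fun p => tri (fun p => wt b (j + 1 / 6) p.2) p * φ p) =
      rieszC b x (fun p => (16 * aOf b ^ 2 * ((j + 1 / 6) * (j + 5 / 6))) *
        (rho p.2 ^ 2 * (wt b (j + 1 / 6 + 1 + 1) p.2 * φ p))) := by
    refine rieszC_congr hb hn (hφ.mul_left (hw _).tri) ((hV _).mul_left (.const _))
      (fun p hp => ?_) hx0
    rw [tri_wt hb _ (conoid_subset_nbhd hb hp)]
    ring
  have e4 : (fun p : Space (2 * m + 1) => rho p.2 ^ 2 * wt b (j + 1 / 6) p.2 * φ p) =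
      fun p => rho p.2 ^ 2 * (wt b (j + 1 / 6) p.2 * φ p) := by ext p; ring
  rw [rieszC_mul_tri hb hn hφ (hw _) (by push_cast; simpa using by linarith), e1, e2, e3, e4,
    rieszC_add hb hn ((hV _).mul_left (.const _)) ((hV _).mul_left (.const _)) hx1,
    rieszC_const_mul hb hn (hV _) _ hx1, rieszC_const_mul hb hn (hV _) _ hx1,
    rieszC_const_mul hb hn (hV _) _ hx0]
  push_cast
  ring

/-- The constant `A m` normalizes the mass at the vertex: there `4at = 4a² = (4/3)² ρ⁶`. -/
lemma vertex_const (m : ℕ) (hb : b < 0) (d : ℝ) :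
    A m * (2 * Real.pi ^ m * (rho b ^ 2 * wt b (1 / 6) b * d / rho b)) = d := by
  have hr := rho_pos hb
  have hw : wt b (1 / 6) b = (4 / 3 : ℝ) ^ (-(1 / 3) : ℝ) * (rho b)⁻¹ := by
    have h1 : 4 * aOf b * tOf b = (4 / 3) ^ (2 : ℝ) * rho b ^ (6 : ℝ) := by
      rw [aOf_eq_tOf hb.le, tOf]
      norm_cast
      ring
    rw [wt, h1, Real.mul_rpow (by positivity) (by positivity), ← Real.rpow_mul (by norm_num),
      ← Real.rpow_mul hr.le]
    norm_num [Real.rpow_neg_one]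
  have h2 : (4 / 3 : ℝ) ^ (-(1 / 3) : ℝ) = (3 : ℝ) ^ (1 / 3 : ℝ) / ((2 : ℝ) ^ (1 / 3 : ℝ)) ^ 2 := by
    rw [Real.rpow_neg (by norm_num), Real.div_rpow (by norm_num) (by norm_num),
      show (4 : ℝ) = 2 * 2 by norm_num, Real.mul_rpow (by norm_num) (by norm_num)]
    rw [inv_div, sq]
  have h3 : ((2 : ℝ) ^ (1 / 3 : ℝ)) ^ 3 = 2 := by
    rw [← Real.rpow_natCast, ← Real.rpow_mul (by norm_num)]; norm_num
  rw [hw, h2, A]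
  have h4 : (0 : ℝ) < (2 : ℝ) ^ (1 / 3 : ℝ) := by positivity
  have h5 : (0 : ℝ) < (3 : ℝ) ^ (1 / 3 : ℝ) := by positivity
  have h6 := Real.pi_pos
  set X := (2 : ℝ) ^ (1 / 3 : ℝ)
  field_simp
  rw [h3]

/-- For `j = 0` the exponent `-m` is the first one where the pairing at `x - 1` is no longer defined;
the limit of the first term of `rieszC_wt_mul_tri` is the Dirac measure at the vertex. -/
lemma rieszC_wt_mul_tri_zero (hm : 1 ≤ m) (hb : b < 0) (φ : Test (2 * m + 1)) :
    rieszC b (-(m : ℂ)) (fun p => wt b (1 / 6) p.2 * tri φ p) =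
      ((2 * Real.pi ^ m * (rho b ^ 2 * wt b (1 / 6) b * φ (0, b) / rho b) : ℝ) : ℂ) +
      16 * (aOf b : ℂ) ^ 2 * ((1 / 6) * (5 / 6) * rieszC b (-(m : ℂ))
          (fun p => rho p.2 ^ 2 * (wt b (1 / 6 + 1 + 1) p.2 * φ p))) := by
  have hn : 2 ≤ 2 * m + 1 := by omega
  obtain ⟨Y, hφ⟩ := exists_isAdm b φ
  have ht := tendsto_rieszC_vertex hb hn φ (f := fun y => rho y ^ 2 * wt b (1 / 6) y)
    ((contDiffOn_rho.pow 2).mul (contDiffOn_wt hb _))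
  have he : -(((2 * m + 1 : ℕ) : ℝ) - 1) / 2 = -(m : ℝ) := by push_cast; ring
  have he' : (((2 * m + 1 : ℕ) : ℝ) - 1) / 2 = (m : ℝ) := by push_cast; ring
  rw [he, he', Real.rpow_natCast] at ht
  have hcont : ∀ {ψ : Space (2 * m + 1) → ℝ}, IsAdm b Y ψ →
      Tendsto (fun x : ℝ => rieszC b x ψ) (𝓝[>] (-(m : ℝ))) (𝓝 (rieszC b (-(m : ℂ)) ψ)) := by
    intro ψ hψ
    have ho : IsOpen {q : ℂ | -(((2 * m + 1 : ℕ) : ℝ) + 1) / 2 < q.re} :=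
      isOpen_lt continuous_const Complex.continuous_re
    have h1 := (differentiableOn_rieszC hb hn hψ).continuousOn.continuousAt
      (x := ((-(m : ℝ) : ℝ) : ℂ)) (ho.mem_nhds (neg_half_lt m (by simp)))
    have h2 : ContinuousAt (fun x : ℝ => rieszC b (x : ℂ) ψ) (-(m : ℝ)) :=
      ContinuousAt.comp (f := fun x : ℝ => (x : ℂ)) h1 Complex.continuous_ofReal.continuousAt
    have h3 := h2.tendsto.mono_left (nhdsWithin_le_nhds (s := Ioi (-(m : ℝ))))
    push_cast at h3
    exact h3
  have hl := hcont (hφ.tri.mul_left (smoothNear_wt hb (1 / 6)))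
  have hr := hcont ((hφ.mul_left (smoothNear_wt hb (1 / 6 + 1 + 1))).mul_left smoothNear_rho_sq)
  refine tendsto_nhds_unique hl ((ht.add ((hr.const_mul ((1 / 6) * (5 / 6))).const_mul
    (16 * (aOf b : ℂ) ^ 2))).congr' ?_)
  filter_upwards [self_mem_nhdsWithin] with x (hx : -(m : ℝ) < x)
  have := rieszC_wt_mul_tri hm hb hφ 0 hx
  simp only [Nat.cast_zero, zero_add, zero_mul, sub_zero] at this
  rw [this]
  push_cast
  ring

/-- The smooth factor of the last term of the fundamental solution: the function
`(4 a t)^{-m-1/6} f(k / (4 a t))` with `f` the Pfaff transform of `F(1/6, m + 1/6; m + 1; ·)`. -/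
noncomputable def regularFactor (m : ℕ) (b : ℝ) : Space (2 * m + 1) → ℝ :=
  tail b (m + 1 / 6) (pfaff (1 / 6) (m + 1 / 6) (m + 1))

lemma smoothNear_regularFactor (hb : b < 0) : SmoothNear b (regularFactor m b) :=
  smoothNear_tail hb _ (contDiffOn_pfaff (by norm_num) (by positivity) (by positivity))

lemma tri_regularFactor (hb : b < 0) {p : Space (2 * m + 1)} (hp : p ∈ conoid (2 * m + 1) b) :
    tri (regularFactor m b) p = 0 := by
  refine tri_tail hb (contDiffOn_pfaff (by norm_num) (by positivity) (by positivity))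
    (conoid_subset_nbhd hb hp) ?_
  have := pfaff_ode (α := 1 / 6) (β := m + 1 / 6) (γ := m + 1) (by norm_num) (by positivity)
    (by positivity) (ratio_pos hb hp)
  linear_combination this

/-- The last term: inside the conoid `regularFactor` solves the equation, and on the boundary only the
value `f(0) = 1` contributes, as `k χ_{-1}(k) = 0`. -/
lemma rieszC_regularFactor_mul_tri (hm : 1 ≤ m) (hb : b < 0) {φ : Space (2 * m + 1) → ℝ}
    (hφ : IsAdm b Y φ) :
    rieszC b 0 (fun p => regularFactor m b p * tri φ p) =
      16 * (aOf b : ℂ) ^ 2 * (m * rieszC b (-1)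
        (fun p => rho p.2 ^ 2 * (wt b (m + 1 / 6 + 1) p.2 * φ p))) := by
  have hn : 2 ≤ 2 * m + 1 := by omega
  have hm' : (1 : ℝ) ≤ m := by exact_mod_cast hm
  set f := pfaff (1 / 6) (m + 1 / 6) (m + 1) with hf
  have hfs : ContDiffOn ℝ ∞ f (Ioi (-1 / 2)) :=
    contDiffOn_pfaff (by norm_num) (by positivity) (by positivity)
  have hdf : ContDiffOn ℝ ∞ (dslope f 0) (Ioi (-1 / 2)) :=
    contDiffOn_dslope_pfaff (by norm_num) (by positivity) (by positivity)
  have hh : SmoothNear b (regularFactor m b) := smoothNear_regularFactor hb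
  have hV : IsAdm b Y (fun p => rho p.2 ^ 2 * (wt b (m + 1 / 6 + 1) p.2 * φ p)) :=
    (hφ.mul_left (smoothNear_wt hb _)).mul_left smoothNear_rho_sq
  have hq : -(((2 * m + 1 : ℕ) : ℝ) + 1) / 2 < ((0 : ℂ) - 1).re :=
    neg_half_lt m (by simp; linarith)
  have hq0 : -(((2 * m + 1 : ℕ) : ℝ) + 1) / 2 < (0 : ℂ).re :=
    neg_half_lt m (by simp; linarith)
  have e1 : rieszC b (0 - 1) (fun p => -p.2 * (regularFactor m b p * φ p)) =
      rieszC b (0 - 1) (fun p => rho p.2 ^ 2 * (regularFactor m b p * φ p)) :=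
    rieszC_congr hb hn ((hφ.mul_left hh).mul_left smoothNear_snd.neg)
      ((hφ.mul_left hh).mul_left smoothNear_rho_sq)
      (fun p hp => by rw [rho_sq (hp.2.trans hb).le]) hq
  have e2 : rieszC b 0 (fun p => tri (regularFactor m b) p * φ p) = 0 :=
    rieszC_zero hb hn (hφ.mul_left hh.tri)
      (fun p hp => by rw [tri_regularFactor hb hp, zero_mul]) hq0
  -- the part of the transport term that is divisible by `k`
  set g : Space (2 * m + 1) → ℝ := fun p =>
    16 * aOf b ^ 2 * m * rho p.2 ^ 2 * tail b (m + 1 / 6 + 1 + 1) (dslope f 0) p +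
      (8 * rho p.2 ^ 2 - 6 * ((tOf p.2 - aOf b) / rho p.2)) *
        tail b (m + 1 / 6 + 1) (deriv f) p with hg
  have hgs : SmoothNear b g := by
    refine SmoothNear.add ?_ ?_
    · exact ((SmoothNear.const _).mul smoothNear_rho_sq).mul (smoothNear_tail hb _ hdf)
    · refine SmoothNear.mul ?_ (smoothNear_tail hb _ (contDiffOn_deriv_Ioi hfs))
      exact ((SmoothNear.const 8).mul smoothNear_rho_sq).sub ((SmoothNear.const 6).mul
        ((smoothNear_tOf.sub (.const _)).div smoothNear_rho fun p hp => (rho_pos hp.1).ne'))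
  have e3 : rieszC b (0 - 1) (fun p => transport b (regularFactor m b) p * φ p) =
      rieszC b (0 - 1) (fun p => 4 * (rho p.2 ^ 2 * (regularFactor m b p * φ p)) +
        (16 * aOf b ^ 2 * m * (rho p.2 ^ 2 * (wt b (m + 1 / 6 + 1) p.2 * φ p)) +
          k b p * (g p * φ p))) := by
    refine rieszC_congr hb hn (hφ.mul_left hh.transport)
      ((((hφ.mul_left hh).mul_left smoothNear_rho_sq).mul_left (.const _)).add
        ((hV.mul_left (.const _)).add ((hφ.mul_left hgs).mul_left smoothNear_k)))
      (fun p hp => ?_) hq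
    have hpn := conoid_subset_nbhd hb hp
    have hy : p.2 < 0 := hpn.1
    have h0 := (rho_pos hy).ne'
    have ha := (aOf_pos hb).ne'
    have hd : f (ratio b p) = 1 + ratio b p * dslope f 0 (ratio b p) := by
      have h1 := sub_smul_dslope f 0 (ratio b p)
      rw [hf, pfaff_zero, ← hf, smul_eq_mul, sub_zero] at h1
      linarith
    rw [regularFactor, transport_tail hb hfs hpn, ← ratio_mul hb hpn]
    simp only [hg, tail, ← hf, wt_add_one hb hy]
    rw [hd, tOf]
    push_cast
    field_simp
    ring
  have hneg : (0 : ℂ) - 1 = -1 := by ring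
  have hA := ((hφ.mul_left hh).mul_left smoothNear_rho_sq)
  rw [rieszC_mul_tri hb hn hφ hh (by push_cast; simpa using by linarith), e1, e2, e3,
    rieszC_add hb hn (hA.mul_left (.const _)) ((hV.mul_left (.const _)).add
      ((hφ.mul_left hgs).mul_left smoothNear_k)) hq,
    rieszC_add hb hn (hV.mul_left (.const _)) ((hφ.mul_left hgs).mul_left smoothNear_k) hq,
    rieszC_const_mul hb hn hA _ hq, rieszC_const_mul hb hn hV _ hq,
    rieszC_k_mul hb hn (hφ.mul_left hgs) hq, hneg]
  push_cast
  ring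

lemma c_zero : c 0 = 1 := by
  have h1 := (Real.Gamma_pos_of_pos (show (0 : ℝ) < 5 / 6 by norm_num)).ne'
  have h2 := (Real.Gamma_pos_of_pos (show (0 : ℝ) < 1 / 6 by norm_num)).ne'
  simp only [c, Nat.cast_zero, zero_add, Real.Gamma_one, mul_one]
  exact div_self (mul_ne_zero h1 h2)

lemma c_succ (j : ℕ) : c (j + 1) * (j + 1) = c j * ((j + 1 / 6) * (j + 5 / 6)) := by
  have h1 := (Real.Gamma_pos_of_pos (show (0 : ℝ) < 5 / 6 by norm_num)).ne'
  have h2 := (Real.Gamma_pos_of_pos (show (0 : ℝ) < 1 / 6 by norm_num)).ne'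
  have h3 := (Real.Gamma_pos_of_pos (show (0 : ℝ) < (j : ℝ) + 1 by positivity)).ne'
  have e1 := Real.Gamma_add_one (show (j : ℝ) + 5 / 6 ≠ 0 by positivity)
  have e2 := Real.Gamma_add_one (show (j : ℝ) + 1 / 6 ≠ 0 by positivity)
  have e3 := Real.Gamma_add_one (show (j : ℝ) + 1 ≠ 0 by positivity)
  simp only [c]
  push_cast
  rw [e3, show (j : ℝ) + 1 + 5 / 6 = j + 5 / 6 + 1 by ring,
    show (j : ℝ) + 1 + 1 / 6 = j + 1 / 6 + 1 by ring, e1, e2]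
  field_simp

lemma c_pos (j : ℕ) : 0 < c j := by
  have h : ∀ x : ℝ, 0 < x → 0 < Real.Gamma x := fun x hx => Real.Gamma_pos_of_pos hx
  have h1 := h (5 / 6) (by norm_num)
  have h2 := h (1 / 6) (by norm_num)
  have h3 := h (j + 1) (by positivity)
  have h4 := h (j + 5 / 6) (by positivity)
  have h5 := h (j + 1 / 6) (by positivity)
  unfold c
  positivity

/-- Two consecutive terms cancel up to the boundary terms of the sum, because
`(j + 1) c_{j+1} = (j + 1/6)(j + 5/6) c_j`. -/
lemma sum_rieszC_wt_mul_tri (hm : 1 ≤ m) (hb : b < 0) (φ : Test (2 * m + 1)) {N : ℕ}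
    (hN : 1 ≤ N) (hNm : N ≤ m) :
    ∑ j ∈ Finset.range N, ((-1) ^ j * c j : ℂ) *
      rieszC b ((j : ℂ) - m) (fun p => wt b (j + 1 / 6) p.2 * tri φ p) =
      ((2 * Real.pi ^ m * (rho b ^ 2 * wt b (1 / 6) b * φ (0, b) / rho b) : ℝ) : ℂ) -
      (-1) ^ N * c N * (16 * (aOf b : ℂ) ^ 2 * (N * rieszC b ((N : ℂ) - m - 1)
        (fun p => rho p.2 ^ 2 * (wt b (N + 1 / 6 + 1) p.2 * φ p)))) := by
  obtain ⟨Y, hφ⟩ := exists_isAdm b φ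
  have hc : ∀ j : ℕ, (c (j + 1) : ℂ) * (j + 1) = c j * ((j + 1 / 6) * (j + 5 / 6)) := fun j => by
    have := congrArg (fun x : ℝ => (x : ℂ)) (c_succ j)
    push_cast at this
    exact this
  induction N, hN using Nat.le_induction with
  | base =>
    have h1 := hc 0
    simp only [Nat.cast_zero, zero_add, c_zero, Complex.ofReal_one, mul_one, one_mul] at h1
    rw [Finset.sum_range_one]
    simp only [Nat.cast_zero, zero_add, c_zero, Complex.ofReal_one, pow_zero, one_mul, zero_sub,
      Nat.cast_one, pow_one]
    rw [rieszC_wt_mul_tri_zero hm hb φ, h1, show (1 : ℂ) - m - 1 = -m by ring,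
      show (1 : ℝ) + 1 / 6 + 1 = 1 / 6 + 1 + 1 by ring]
    ring
  | succ N hN ih =>
    rw [Finset.sum_range_succ, ih (by omega)]
    have hx : -(m : ℝ) < (N : ℝ) - m := by
      have : (1 : ℝ) ≤ N := by exact_mod_cast hN
      linarith
    have h1 := rieszC_wt_mul_tri hm hb hφ N hx
    push_cast at h1
    rw [h1]
    have e1 : ((N + 1 : ℕ) : ℂ) - m - 1 = N - m := by push_cast; ring
    have e2 : ((N + 1 : ℕ) : ℝ) + 1 / 6 + 1 = N + 1 / 6 + 1 + 1 := by push_cast; ring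
    rw [e1, e2]
    set V := rieszC b ((N : ℂ) - m) fun p => rho p.2 ^ 2 * (wt b (N + 1 / 6 + 1 + 1) p.2 * φ p)
    push_cast
    linear_combination (-1) ^ N * 16 * (aOf b : ℂ) ^ 2 * V * (-(hc N))

/-- The equation `𝒯E = δ` in terms of the continued family: what remains of the telescoping sum
cancels with the contribution of the last term. -/
lemma fundamental_identity (hm : 1 ≤ m) (hb : b < 0) (φ : Test (2 * m + 1)) :
    (A m : ℂ) * ∑ j ∈ Finset.range m, ((-1) ^ j * c j : ℂ) *
      rieszC b ((j : ℂ) - m) (fun p => wt b (j + 1 / 6) p.2 * tri φ p) +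
      (-1) ^ m * A m * c m * rieszC b 0 (fun p => regularFactor m b p * tri φ p) = φ (0, b) := by
  obtain ⟨Y, hφ⟩ := exists_isAdm b φ
  rw [sum_rieszC_wt_mul_tri hm hb φ hm le_rfl, rieszC_regularFactor_mul_tri hm hb hφ,
    show (m : ℂ) - m - 1 = -1 by ring]
  have := congrArg (fun x : ℝ => (x : ℂ)) (vertex_const m hb (φ (0, b)))
  push_cast at this ⊢
  linear_combination this

end

section

variable {n m : ℕ} {b Y : ℝ}

/-! ### The terms of the fundamental solution -/

lemma two_le (hm : 1 ≤ m) : 2 ≤ 2 * m + 1 := by omega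

/-- The distribution `(4 a t)^{-j-1/6} δ^{(m-j-1)}(k)`. -/
noncomputable def layer (hm : 1 ≤ m) (hb : b < 0) (j : ℕ) : Distr (2 * m + 1) :=
  rieszDistr hb (two_le hm) (x := (j : ℝ) - m)
    (neg_half_lt m (by have : (0 : ℝ) ≤ j := j.cast_nonneg; linarith)) (smoothNear_wt hb (j + 1 / 6))

lemma layer_apply (hm : 1 ≤ m) (hb : b < 0) (j : ℕ) (φ : Test (2 * m + 1)) :
    ((layer hm hb j φ : ℝ) : ℂ) =
      rieszC b ((j : ℂ) - m) (fun p => wt b (j + 1 / 6) p.2 * φ p) := by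
  rw [layer, rieszDistr_apply]
  push_cast
  rfl

/-- The distribution given by the function `regularPart m b`. -/
noncomputable def regularDistr (hm : 1 ≤ m) (hb : b < 0) : Distr (2 * m + 1) :=
  ((-1 : ℝ) ^ m * A m * c m) • rieszDistr hb (two_le hm) (x := 0)
    (neg_half_lt m (by have : (0 : ℝ) ≤ m := m.cast_nonneg; linarith)) (smoothNear_regularFactor hb)

lemma regularDistr_apply (hm : 1 ≤ m) (hb : b < 0) (φ : Test (2 * m + 1)) :
    ((regularDistr hm hb φ : ℝ) : ℂ) =
      (-1) ^ m * A m * c m * rieszC b 0 (fun p => regularFactor m b p * φ p) := by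
  have h : regularDistr hm hb φ = ((-1 : ℝ) ^ m * A m * c m) * rieszDistr hb (two_le hm) (x := 0)
    (neg_half_lt m (by have : (0 : ℝ) ≤ m := m.cast_nonneg; linarith))
    (smoothNear_regularFactor hb) φ := rfl
  rw [h, Complex.ofReal_mul, rieszDistr_apply]
  push_cast
  rfl

lemma regularPart_eq (hb : b < 0) : regularPart m b = (conoid (2 * m + 1) b).indicator
    fun p => ((-1 : ℝ) ^ m * A m * c m) * regularFactor m b p := by
  refine indicator_congr fun p hp => ?_
  have hy : p.2 < 0 := hp.2.trans hb
  have hT := four_mul_pos hb hy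
  have hz := ratio_pos hb hp
  have hr := ratio_mul hb (conoid_subset_nbhd hb hp)
  have hv : -v b p / 9 = 4 * aOf b * tOf p.2 * (1 + ratio b p) := by
    rw [neg_v_eq hy.le, ← hr]; ring
  have huv : u b p / v b p = ratio b p / (1 + ratio b p) := by
    have h1 : u b p = -9 * k b p := by rw [k]; ring
    have h2 : v b p = -9 * (-v b p / 9) := by ring
    rw [h2, hv, h1, ← hr]
    have : 1 + ratio b p ≠ 0 := by positivity
    rw [div_eq_div_iff (mul_ne_zero (by norm_num) (mul_ne_zero hT.ne' this)) this]
    ring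
  rw [hv, huv, Real.mul_rpow hT.le (by positivity), regularFactor, tail, wt, pfaff, neg_add']
  ring

lemma regularDistr_eq_integral (hm : 1 ≤ m) (hb : b < 0) (φ : Test (2 * m + 1)) :
    regularDistr hm hb φ = ((-1 : ℝ) ^ m * A m * c m) *
      ∫ p in conoid (2 * m + 1) b, regularFactor m b p * φ p := by
  obtain ⟨Y, hφ⟩ := exists_isAdm b φ
  have h1 := rieszC_eq_riesz_ofReal hb (two_le hm) (hφ.mul_left (smoothNear_regularFactor hb))
    (x := 0) (by norm_num)
  have h := regularDistr_apply hm hb φ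
  rw [← Complex.ofReal_zero, h1, riesz_ofReal] at h
  simp only [Real.rpow_zero, one_mul, zero_add, Real.Gamma_one, div_one] at h
  exact_mod_cast h

lemma regularDistr_eq_integral_regularPart (hm : 1 ≤ m) (hb : b < 0) (φ : Test (2 * m + 1)) :
    regularDistr hm hb φ = ∫ p, regularPart m b p * φ p := by
  have h : (fun p => regularPart m b p * φ p) = (conoid (2 * m + 1) b).indicator
      fun p => ((-1 : ℝ) ^ m * A m * c m) * (regularFactor m b p * φ p) := by
    ext p
    by_cases hp : p ∈ conoid (2 * m + 1) b <;> simp [regularPart_eq hb, hp, mul_assoc]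
  rw [regularDistr_eq_integral, h, integral_indicator measurableSet_conoid, integral_const_mul]

lemma locallyIntegrable_regularPart (hb : b < 0) : LocallyIntegrable (regularPart m b) := by
  refine locallyIntegrable_iff.2 fun K hK => ?_
  obtain ⟨Y, hY⟩ := (hK.image continuous_snd).bddBelow
  have hs := smoothNear_regularFactor (m := m) hb
  obtain ⟨C, hC⟩ := (isCompact_trunc (n := 2 * m + 1) (b := b) Y).exists_bound_of_continuousOn
    (hs.continuousOn.mono (trunc_subset_nbhd hb Y))
  rw [regularPart_eq hb]
  refine Measure.integrableOn_of_bounded (M := |(-1 : ℝ) ^ m * A m * c m| * max C 0)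
    hK.measure_lt_top.ne ?_ ?_
  · rw [aestronglyMeasurable_indicator_iff measurableSet_conoid]
    exact ((hs.continuousOn.mono (conoid_subset_nbhd hb)).aestronglyMeasurable
      measurableSet_conoid).const_mul _
  · filter_upwards [ae_restrict_mem hK.measurableSet] with p hp
    by_cases h : p ∈ conoid (2 * m + 1) b
    · rw [indicator_of_mem h, norm_mul, Real.norm_eq_abs]
      refine mul_le_mul_of_nonneg_left ((hC p (mem_trunc_of_mem_conoid hb h
        (hY (mem_image_of_mem _ hp)))).trans (le_max_left _ _)) (abs_nonneg _)
    · rw [indicator_of_notMem h, norm_zero]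
      positivity

/-- The continuation reaches the half-plane of the definition, as `-(m - j - 1) - 2 ≥ -m - 1`. -/
lemma isWeightedDelta_layer (hm : 1 ≤ m) (hb : b < 0) {j : ℕ} (hj : j < m) :
    IsWeightedDelta b (m - j - 1)
      (fun p => ((u b p - v b p) / 9) ^ (-(j : ℝ) - 1 / 6)) (layer hm hb j) := by
  intro φ
  obtain ⟨Y, hφ⟩ := exists_isAdm b φ
  have hn := two_le hm
  have hw := hφ.mul_left (smoothNear_wt hb (j + 1 / 6))
  have hc : ∀ p ∈ conoid (2 * m + 1) b,
      ((u b p - v b p) / 9) ^ (-(j : ℝ) - 1 / 6) * φ p = wt b (j + 1 / 6) p.2 * φ p := by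
    intro p hp
    rw [u_sub_v_eq (hp.2.trans hb).le, wt, neg_add']
  have hl : ((m - j - 1 : ℕ) : ℝ) = (m : ℝ) - j - 1 := by
    rw [Nat.cast_sub (by omega), Nat.cast_sub hj.le]; simp
  have hl' : ((m - j - 1 : ℕ) : ℂ) = (m : ℂ) - j - 1 := by
    rw [Nat.cast_sub (by omega), Nat.cast_sub hj.le]; simp
  refine ⟨fun q => rieszC b q (fun p => wt b (j + 1 / 6) p.2 * φ p),
    (differentiableOn_rieszC hb hn hw).mono fun q (hq : _ < q.re) => ?_, fun q hq => ⟨?_, ?_⟩, ?_⟩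
  · rw [hl] at hq
    have : (0 : ℝ) ≤ j := j.cast_nonneg
    refine neg_half_lt m ?_
    linarith
  · refine (hw.integrableOn_riesz hb hn hq).congr_fun (fun p hp => ?_) measurableSet_conoid
    simp only [hc p hp]
  · simp only
    rw [rieszC_eq_riesz hb hn hw hq, riesz]
    exact setIntegral_congr_fun measurableSet_conoid fun p hp => by simp only [hc p hp]
  · rw [layer_apply, hl']
    congr 1
    ring

/-! ### The equation `𝒯E = δ` -/

/-- The test function `𝒯φ`. -/
noncomputable def triTest (φ : Test n) : Test n :=
  (∑ i : Fin n, ∂_{dirX i} (∂_{dirX i} (mulY φ))) + ∂_{dirY n} (∂_{dirY n} φ)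

lemma tricomi_eq (E : Distr n) (φ : Test n) : tricomi E φ = E (triTest φ) := by
  have h : ∀ (w : Space n) (ψ : Test n), (∂_{w} (∂_{w} E)) ψ = E (∂_{w} (∂_{w} ψ)) := fun w ψ => by
    rw [Distribution.lineDerivOp_apply_apply, Distribution.lineDerivOp_apply_apply,
      LineDeriv.lineDerivOp_neg, neg_neg]
  have hs : (∑ i : Fin n, ∂_{dirX i} (∂_{dirX i} E)) (mulY φ) =
      ∑ i : Fin n, (∂_{dirX i} (∂_{dirX i} E)) (mulY φ) := by
    simp
  rw [tricomi, hs, triTest, map_add, map_sum]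
  simp only [h]

lemma triTest_apply {p : Space n} (hp : p ∈ nbhd n b) (φ : Test n) :
    triTest φ p = tri φ p := by
  have hφ := smoothNear_test (b := b) φ
  have h1 : ∀ i, (∂_{dirX i} (∂_{dirX i} (mulY φ)) : Test n) p =
      p.2 * pd (dirX i) (pd (dirX i) φ) p := fun i => by
    rw [← pd_test, ← pd_test]
    have h2 : ∀ {ψ : Space n → ℝ}, SmoothNear b ψ → ∀ q ∈ nbhd n b,
        pd (dirX i) (fun q => q.2 * ψ q) q = q.2 * pd (dirX i) ψ q := fun hψ q hq => by
      rw [pd_mul smoothNear_snd hψ hq, pd_snd]; simp [dirX]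
    have h3 : ⇑(mulY φ) = fun q : Space n => q.2 * φ q := rfl
    rw [h3, pd_congr (h2 hφ) hp, h2 (hφ.pd _) p hp]
  have h4 : triTest φ p = (∑ i : Fin n, (∂_{dirX i} (∂_{dirX i} (mulY φ)) : Test n) p) +
      (∂_{dirY n} (∂_{dirY n} φ) : Test n) p := by
    simp [triTest]
  rw [h4, Finset.sum_congr rfl fun i _ => h1 i, ← pd_test, ← pd_test, tri, Finset.mul_sum]

/-- The fundamental solution relative to `(0, b)`. -/
noncomputable def fundSol (hm : 1 ≤ m) (hb : b < 0) : Distr (2 * m + 1) :=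
  A m • ∑ j : Fin m, ((-1 : ℝ) ^ (j : ℕ) * c j) • layer hm hb j + regularDistr hm hb

lemma fundSol_apply (hm : 1 ≤ m) (hb : b < 0) (φ : Test (2 * m + 1)) :
    fundSol hm hb φ = A m * ∑ j ∈ Finset.range m, ((-1 : ℝ) ^ j * c j) * layer hm hb j φ +
      regularDistr hm hb φ := by
  rw [← Fin.sum_univ_eq_sum_range (fun j => ((-1 : ℝ) ^ j * c j) * layer hm hb j φ)]
  simp [fundSol]

lemma isFundamentalSolution_fundSol (hm : 1 ≤ m) (hb : b < 0) :
    IsFundamentalSolution (fundSol hm hb) (0, b) := by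
  intro φ
  obtain ⟨Y, hφ⟩ := exists_isAdm b φ
  obtain ⟨Y', hφ'⟩ := exists_isAdm b (triTest φ)
  have hn := two_le hm
  have he : ∀ p ∈ conoid (2 * m + 1) b, triTest φ p = tri φ p := fun p hp =>
    triTest_apply (conoid_subset_nbhd hb hp) φ
  have h0 : ∀ {x : ℂ} {w : Space (2 * m + 1) → ℝ}, -(m : ℝ) - 1 < x.re → SmoothNear b w →
      rieszC b x (fun p => w p * triTest φ p) = rieszC b x (fun p => w p * tri φ p) :=
    fun hx hw => rieszC_congr hb hn ((hφ'.mul_left hw).mono (min_le_left Y' Y))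
      ((hφ.tri.mul_left hw).mono (min_le_right Y' Y)) (fun p hp => by rw [he p hp])
      (neg_half_lt m hx)
  rw [tricomi_eq, fundSol_apply, Distribution.delta_apply]
  have h := fundamental_identity hm hb φ
  have hm0 : (0 : ℝ) ≤ m := m.cast_nonneg
  rw [← h0 (by simp; linarith) (smoothNear_regularFactor hb), ← regularDistr_apply hm hb,
    Finset.sum_congr rfl fun j _ => by
      rw [← h0 (by simp; have : (0 : ℝ) ≤ j := j.cast_nonneg; linarith) (smoothNear_wt hb _),
        ← layer_apply hm hb]] at h
  exact_mod_cast h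

/-! ### Supports -/

lemma rieszC_mul_eq_zero (hb : b < 0) (hn : 2 ≤ n) {w : Space n → ℝ} (hw : SmoothNear b w)
    {φ : Test n} (hφ : tsupport φ ⊆ (closure (conoid n b))ᶜ) {q : ℂ}
    (hq : -((n : ℝ) + 1) / 2 < q.re) : rieszC b q (fun p => w p * φ p) = 0 := by
  obtain ⟨Y, hY⟩ := exists_isAdm b φ
  refine rieszC_zero hb hn (hY.mul_left hw) (fun p hp => ?_) hq
  rw [image_eq_zero_of_notMem_tsupport fun h => hφ h (subset_closure hp), mul_zero]

/-- For `l ≥ 0` the distribution `χ_{-l-1}(k)` vanishes inside the conoid: there a test function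
is divisible by `k`, and `k χ_q(k) = (q + 1) χ_{q+1}(k)` vanishes for `q = -1`. -/
lemma rieszC_neg_eq_zero (hb : b < 0) (hn : 2 ≤ n) (l : ℕ) {ψ : Space n → ℝ} (h : IsAdm b Y ψ)
    (hs : tsupport ψ ⊆ conoid n b) (hl : (l : ℝ) + 1 < ((n : ℝ) + 1) / 2) :
    rieszC b (-(l : ℂ) - 1) ψ = 0 := by
  have hχ : IsAdm b Y (fun p => ψ p / k b p) := by
    refine ⟨fun p hp => ContDiffAt.contDiffWithinAt ?_, fun p hp hY => by
      rw [h.zero p hp hY, zero_div]⟩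
    by_cases hc : p ∈ conoid n b
    · exact (h.smooth.contDiffAt (isOpen_nbhd.mem_nhds hp)).div
        (ContDiffOn.contDiffAt smoothNear_k (isOpen_nbhd.mem_nhds hp)) (k_pos_of_mem hc).ne'
    · have h0 := notMem_tsupport_iff_eventuallyEq.1 fun h => hc (hs h)
      refine (contDiffAt_const (c := (0 : ℝ))).congr_of_eventuallyEq ?_
      filter_upwards [h0] with q hq
      simp [hq]
  have hq : -((n : ℝ) + 1) / 2 < (-(l : ℂ) - 1).re := by
    simp only [Complex.sub_re, Complex.neg_re, Complex.natCast_re, Complex.one_re]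
    linarith
  rw [rieszC_congr hb hn h (hχ.mul_left smoothNear_k)
    (fun p hp => (mul_div_cancel₀ _ (k_pos_of_mem hp).ne').symm) hq, rieszC_k_mul hb hn hχ hq]
  cases l with
  | zero => simp
  | succ l =>
    have hs' : tsupport (fun p => ψ p / k b p) ⊆ conoid n b := by
      refine (closure_mono fun p hp => ?_).trans hs
      contrapose! hp
      simp [Function.notMem_support.1 hp]
    have := rieszC_neg_eq_zero hb hn l hχ hs' (by push_cast at hl; linarith)
    have e : -((l + 1 : ℕ) : ℂ) - 1 + 1 = -(l : ℂ) - 1 := by push_cast; ring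
    rw [e, this, mul_zero]

lemma layer_eq_zero_of_conoid (hm : 1 ≤ m) (hb : b < 0) {j : ℕ} (hj : j < m)
    {φ : Test (2 * m + 1)} (hφ : tsupport φ ⊆ conoid (2 * m + 1) b) : layer hm hb j φ = 0 := by
  obtain ⟨Y, hY⟩ := exists_isAdm b φ
  have h := rieszC_neg_eq_zero hb (two_le hm) (m - j - 1) (hY.mul_left (smoothNear_wt hb (j + 1 / 6)))
    ((tsupport_mul_subset_right (f := fun p : Space (2 * m + 1) => wt b (j + 1 / 6) p.2)).trans hφ)
    (by
      rw [Nat.cast_sub (by omega), Nat.cast_sub hj.le]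
      push_cast
      have : (0 : ℝ) ≤ j := j.cast_nonneg
      linarith)
  have hl' : ((m - j - 1 : ℕ) : ℂ) = (m : ℂ) - j - 1 := by
    rw [Nat.cast_sub (by omega), Nat.cast_sub hj.le]; simp
  have e : -((m - j - 1 : ℕ) : ℂ) - 1 = (j : ℂ) - m := by rw [hl']; ring
  rw [e, ← layer_apply hm hb] at h
  exact_mod_cast h

lemma layer_isVanishingOn (hm : 1 ≤ m) (hb : b < 0) (j : ℕ) :
    Distribution.IsVanishingOn (layer hm hb j) (closure (conoid (2 * m + 1) b))ᶜ := fun φ hφ => by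
  have h := rieszC_mul_eq_zero hb (two_le hm) (smoothNear_wt hb (j + 1 / 6)) hφ
    (q := (j : ℂ) - m) (neg_half_lt m (by
      have : (0 : ℝ) ≤ j := j.cast_nonneg
      simp; linarith))
  rw [← layer_apply hm hb] at h
  exact_mod_cast h

lemma regularDistr_isVanishingOn (hm : 1 ≤ m) (hb : b < 0) :
    Distribution.IsVanishingOn (regularDistr hm hb) (closure (conoid (2 * m + 1) b))ᶜ :=
  fun φ hφ => by
  have h := rieszC_mul_eq_zero hb (two_le hm) (smoothNear_regularFactor hb) hφ
    (q := 0) (neg_half_lt m (by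
      have : (0 : ℝ) ≤ m := m.cast_nonneg
      simp; linarith))
  have h' := regularDistr_apply hm hb φ
  rw [h, mul_zero] at h'
  exact_mod_cast h'

lemma fundSol_isVanishingOn (hm : 1 ≤ m) (hb : b < 0) :
    Distribution.IsVanishingOn (fundSol hm hb) (closure (conoid (2 * m + 1) b))ᶜ := fun φ hφ => by
  rw [fundSol_apply, regularDistr_isVanishingOn hm hb φ hφ,
    Finset.sum_eq_zero fun j _ => by rw [layer_isVanishingOn hm hb j φ hφ, mul_zero]]
  simp

lemma A_pos (m : ℕ) : 0 < A m := by
  have := Real.pi_pos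
  unfold A; positivity

lemma regularFactor_pos (hb : b < 0) {p : Space (2 * m + 1)} (hp : p ∈ conoid (2 * m + 1) b) :
    0 < regularFactor m b p := by
  have hz := ratio_pos hb hp
  have h1 : 0 < 1 + ratio b p := by linarith
  refine mul_pos (wt_pos hb _ (hp.2.trans hb)) (mul_pos (Real.rpow_pos_of_pos h1 _) ?_)
  exact ordinaryHypergeometric_pos (by norm_num) (by positivity) (by positivity)
    (div_nonneg hz.le h1.le) ((div_lt_one h1).2 (by linarith))

/-- Near every point of the conoid there is a test function on which the last term does not
vanish, because its density has a fixed sign there. -/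
lemma exists_regularDistr_ne_zero (hm : 1 ≤ m) (hb : b < 0) {s : Set (Space (2 * m + 1))}
    (hs : IsOpen s) {y : Space (2 * m + 1)} (hy : y ∈ s ∩ conoid (2 * m + 1) b) :
    ∃ φ : Test (2 * m + 1), tsupport φ ⊆ s ∩ conoid (2 * m + 1) b ∧ regularDistr hm hb φ ≠ 0 := by
  obtain ⟨f, hf1, hf2, hf3, hf4, hf5⟩ := exists_contDiff_tsupport_subset (n := ⊤)
    ((hs.inter isOpen_conoid).mem_nhds hy)
  let φ : Test (2 * m + 1) := ⟨f, hf3, hf2, subset_univ _⟩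
  refine ⟨φ, hf1, ?_⟩
  rw [regularDistr_eq_integral]
  have hA := A_pos m
  have hc := c_pos m
  refine mul_ne_zero (mul_ne_zero (mul_ne_zero (by simp) hA.ne') hc.ne') (ne_of_gt ?_)
  obtain ⟨Y, hφ⟩ := exists_isAdm b φ
  have hi := (hφ.mul_left (smoothNear_regularFactor hb)).integrableOn_rpow hb (two_le hm)
    (σ := 0) (by norm_num)
  simp only [Real.rpow_zero, one_mul] at hi
  have hnn : ∀ p, 0 ≤ f p := fun p => (hf4 (mem_range_self p)).1
  rw [setIntegral_pos_iff_support_of_nonneg_ae ?_ hi]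
  · have ho : IsOpen (f ⁻¹' {0}ᶜ ∩ conoid (2 * m + 1) b) :=
      (isOpen_compl_singleton.preimage hf3.continuous).inter isOpen_conoid
    refine (ho.measure_pos volume ⟨y, by simp [hf5], hy.2⟩).trans_le (measure_mono ?_)
    rintro p ⟨h1, h2⟩
    exact ⟨mul_ne_zero (regularFactor_pos hb h2).ne' h1, h2⟩
  · filter_upwards [ae_restrict_mem measurableSet_conoid] with p hp
    exact mul_nonneg (regularFactor_pos hb hp).le (hnn p)

lemma fundSol_eq_of_conoid (hm : 1 ≤ m) (hb : b < 0) {φ : Test (2 * m + 1)}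
    (hφ : tsupport φ ⊆ conoid (2 * m + 1) b) : fundSol hm hb φ = regularDistr hm hb φ := by
  rw [fundSol_apply, Finset.sum_eq_zero fun j hj => by
    rw [layer_eq_zero_of_conoid hm hb (Finset.mem_range.1 hj) hφ, mul_zero]]
  simp

lemma dsupport_subset_closure {T : Distr n}
    (h : Distribution.IsVanishingOn T (closure (conoid n b))ᶜ) :
    Distribution.dsupport T ⊆ closure (conoid n b) := fun x hx => by
  by_contra hc
  exact (Distribution.notMem_dsupport_iff x).2 ⟨_, h, isClosed_closure.isOpen_compl, hc⟩ hx

lemma dsupport_regularDistr (hm : 1 ≤ m) (hb : b < 0) :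
    Distribution.dsupport (regularDistr hm hb) = closure (conoid (2 * m + 1) b) := by
  refine (dsupport_subset_closure (regularDistr_isVanishingOn hm hb)).antisymm fun x hx => ?_
  rw [Distribution.mem_dsupport_iff_forall_exists_ne]
  intro s hxs hs
  obtain ⟨y, hy⟩ := mem_closure_iff.1 hx s hs hxs
  obtain ⟨φ, h1, h2⟩ := exists_regularDistr_ne_zero hm hb hs hy
  exact ⟨φ, h1.trans inter_subset_left, h2⟩

lemma dsupport_fundSol (hm : 1 ≤ m) (hb : b < 0) :
    Distribution.dsupport (fundSol hm hb) = closure (conoid (2 * m + 1) b) := by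
  refine (dsupport_subset_closure (fundSol_isVanishingOn hm hb)).antisymm fun x hx => ?_
  rw [Distribution.mem_dsupport_iff_forall_exists_ne]
  intro s hxs hs
  obtain ⟨y, hy⟩ := mem_closure_iff.1 hx s hs hxs
  obtain ⟨φ, h1, h2⟩ := exists_regularDistr_ne_zero hm hb hs hy
  refine ⟨φ, h1.trans inter_subset_left, ?_⟩
  rwa [fundSol_eq_of_conoid hm hb (h1.trans inter_subset_right)]

lemma dsupport_layer_subset (hm : 1 ≤ m) (hb : b < 0) {j : ℕ} (hj : j < m) :
    Distribution.dsupport (layer hm hb j) ⊆ frontier (conoid (2 * m + 1) b) := by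
  rw [frontier, isOpen_conoid.interior_eq]
  refine subset_sdiff.2 ⟨dsupport_subset_closure (layer_isVanishingOn hm hb j), ?_⟩
  exact (Distribution.IsVanishingOn.disjoint_dsupport
    (fun φ hφ => layer_eq_zero_of_conoid hm hb hj hφ) isOpen_conoid).symm

end

end Tricomi

theorem theorem6p2 (m : ℕ) (hm : 1 ≤ m) (b : ℝ) (hb : b < 0) :
    ∃ (B : Fin m → Tricomi.Distr (2 * m + 1)) (R E : Tricomi.Distr (2 * m + 1)),
      (∀ j : Fin m, Tricomi.IsWeightedDelta b (m - j - 1)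
        (fun p ↦ ((Tricomi.u b p - Tricomi.v b p) / 9) ^ (-(j : ℝ) - 1 / 6)) (B j)) ∧
      LocallyIntegrable (Tricomi.regularPart m b) ∧
      (∀ φ : Tricomi.Test (2 * m + 1), R φ = ∫ p, Tricomi.regularPart m b p * φ p) ∧
      E = Tricomi.A m • ∑ j : Fin m, ((-1 : ℝ) ^ (j : ℕ) * Tricomi.c j) • B j + R ∧
      Tricomi.IsFundamentalSolution E (0, b) ∧
      Distribution.dsupport E = closure (Tricomi.conoid (2 * m + 1) b) ∧
      (∀ j : Fin m, Distribution.dsupport (B j) ⊆ frontier (Tricomi.conoid (2 * m + 1) b)) ∧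
      Distribution.dsupport R = closure (Tricomi.conoid (2 * m + 1) b) :=
  ⟨fun j => Tricomi.layer hm hb j, Tricomi.regularDistr hm hb, Tricomi.fundSol hm hb,
    fun j => Tricomi.isWeightedDelta_layer hm hb j.2, Tricomi.locallyIntegrable_regularPart hb,
    Tricomi.regularDistr_eq_integral_regularPart hm hb, rfl,
    Tricomi.isFundamentalSolution_fundSol hm hb, Tricomi.dsupport_fundSol hm hb,
    fun j => Tricomi.dsupport_layer_subset hm hb j.2, Tricomi.dsupport_regularDistr hm hb⟩
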